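/- Let $p$ be a prime and $e\ge 1$. Machines are nondeterministic multitape Turing machines (two-way read-only input tape, finitely many work tapes) over finite alphabets, all of whose branches use work space $O(\log n)$ and halt within time polynomial in the input length $n$. $\#\mathsf L$ is the class of functions $\varphi:\Sigma^*\to\mathbb N$ for which $\varphi(x)$ is the number of accepting branches of some such machine on input $x$. For $k\ge 2$: - $\#_k\mathsf L$ is the class of functions $f:\Sigma^*\to\mathbb Z/k\mathbb Z$ of the form $f(x)=\varphi(x)+k\mathbb Z$ with $\varphi\in\#\mathsf L$; - $\mathsf{coMod}_k\mathsf L$ is the class of languages $L\subseteq\Sigma^*$ for which there is $\varphi\in\#\mathsf L$ with $x\in L\iff\varphi(x)\equiv 0\pmod k$; - $\mathsf{FUL}[k]$ is the class of partial functions $f:\Sigma^*\rightharpoonup\Gamma^*$ for which there is such a machine with, in addition, a one-way write-only output tape (not counted as work space), such that for all $x\in\Sigma^*$ and $y\in\Gamma^*$ the number of accepting branches on input $x$ with output $y$ is $\equiv 1\pmod k$ if $x\in\mathrm{dom}(f)$ and $y=f(x)$, and is $\equiv 0\pmod k$ otherwise; - for a class $\mathcal F$ of functions $f:\Delta^*\to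 R$ with $R$ finite, $\mathsf{coMod}_k\mathsf L^{\mathcal F}$ is the class of languages $L$ for which there are $f\in\mathcal F$ and a machine with oracle $f$, with work space $O(\log n)$ and polynomial time on all branches, such that $x\in L$ iff the number of its accepting branches on $x$ is $\equiv 0\pmod k$. Queries are written on a write-only oracle tape, which does not count as work space and is erased after each query, whose answer determines the next state; as usual for nondeterministic space-bounded oracle machines (the Ruzzo–Simon–Tompa convention), the machine is deterministic from the moment it starts to write a query until the query is made. Then: 1. $\#_{p^e}\mathsf L\subseteq\mathsf{FUL}[p]$. That is, for all finite alphabets $\Sigma,\Gamma$, every fixed injective representation $\mathrm{enc}:\mathbb Z/p^e\mathbb Z\to\Gamma^*$ of the residues by strings, and every $f:\Sigma^*\to\mathbb Z/p^e\mathbb Z$ in $\#_{p^e}\mathsf L$, the function $x\mapsto\mathrm{enc}(f(x))$ belongs to $\mathsf{FUL}[p]$. 2. $\mathsf{coMod}_p\mathsf L^{\#_{p^e}\mathsf L}=\mathsf{coMod}_p\mathsf L$, for languages over any finite alphabet $\Sigma$ and oracle functions in $\#_{p^e}\mathsf L$ over any finite alphabet $\Delta$. -/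

import Mathlib

namespace ModLog

/-! ## Computation branches of a labelled transition system -/

/-- `Branch step c l c'`: the sequence of moves `l` leads from `c` to `c'`. -/
inductive Branch {C M : Type} (step : C → M → C → Prop) : C → List M → C → Prop
  | nil (c : C) : Branch step c [] c
  | cons {c c' c'' : C} {m : M} {l : List M} :
      step c m c' → Branch step c' l c'' → Branch step c (m :: l) c''

/-- The number of branches that start in `c₀` and halt (no further move is possible) in a
configuration satisfying `acc`. -/
noncomputable def numBranches {C M : Type} (step : C → M → C → Prop) (c₀ : C)
    (acc : C → Prop) : ℕ :=
  Set.ncard {l : List M | ∃ c, Branch step c₀ l c ∧ (∀ m c', ¬ step c m c') ∧ acc c}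

/-! ## Nondeterministic Turing machines -/

inductive Dir
  | left
  | stay
  | right

/-- What can be read on the input tape: an end marker or an input symbol. -/
inductive InputSym (A : Type)
  | leftEnd
  | sym (a : A)
  | rightEnd

/-- The input tape with the word `x` has `leftEnd` in cell `0`, the letters of `x` in the cells
`1, …, |x|` and `rightEnd` in cell `|x| + 1`. -/
def readInput {A : Type} (x : List A) : ℕ → InputSym A
  | 0 => InputSym.leftEnd
  | i + 1 => match x[i]? with
    | some a => InputSym.sym a
    | none => InputSym.rightEnd

/-- Moving a head on a one-way infinite tape (the head stays in cell `0` on a left move there). -/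
def moveHead : Dir → ℕ → ℕ
  | Dir.left, i => i - 1
  | Dir.stay, i => i
  | Dir.right, i => i + 1

/-- An instruction: the new state, the symbols to be written on the work tapes, the head moves, and
possibly a symbol to be appended to the write-only tape. -/
structure Action (State Sym Tape B : Type) where
  next : State
  write : Tape → Sym
  moveWork : Tape → Dir
  moveInput : Dir
  emit : Option B

/-- A nondeterministic Turing machine with a two-way read-only input tape over `A`, finitely many
one-way infinite work tapes, and a one-way write-only tape over `B`.  A machine halts when it
has no instruction to follow, and accepts if it then is in an accepting state. -/
structure Machine (A B : Type) where
  State : Type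
  Sym : Type
  Tape : Type
  finite_state : Finite State
  finite_sym : Finite Sym
  finite_tape : Finite Tape
  blank : Sym
  start : State
  accept : Set State
  instr : State → InputSym A → (Tape → Sym) → Set (Action State Sym Tape B)

structure Config (State Sym Tape B : Type) where
  state : State
  inputHead : ℕ
  work : Tape → ℕ → Sym
  workHead : Tape → ℕ
  /-- the contents of the write-only tape -/
  out : List B

namespace Machine

variable {A B : Type} (M : Machine A B)

abbrev Act : Type := Action M.State M.Sym M.Tape B

abbrev Cfg : Type := Config M.State M.Sym M.Tape B

def init : M.Cfg where
  state := M.start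
  inputHead := 0
  work := fun _ _ => M.blank
  workHead := fun _ => 0
  out := []

/-- The instructions that are applicable in configuration `c` on input `x`. -/
def enabled (x : List A) (c : M.Cfg) : Set M.Act :=
  M.instr c.state (readInput x c.inputHead) (fun i => c.work i (c.workHead i))

/-- The effect of an instruction; the input head cannot leave the cells `0, …, |x| + 1`. -/
def apply (x : List A) (c : M.Cfg) (a : M.Act) : M.Cfg where
  state := a.next
  inputHead := min (moveHead a.moveInput c.inputHead) (x.length + 1)
  work := fun i => Function.update (c.work i) (c.workHead i) (a.write i)
  workHead := fun i => moveHead (a.moveWork i) (c.workHead i)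
  out := c.out ++ a.emit.toList

def Step (x : List A) (c : M.Cfg) (a : M.Act) (c' : M.Cfg) : Prop :=
  a ∈ M.enabled x c ∧ c' = M.apply x c a

/-- With respect to the given step relations (one for each input), all branches take time
polynomial, and work space logarithmic, in the length of the input.  The input tape and the
write-only tape do not count as work space. -/
def Bounded {L : Type} (step : List A → M.Cfg → L → M.Cfg → Prop) : Prop :=
  ∃ C : ℕ, ∀ (x : List A) (l : List L) (c : M.Cfg), Branch (step x) M.init l c →
    l.length ≤ C * (x.length + 1) ^ C ∧ ∀ i, c.workHead i ≤ C * (Nat.log 2 x.length + 1)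

/-- `M` is a nondeterministic logspace machine. -/
def IsLogspace : Prop := M.Bounded M.Step

/-- The number of accepting branches on input `x`. -/
noncomputable def numAcc (x : List A) : ℕ :=
  numBranches (M.Step x) M.init (fun c => c.state ∈ M.accept)

/-- The number of accepting branches on input `x` in which `y` is written on the output tape. -/
noncomputable def numAccOut (x : List A) (y : List B) : ℕ :=
  numBranches (M.Step x) M.init (fun c => c.state ∈ M.accept ∧ c.out = y)

end Machine

/-! ## Oracle machines

The write-only tape is the oracle tape, and `R` is a finite type of answers.  If
`M.query q = some g`, then `q` is a query state: for the oracle `f` and the word `w` on the oracle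
tape, the machine enters the state `g (f w)` in one step, and the oracle tape is erased. -/

structure OracleMachine (A B R : Type) extends Machine A B where
  query : State → Option (R → State)

namespace OracleMachine

variable {A B R : Type} (M : OracleMachine A B R)

/-- Steps relative to the oracle `f`; the query steps have the label `none`. -/
inductive Step (f : List B → R) (x : List A) : M.Cfg → Option M.Act → M.Cfg → Prop
  | work {c : M.Cfg} {a : M.Act} : M.query c.state = none → a ∈ M.enabled x c →
      Step f x c (some a) (M.apply x c a)
  | ask {c : M.Cfg} {g : R → M.State} : M.query c.state = some g →
      Step f x c none { c with state := g (f c.out), out := [] }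

/-- `M` is a nondeterministic logspace machine relative to the oracle `f`. -/
def IsLogspace (f : List B → R) : Prop := M.Bounded (M.Step f)

/-- The Ruzzo-Simon-Tompa convention for nondeterministic space-bounded oracle machines: from the
moment it starts to write on the oracle tape until the next query, the machine is deterministic. -/
def DetQueries (f : List B → R) : Prop :=
  ∀ (x : List A) (l : List (Option M.Act)) (c : M.Cfg), Branch (M.Step f x) M.init l c →
    M.query c.state = none →
    (c.out ≠ [] ∨ ∃ a ∈ M.enabled x c, a.emit ≠ none) → (M.enabled x c).Subsingleton

noncomputable def numAcc (f : List B → R) (x : List A) : ℕ :=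
  numBranches (M.Step f x) M.init (fun c => c.state ∈ M.accept)

end OracleMachine

/-! ## Classes -/

/-- `#L`: the numbers of accepting branches of nondeterministic logspace machines (which have no
output tape). -/
def SharpL (A : Type) : Set (List A → ℕ) :=
  {φ | ∃ M : Machine A Empty, M.IsLogspace ∧ ∀ x, φ x = M.numAcc x}

/-- `#_k L` -/
def SharpModL (k : ℕ) (A : Type) : Set (List A → ZMod k) :=
  {f | ∃ φ ∈ SharpL A, ∀ x, f x = (φ x : ZMod k)}

/-- `coMod_k L` -/
def CoModL (k : ℕ) (A : Type) : Set (Language A) :=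
  {L | ∃ φ ∈ SharpL A, ∀ x, x ∈ L ↔ φ x ≡ 0 [MOD k]}

/-- `FUL[k]`, a class of partial functions. -/
def FUL (k : ℕ) (A B : Type) : Set (List A →. List B) :=
  {f | ∃ M : Machine A B, M.IsLogspace ∧ ∀ x y,
    (y ∈ f x → M.numAccOut x y ≡ 1 [MOD k]) ∧ (y ∉ f x → M.numAccOut x y ≡ 0 [MOD k])}

/-- `#L` relative to the oracle `f`. -/
def SharpLOracle {B R : Type} (f : List B → R) (A : Type) : Set (List A → ℕ) :=
  {φ | ∃ M : OracleMachine A B R, M.IsLogspace f ∧ M.DetQueries f ∧ ∀ x, φ x = M.numAcc f x}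

/-- `coMod_k L ^ F` for a class `F` of oracle functions. -/
def CoModLOracle {B R : Type} (k : ℕ) (F : Set (List B → R)) (A : Type) : Set (Language A) :=
  {L | ∃ f ∈ F, ∃ φ ∈ SharpLOracle f A, ∀ x, x ∈ L ↔ φ x ≡ 0 [MOD k]}

end ModLog

/-! Let `f x` be the residue of `φ x` modulo `p ^ e`. For `i < p ^ e` the binomial coefficient
`n.choose i`, taken modulo `p`, depends only on `n` modulo `p ^ e` (`choose_mod_prime_pow`), and
these coefficients form a triangular basis of the functions from `{0, …, p ^ e - 1}` to `ZMod p`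
(`exists_binomial_expansion`). Hence the indicator of `f x = r` is, modulo `p`, a fixed linear
combination of the numbers `(φ x).choose i`.

Each of these numbers counts the `i`-element sets of accepting branches. Since `i` is bounded by a
constant, such a set can be guessed in logarithmic space: its members are followed together along
their common prefix, and where they part the groups are treated one after the other
(`countsSets_tokens`, `exists_choose_prog`). So every residue `r` has a program whose number of
branches is `1` modulo `p` if `f x = r`, and `0` otherwise (`exists_residue_prog`).

For the first claim the residue is guessed, confirmed by its program and written out; wrong guesses
cancel modulo `p` (`lift_mem_FUL`). For the second, every query is replaced by a guess of its
answer, followed by the confirming program with the query as input; again only the true answer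
survives modulo `p` (`iterate_oracleStep`). The query may be too long to be stored. As the machine
is deterministic while it writes, any letter can be recomputed from a saved configuration in which
the oracle tape was empty (`wp_virt`); as the query has polynomial length, registers bounded by a
polynomial in `|x|` still suffice. The reverse inclusion uses machines that never ask.

The machines are obtained from register programs. Their semantics `wp` sums a continuation over all
branches, with values in an arbitrary commutative monoid, so that counts, counts by output and
residues are all instances. The compiler (`comp_run`, `exists_machine`) turns such a program into a
logspace Turing machine with exactly the same counts. -/

namespace ModLog

/-! ## Counting branches -/

section LTS

variable {C M : Type}

/-- `Run step ok acc t c n`: all branches from `c` have length at most `t` and stay in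
configurations satisfying `ok`, and exactly `n` of them halt in `acc`. -/
inductive Run (step : C → M → C → Prop) (ok acc : C → Prop) : ℕ → C → ℕ → Prop
  | accept {t : ℕ} {c : C} : ok c → (∀ m c', ¬ step c m c') → acc c → Run step ok acc t c 1
  | reject {t : ℕ} {c : C} : ok c → (∀ m c', ¬ step c m c') → ¬ acc c → Run step ok acc t c 0
  | move {t : ℕ} {c : C} (s : Finset M) (f : M → C) (n : M → ℕ) : ok c →
      (∀ m c', step c m c' ↔ m ∈ s ∧ c' = f m) → s.Nonempty →
      (∀ m ∈ s, Run step ok acc t (f m) (n m)) → Run step ok acc (t + 1) c (∑ m ∈ s, n m)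

variable {step : C → M → C → Prop} {ok acc : C → Prop}

theorem Run.ok_start {t c n} (h : Run step ok acc t c n) : ok c := by
  cases h <;> assumption

theorem Run.mono {t t' c n} (h : Run step ok acc t c n) (htt : t ≤ t') :
    Run step ok acc t' c n := by
  induction h generalizing t' with
  | accept h1 h2 h3 => exact .accept h1 h2 h3
  | reject h1 h2 h3 => exact .reject h1 h2 h3
  | move s f n h1 h2 h3 _ ih =>
    obtain ⟨t', rfl⟩ : ∃ u, t' = u + 1 := ⟨t' - 1, by omega⟩
    exact .move s f n h1 h2 h3 fun m hm => ih m hm (by omega)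

theorem Run.single {t c c' m n} (hok : ok c) (hs : ∀ m' d, step c m' d ↔ m' = m ∧ d = c')
    (h : Run step ok acc t c' n) : Run step ok acc (t + 1) c n := by
  have := Run.move (step := step) (ok := ok) (acc := acc) (t := t) (c := c) {m} (fun _ => c')
    (fun _ => n) hok (by simpa using hs) (by simp) (by simpa using h)
  simpa using this

theorem Run.pair {t c c₁ c₂ m₁ m₂ n₁ n₂} (hok : ok c) (hne : m₁ ≠ m₂)
    (hs : ∀ m d, step c m d ↔ m = m₁ ∧ d = c₁ ∨ m = m₂ ∧ d = c₂)
    (h₁ : Run step ok acc t c₁ n₁) (h₂ : Run step ok acc t c₂ n₂) :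
    Run step ok acc (t + 1) c (n₁ + n₂) := by
  classical
  have := Run.move (step := step) (ok := ok) (acc := acc) (t := t) (c := c) {m₁, m₂}
    (fun m => if m = m₁ then c₁ else c₂) (fun m => if m = m₁ then n₁ else n₂) hok
    (by
      intro m d
      rw [hs]
      by_cases h : m = m₁
      · subst h; simp [hne]
      · simp [h]) (by simp)
    (by
      intro m hm
      by_cases h : m = m₁
      · simpa [h] using h₁
      · simpa [h] using h₂)
  rw [Finset.sum_pair hne] at this
  simpa [hne.symm] using this

theorem Run.branch {t c n} (h : Run step ok acc t c n) {l c'} (hl : Branch step c l c') :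
    l.length ≤ t ∧ ok c' := by
  induction h generalizing l c' with
  | accept h1 h2 h3 =>
    cases hl with
    | nil => exact ⟨by simp, h1⟩
    | cons hs _ => exact absurd hs (h2 _ _)
  | reject h1 h2 h3 =>
    cases hl with
    | nil => exact ⟨by simp, h1⟩
    | cons hs _ => exact absurd hs (h2 _ _)
  | move s f n h1 h2 h3 _ ih =>
    cases hl with
    | nil => exact ⟨by simp, h1⟩
    | cons hs hb =>
      obtain ⟨hm, rfl⟩ := (h2 _ _).1 hs
      have := ih _ hm hb
      simpa using this

/-- Finiteness is carried through the induction because `Set.ncard` is additive over a disjoint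
union only if the pieces are finite. -/
theorem Run.finite_ncard {t c n} (h : Run step ok acc t c n) :
    {l : List M | ∃ c', Branch step c l c' ∧ (∀ m d, ¬ step c' m d) ∧ acc c'}.Finite ∧
      numBranches step c acc = n := by
  induction h with
  | @accept t c h1 h2 h3 =>
    have : {l : List M | ∃ c', Branch step c l c' ∧ (∀ m d, ¬ step c' m d) ∧ acc c'} = {[]} := by
      ext l
      constructor
      · rintro ⟨c', hb, _⟩
        cases hb with
        | nil => rfl
        | cons hs _ => exact absurd hs (h2 _ _)
      · rintro rfl
        exact ⟨c, .nil c, h2, h3⟩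
    unfold numBranches
    rw [this]
    simp
  | @reject t c h1 h2 h3 =>
    have : {l : List M | ∃ c', Branch step c l c' ∧ (∀ m d, ¬ step c' m d) ∧ acc c'} = ∅ := by
      ext l
      simp only [Set.mem_ofPred_eq, Set.mem_empty_iff_false, iff_false]
      rintro ⟨c', hb, _, ha⟩
      cases hb with
      | nil => exact h3 ha
      | cons hs _ => exact absurd hs (h2 _ _)
    unfold numBranches
    rw [this]
    simp
  | @move t c s f n h1 h2 h3 _ ih =>
    -- An accepting branch consists of its first move and an accepting branch of the successor. The
    -- empty branch is excluded because some move is possible.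
    have key : {l : List M | ∃ c', Branch step c l c' ∧ (∀ m d, ¬ step c' m d) ∧ acc c'} =
        ⋃ m ∈ s, List.cons m ''
          {l : List M | ∃ c', Branch step (f m) l c' ∧ (∀ m d, ¬ step c' m d) ∧ acc c'} := by
      ext l
      simp only [Set.mem_ofPred_eq, Set.mem_iUnion, Set.mem_image, exists_prop]
      constructor
      · rintro ⟨c', hb, hh, ha⟩
        cases hb with
        | nil =>
          obtain ⟨m, hm⟩ := h3
          exact absurd ((h2 m (f m)).2 ⟨hm, rfl⟩) (hh _ _)
        | cons hs hb =>
          obtain ⟨hm, rfl⟩ := (h2 _ _).1 hs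
          exact ⟨_, hm, _, ⟨c', hb, hh, ha⟩, rfl⟩
      · rintro ⟨m, hm, l', ⟨c', hb, hh, ha⟩, rfl⟩
        exact ⟨c', .cons ((h2 _ _).2 ⟨hm, rfl⟩) hb, hh, ha⟩
    have hfin : ∀ m ∈ s, (List.cons m ''
          {l : List M | ∃ c', Branch step (f m) l c' ∧ (∀ m d, ¬ step c' m d) ∧ acc c'}).Finite :=
      fun m hm => (ih m hm).1.image _
    refine ⟨?_, ?_⟩
    · rw [key]
      exact s.finite_toSet.biUnion hfin
    · unfold numBranches
      rw [key]
      have hd : (s : Set M).PairwiseDisjoint (fun m => List.cons m ''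
          {l : List M | ∃ c', Branch step (f m) l c' ∧ (∀ m d, ¬ step c' m d) ∧ acc c'}) := by
        intro m _ m' _ hne
        rw [Function.onFun, Set.disjoint_left]
        rintro _ ⟨l, _, rfl⟩ ⟨l', _, h⟩
        exact hne (List.cons.inj h).1.symm
      have := Set.Finite.ncard_biUnion s.finite_toSet hfin hd
      simp only [SetLike.mem_coe] at this
      rw [this, finsum_mem_finset_eq_sum]
      refine Finset.sum_congr rfl fun m hm => ?_
      rw [Set.ncard_image_of_injective _ (List.cons_injective)]
      exact (ih m hm).2

theorem Run.numBranches_eq {t c n} (h : Run step ok acc t c n) : numBranches step c acc = n :=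
  h.finite_ncard.2

/-- Finite branching and labels that determine the successor turn a bound on all branches into an
inductive certificate. This is how a machine that is only known to be bounded becomes accessible to
induction. -/
theorem exists_run (en : C → Finset M) (f : C → M → C)
    (hs : ∀ c m c', step c m c' ↔ m ∈ en c ∧ c' = f c m) (t : ℕ) (c : C)
    (hb : ∀ l c', Branch step c l c' → l.length ≤ t ∧ ok c') : ∃ n, Run step ok acc t c n := by
  induction t generalizing c with
  | zero =>
    have hno : ∀ m c', ¬ step c m c' := by
      intro m c' h
      have := (hb [m] c' (.cons h (.nil _))).1
      simp at this
    by_cases ha : acc c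
    · exact ⟨1, .accept (hb [] c (.nil c)).2 hno ha⟩
    · exact ⟨0, .reject (hb [] c (.nil c)).2 hno ha⟩
  | succ t ih =>
    by_cases hne : (en c).Nonempty
    · have : ∀ m ∈ en c, ∃ n, Run step ok acc t (f c m) n := by
        intro m hm
        apply ih
        intro l c' hl
        have := hb (m :: l) c' (.cons ((hs _ _ _).2 ⟨hm, rfl⟩) hl)
        simpa using this
      choose! n hn using this
      exact ⟨_, .move (en c) (f c) n (hb [] c (.nil c)).2 (hs c) hne hn⟩
    · have hno : ∀ m c', ¬ step c m c' := by
        intro m c' h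
        exact hne ⟨m, ((hs _ _ _).1 h).1⟩
      by_cases ha : acc c
      · exact ⟨1, .accept (hb [] c (.nil c)).2 hno ha⟩
      · exact ⟨0, .reject (hb [] c (.nil c)).2 hno ha⟩

theorem Branch.append {c c' c'' : C} {l l' : List M} (h : Branch step c l c')
    (h' : Branch step c' l' c'') : Branch step c (l ++ l') c'' := by
  induction h with
  | nil => exact h'
  | cons hs _ ih => exact .cons hs (ih h')

end LTS

/-! ### Finiteness of instructions and input symbols -/

instance Action.finite {State Sym Tape B : Type} [Finite State] [Finite Sym] [Finite Tape]
    [Finite B] : Finite (Action State Sym Tape B) := by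
  have : Finite Dir := by
    refine Finite.of_surjective (fun i : Fin 3 => ![Dir.left, Dir.stay, Dir.right] i) ?_
    rintro (_ | _ | _)
    exacts [⟨0, rfl⟩, ⟨1, rfl⟩, ⟨2, rfl⟩]
  refine Finite.of_injective (fun a : Action State Sym Tape B =>
    (a.next, a.write, a.moveWork, a.moveInput, a.emit)) ?_
  rintro ⟨⟩ ⟨⟩ h
  simpa using h

instance InputSym.finite {A : Type} [Finite A] : Finite (InputSym A) := by
  refine Finite.of_surjective (fun i : Option (Option A) => match i with
    | none => InputSym.leftEnd
    | some none => InputSym.rightEnd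
    | some (some a) => InputSym.sym a) ?_
  rintro (_ | a | _)
  exacts [⟨none, rfl⟩, ⟨some (some a), rfl⟩, ⟨some none, rfl⟩]

/-! ## Register programs -/

/-- Nondeterministic programs over registers indexed by `ι`, with an input word over `A` and a
write-only output over `B`. -/
inductive Prog (A B ι : Type) : Type
  | skip
  | fail
  | inc (i : ι)
  | dec (i : ι)
  | setmax (i : ι)
  | emit (b : B)
  | seq (p q : Prog A B ι)
  | choose (p q : Prog A B ι)
  | ifz (i : ι) (p q : Prog A B ι)
  | ifsym (i : ι) (a : InputSym A) (p q : Prog A B ι)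
  | loop (i : ι) (p : Prog A B ι)

/-! ### Stores and their updates -/

section Upd

variable {ι : Type}

open Classical in
/-- The store `σ` with the register `i` set to `v`. -/
noncomputable def upd (σ : ι → ℕ) (i : ι) (v : ℕ) : ι → ℕ := fun j => if j = i then v else σ j

@[simp] theorem upd_same (σ : ι → ℕ) (i : ι) (v : ℕ) : upd σ i v i = v := by simp [upd]

@[simp] theorem upd_ne (σ : ι → ℕ) {i j : ι} (v : ℕ) (h : j ≠ i) : upd σ i v j = σ j := by
  simp [upd, h]

@[simp] theorem upd_upd (σ : ι → ℕ) (i : ι) (v w : ℕ) : upd (upd σ i v) i w = upd σ i w := by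
  funext j; by_cases h : j = i <;> simp [upd, h]

@[simp] theorem upd_self (σ : ι → ℕ) (i : ι) : upd σ i (σ i) = σ := by
  funext j; by_cases h : j = i <;> simp [upd, h]

theorem upd_eq_self {σ : ι → ℕ} {i : ι} {v : ℕ} (h : σ i = v) : upd σ i v = σ := by
  subst h; simp

theorem upd_comm (σ : ι → ℕ) {i j : ι} (h : i ≠ j) (v w : ℕ) :
    upd (upd σ i v) j w = upd (upd σ j w) i v := by
  funext r; by_cases h1 : r = i <;> by_cases h2 : r = j <;> simp_all [upd]

theorem upd_le {σ : ι → ℕ} {i : ι} {v K : ℕ} (hσ : ∀ r, σ r ≤ K) (hv : v ≤ K) (r : ι) :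
    upd σ i v r ≤ K := by
  by_cases h : r = i
  · subst h; simpa using hv
  · simpa [h] using hσ r

end Upd

/-! ### Counting semantics of register programs -/

section WP

variable {A B ι : Type}

open Classical in
/-- Counting semantics with continuations: `wp x K em p k σ` is the sum of `k` over the results of
the branches of `p` on the store `σ`.  The registers take values at most `K`; a branch in which a
register would exceed `K` fails.  The map `em b` accounts for the emission of `b`. -/
noncomputable def wp (x : List A) (K : ℕ) {R : Type} [AddCommMonoid R] (em : B → R → R) :
    Prog A B ι → ((ι → ℕ) → R) → (ι → ℕ) → R
  | .skip, k, σ => k σ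
  | .fail, _, _ => 0
  | .inc i, k, σ => if σ i < K then k (upd σ i (σ i + 1)) else 0
  | .dec i, k, σ => k (upd σ i (σ i - 1))
  | .setmax i, k, σ => k (upd σ i K)
  | .emit b, k, σ => em b (k σ)
  | .seq p q, k, σ => wp x K em p (wp x K em q k) σ
  | .choose p q, k, σ => wp x K em p k σ + wp x K em q k σ
  | .ifz i p q, k, σ => if σ i = 0 then wp x K em p k σ else wp x K em q k σ
  | .ifsym i a p q, k, σ =>
    if readInput x (σ i) = a then wp x K em p k σ else wp x K em q k σ
  | .loop i p, k, σ => (wp x K em p)^[σ i] k σ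

/-- On the store `σ` the program `p` has a single branch, which leads to `σ'`. -/
structure Det (x : List A) (K : ℕ) (p : Prog A B ι) (σ σ' : ι → ℕ) : Prop where
  wp_eq : ∀ {R : Type} [AddCommMonoid R] (em : B → R → R) (k : (ι → ℕ) → R),
    wp x K em p k σ = k σ'

variable {x : List A} {K : ℕ} {p q : Prog A B ι} {σ τ υ : ι → ℕ}

theorem Det.skip : Det (B := B) x K .skip σ σ := ⟨fun _ _ => rfl⟩

theorem Det.inc {i : ι} (h : σ i < K) : Det (B := B) x K (.inc i) σ (upd σ i (σ i + 1)) :=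
  ⟨fun _ _ => by simp [wp, h]⟩

theorem Det.dec (i : ι) : Det (B := B) x K (.dec i) σ (upd σ i (σ i - 1)) := ⟨fun _ _ => rfl⟩

theorem Det.setmax (i : ι) : Det (B := B) x K (.setmax i) σ (upd σ i K) := ⟨fun _ _ => rfl⟩

theorem Det.seq (h : Det x K p σ τ) (h' : Det x K q τ υ) : Det x K (.seq p q) σ υ :=
  ⟨fun em k => by rw [wp, h.wp_eq, h'.wp_eq]⟩

theorem Det.wp_seq {R : Type} [AddCommMonoid R] {em : B → R → R} {k : (ι → ℕ) → R}
    (h : Det x K p σ τ) : wp x K em (.seq p q) k σ = wp x K em q k τ := by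
  rw [wp, h.wp_eq]

theorem Det.congr (h : Det x K p σ τ) (e : τ = υ) : Det x K p σ υ := e ▸ h

theorem Det.ifz_pos {i : ι} (h : σ i = 0) (hp : Det x K p σ τ) : Det x K (.ifz i p q) σ τ :=
  ⟨fun em k => by rw [wp, if_pos h, hp.wp_eq]⟩

theorem Det.ifz_neg {i : ι} (h : σ i ≠ 0) (hq : Det x K q σ τ) : Det x K (.ifz i p q) σ τ :=
  ⟨fun em k => by rw [wp, if_neg h, hq.wp_eq]⟩

/-- The family `I` is a loop invariant that prescribes the whole store after each pass. -/
theorem Det.iterate (n : ℕ) (I : ℕ → ι → ℕ) (h : ∀ j < n, Det x K p (I j) (I (j + 1)))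
    {R : Type} [AddCommMonoid R] (em : B → R → R) (k : (ι → ℕ) → R) :
    (wp x K em p)^[n] k (I 0) = k (I n) := by
  induction n generalizing k with
  | zero => rfl
  | succ n ih =>
    rw [Function.iterate_succ_apply, ih (fun j hj => h j (by omega)), (h n (by omega)).wp_eq]

theorem Det.loop {i : ι} (I : ℕ → ι → ℕ) (h0 : I 0 = σ)
    (h : ∀ j < σ i, Det x K p (I j) (I (j + 1))) : Det x K (.loop i p) σ (I (σ i)) :=
  ⟨fun em k => by
    have := Det.iterate _ I h em k
    rw [h0] at this
    rw [wp, this]⟩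

/-! ### Deterministic macros -/

namespace Prog

/-- `n` increments -/
def incs (i : ι) : ℕ → Prog A B ι
  | 0 => skip
  | n + 1 => seq (inc i) (incs i n)

/-- The number of passes of a loop is read once, on entry, so the body may change the very register
that is looped over. -/
def clear (i : ι) : Prog A B ι := loop i (dec i)

def setc (i : ι) (n : ℕ) : Prog A B ι := seq (clear i) (incs i n)

def add (i j : ι) : Prog A B ι := loop i (inc j)

def copy (i j : ι) : Prog A B ι := seq (clear j) (add i j)

/-- Branching on whether the register `i` has the value `n`. -/
def ifeq (i : ι) : ℕ → Prog A B ι → Prog A B ι → Prog A B ι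
  | 0, p, q => ifz i p q
  | n + 1, p, q => ifz i q (seq (dec i) (ifeq i n (seq (inc i) p) (seq (inc i) q)))

/-- Multiplication of the register `i` by `b`, with the help of the register `t`. -/
def mulc (i t : ι) (b : ℕ) : Prog A B ι :=
  seq (copy i t) (seq (clear i) (seq (loop t (incs i b)) (clear t)))

/-- Replacing the value `v` of the register `i` by `b * v + w + c`, where `w` is the value of the
register `s`. -/
def push (i s t : ι) (b c : ℕ) : Prog A B ι :=
  seq (mulc i t b) (seq (add s i) (incs i c))

/-- Division of the register `i` by `b`, with the remainder in the register `s`. -/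
def divMod (i s t : ι) (b : ℕ) : Prog A B ι :=
  seq (copy i t) (seq (clear i) (seq (clear s)
    (seq (loop t (seq (inc s) (ifeq s b (seq (clear s) (inc i)) skip))) (clear t))))

/-- Branching on the elements of a list. -/
def anyOf {α : Type} (f : α → Prog A B ι) : List α → Prog A B ι
  | [] => fail
  | a :: l => choose (f a) (anyOf f l)

/-- The composition of the programs for the elements of a list. -/
def each {α : Type} (f : α → Prog A B ι) : List α → Prog A B ι
  | [] => skip
  | a :: l => seq (f a) (each f l)

/-- The program `f a` for the first `a` in the list such that the register `i` has the
value `c a`. -/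
def switch {α : Type} (i : ι) (c : α → ℕ) (f : α → Prog A B ι) : List α → Prog A B ι
  | [] => fail
  | a :: l => ifeq i (c a) (f a) (switch i c f l)

end Prog

open Prog

theorem Det.incs {i : ι} {n : ℕ} (h : σ i + n ≤ K) :
    Det (B := B) x K (incs i n) σ (upd σ i (σ i + n)) := by
  induction n generalizing σ with
  | zero => simpa [Prog.incs] using Det.skip
  | succ n ih =>
    refine (Det.seq (Det.inc (by omega)) (ih (by simp; omega))).congr ?_
    simp [add_comm, add_left_comm]

theorem Det.clear (i : ι) : Det (B := B) x K (clear i) σ (upd σ i 0) := by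
  refine (Det.loop (fun j => upd σ i (σ i - j)) (by simp) ?_).congr (by simp)
  intro j _
  refine (Det.dec i).congr ?_
  simp [Nat.sub_sub]

theorem Det.setc {i : ι} {n : ℕ} (h : n ≤ K) : Det (B := B) x K (setc i n) σ (upd σ i n) :=
  ((Det.clear i).seq (Det.incs (by simpa using h))).congr (by simp)

theorem Det.add {i j : ι} (h : σ i + σ j ≤ K) :
    Det (B := B) x K (add i j) σ (upd σ j (σ i + σ j)) := by
  refine (Det.loop (fun m => upd σ j (m + σ j)) (by simp) ?_)
  intro m hm
  refine (Det.inc (by simp; omega)).congr ?_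
  simp [add_right_comm]

theorem Det.copy {i j : ι} (hij : i ≠ j) (h : σ i ≤ K) :
    Det (B := B) x K (copy i j) σ (upd σ j (σ i)) :=
  ((Det.clear j).seq (Det.add (by simpa [hij] using h))).congr (by simp [hij])

/-- The test counts the register down, and each outcome first counts it up again; the bound on `σ i`
keeps these increments from overflowing, which would kill the branch. -/
theorem wp_ifeq {R : Type} [AddCommMonoid R] {em : B → R → R} {k : (ι → ℕ) → R} {i : ι} {n : ℕ}
    (h : σ i ≤ K) :
    wp x K em (ifeq i n p q) k σ = if σ i = n then wp x K em p k σ else wp x K em q k σ := by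
  induction n generalizing σ p q with
  | zero => rfl
  | succ n ih =>
    by_cases h0 : σ i = 0
    · simp [ifeq, wp, h0]
    · rw [ifeq, wp, if_neg h0, wp, wp, ih (by simp; omega)]
      simp only [upd_same, wp]
      have h1 : σ i - 1 < K := by omega
      have h2 : σ i - 1 + 1 = σ i := by omega
      have h3 : σ i - 1 = n ↔ σ i = n + 1 := by omega
      simp [h1, h2, h3]

theorem Det.ifeq_pos {i : ι} {n : ℕ} (h : σ i = n) (hn : n ≤ K) (hp : Det x K p σ τ) :
    Det x K (ifeq i n p q) σ τ := ⟨fun em k => by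
  rw [wp_ifeq (h ▸ hn), if_pos h, hp.wp_eq]⟩

theorem Det.ifeq_neg {i : ι} {n : ℕ} (h : σ i ≠ n) (hn : σ i ≤ K) (hq : Det x K q σ τ) :
    Det x K (ifeq i n p q) σ τ := ⟨fun em k => by
  rw [wp_ifeq hn, if_neg h, hq.wp_eq]⟩

theorem Det.mulc {i t : ι} {b : ℕ} (hit : i ≠ t) (ht : σ t = 0) (hi : σ i ≤ K)
    (h : b * σ i ≤ K) : Det (B := B) x K (mulc i t b) σ (upd σ i (b * σ i)) := by
  have h1 : Det (B := B) x K (.loop t (Prog.incs i b)) (upd (upd σ t (σ i)) i 0)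
      (upd (upd σ t (σ i)) i (b * σ i)) := by
    have := Det.loop (x := x) (K := K) (p := Prog.incs (A := A) (B := B) i b)
      (σ := upd (upd σ t (σ i)) i 0) (i := t)
      (fun m => upd (upd σ t (σ i)) i (b * m)) (by simp) (by
        intro j hj
        rw [upd_ne _ _ hit.symm, upd_same] at hj
        have : b * (j + 1) ≤ b * σ i := Nat.mul_le_mul le_rfl hj
        refine (Det.incs (by simp; linarith)).congr ?_
        simp [mul_add])
    rw [upd_ne _ _ hit.symm, upd_same] at this
    exact this
  refine (Det.seq (Det.copy hit hi) (Det.seq (Det.clear i) (Det.seq h1 (Det.clear t)))).congr ?_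
  -- The auxiliary register held `0` before, so clearing it restores its old value.
  rw [upd_comm _ hit, upd_upd, upd_eq_self ht]

theorem Det.push {i s t : ι} {b c : ℕ} (hit : i ≠ t) (his : i ≠ s) (ht : σ t = 0)
    (hi : σ i ≤ K) (h : b * σ i + σ s + c ≤ K) :
    Det (B := B) x K (push i s t b c) σ (upd σ i (b * σ i + σ s + c)) := by
  refine (Det.seq (Det.mulc hit ht hi (by omega)) (Det.seq (Det.add ?_) (Det.incs ?_))).congr ?_
  · simp [his.symm]; omega
  · simp [his.symm]; omega
  · simp [his.symm, add_comm]

theorem Det.divMod {i s t : ι} {b : ℕ} (hit : i ≠ t) (his : i ≠ s) (hst : s ≠ t) (ht : σ t = 0)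
    (hi : σ i ≤ K) (hb : 0 < b) (hbK : b ≤ K) :
    Det (B := B) x K (divMod i s t b) σ (upd (upd σ i (σ i / b)) s (σ i % b)) := by
  set σ₁ := upd σ t (σ i) with hσ₁
  -- Invariant: after `m` passes the two registers hold quotient and remainder of `m` by `b`. A
  -- remainder that reaches `b` is reset and carried into the quotient.
  have hloop : Det (B := B) x K (.loop t (.seq (.inc s)
      (Prog.ifeq s b (.seq (Prog.clear s) (.inc i)) .skip)))
      (upd (upd σ₁ i 0) s 0) (upd (upd σ₁ i (σ i / b)) s (σ i % b)) := by
    have := Det.loop (x := x) (K := K) (p := .seq (.inc s)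
      (Prog.ifeq (A := A) (B := B) s b (.seq (Prog.clear s) (.inc i)) .skip))
      (σ := upd (upd σ₁ i 0) s 0) (i := t)
      (fun m => upd (upd σ₁ i (m / b)) s (m % b)) (by simp) (by
        intro j hj
        rw [upd_ne _ _ hst.symm, upd_ne _ _ hit.symm, hσ₁, upd_same] at hj
        have hlt : j % b < b := Nat.mod_lt _ hb
        refine Det.seq (Det.inc (by simp; omega)) ?_
        by_cases hjb : j % b + 1 = b
        · refine (Det.ifeq_pos (by simpa using hjb) hbK
            (Det.seq (Det.clear s) (Det.inc ?_))).congr ?_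
          · simp [his]
            exact lt_of_le_of_lt (Nat.div_le_self _ _) (by omega)
          · have h1 : (j + 1) % b = 0 := by
              rw [← Nat.mod_add_mod, hjb, Nat.mod_self]
            have h2 : (j + 1) / b = j / b + 1 := by
              rw [Nat.succ_div, if_pos (Nat.dvd_of_mod_eq_zero h1)]
            simp only [upd_upd, h1, h2]
            rw [upd_ne _ _ his, upd_same, upd_comm _ his.symm, upd_upd]
        · refine (Det.ifeq_neg (by simpa using hjb) (by simp; omega) Det.skip).congr ?_
          have h1 : (j + 1) % b = j % b + 1 := by
            rw [← Nat.mod_add_mod, Nat.mod_eq_of_lt (by omega)]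
          have h2 : (j + 1) / b = j / b := by
            rw [Nat.succ_div, if_neg (fun h => by
              have := Nat.mod_eq_zero_of_dvd h
              omega)]
            rfl
          simp [h1, h2])
    rw [upd_ne _ _ hst.symm, upd_ne _ _ hit.symm, hσ₁, upd_same] at this
    exact this
  refine (Det.seq (Det.copy hit hi) (Det.seq (Det.clear i) (Det.seq (Det.clear s)
    (Det.seq hloop (Det.clear t))))).congr ?_
  rw [hσ₁, upd_comm _ hst, upd_comm _ hit, upd_upd, upd_eq_self ht]

theorem wp_anyOf {α : Type} {R : Type} [AddCommMonoid R] {em : B → R → R} {k : (ι → ℕ) → R}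
    (f : α → Prog A B ι) (l : List α) :
    wp x K em (anyOf f l) k σ = (l.map fun a => wp x K em (f a) k σ).sum := by
  induction l with
  | nil => rfl
  | cons a l ih => simp [anyOf, wp, ih]

theorem wp_switch {α : Type} {R : Type} [AddCommMonoid R] {em : B → R → R} {k : (ι → ℕ) → R}
    {i : ι} {c : α → ℕ} (f : α → Prog A B ι) {l : List α} {a : α} (ha : a ∈ l)
    (hc : ∀ a' ∈ l, c a' = c a → a' = a) (hi : σ i = c a) (hK : c a ≤ K) :
    wp x K em (switch i c f l) k σ = wp x K em (f a) k σ := by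
  induction l with
  | nil => simp at ha
  | cons a' l ih =>
    rw [switch, wp_ifeq (hi ▸ hK)]
    by_cases h : σ i = c a'
    · rw [if_pos h, hc a' (by simp) (by omega)]
    · rw [if_neg h]
      refine ih ?_ fun a'' h'' => hc a'' (by simp [h''])
      rcases List.mem_cons.1 ha with rfl | h'
      · exact absurd hi h
      · exact h'

end WP

/-! ## Bijective numeration -/

/-- Increment of a number in bijective base `β + 1`, where the digit `d ≤ β` has the value `d + 1`
and the least significant digit comes first. -/
def incL (β : ℕ) : List ℕ → List ℕ
  | [] => [0]
  | d :: l => if d < β then (d + 1) :: l else 0 :: incL β l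

def decL (β : ℕ) : List ℕ → List ℕ
  | [] => []
  | (d + 1) :: l => d :: l
  | 0 :: [] => []
  | 0 :: d :: l => β :: decL β (d :: l)

def valL (β : ℕ) : List ℕ → ℕ
  | [] => 0
  | d :: l => (β + 1) * valL β l + d + 1

/-- In bijective numeration every number has exactly one digit string, and zero has the empty one.
So an empty tape is a register of value `0`, and no leading zeros have to be dealt with. -/
def digs (β n : ℕ) : List ℕ := (incL β)^[n] []

/-- The largest number with `l` digits in bijective base `β + 1`. -/
def maxVal (β : ℕ) : ℕ → ℕ
  | 0 => 0
  | l + 1 => (β + 1) * maxVal β l + β + 1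

theorem incL_ne_nil (β : ℕ) (l : List ℕ) : incL β l ≠ [] := by
  cases l with
  | nil => simp [incL]
  | cons d l => rw [incL]; split_ifs <;> simp

theorem digs_zero (β : ℕ) : digs β 0 = [] := rfl

theorem digs_succ (β n : ℕ) : digs β (n + 1) = incL β (digs β n) :=
  Function.iterate_succ_apply' _ _ _

theorem digs_eq_nil {β n : ℕ} : digs β n = [] ↔ n = 0 := by
  cases n with
  | zero => simp [digs_zero]
  | succ n => simp [digs_succ, incL_ne_nil]

theorem incL_le {β : ℕ} {l : List ℕ} (h : ∀ d ∈ l, d ≤ β) : ∀ d ∈ incL β l, d ≤ β := by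
  induction l with
  | nil => simp [incL]
  | cons d l ih =>
    simp only [List.mem_cons, forall_eq_or_imp] at h
    rw [incL]
    split_ifs with hd
    · simp only [List.mem_cons, forall_eq_or_imp]
      exact ⟨hd, h.2⟩
    · simp only [List.mem_cons, forall_eq_or_imp]
      exact ⟨Nat.zero_le _, ih h.2⟩

theorem digs_le (β n : ℕ) : ∀ d ∈ digs β n, d ≤ β := by
  induction n with
  | zero => simp [digs_zero]
  | succ n ih => rw [digs_succ]; exact incL_le ih

theorem valL_incL {β : ℕ} {l : List ℕ} (h : ∀ d ∈ l, d ≤ β) : valL β (incL β l) = valL β l + 1 := by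
  induction l with
  | nil => simp [incL, valL]
  | cons d l ih =>
    simp only [List.mem_cons, forall_eq_or_imp] at h
    rw [incL]
    split_ifs with hd
    · simp [valL]; ring
    · have : d = β := by omega
      simp [valL, ih h.2, this]; ring

theorem valL_digs (β n : ℕ) : valL β (digs β n) = n := by
  induction n with
  | zero => rfl
  | succ n ih => rw [digs_succ, valL_incL (digs_le β n), ih]

theorem decL_incL {β : ℕ} {l : List ℕ} (h : ∀ d ∈ l, d ≤ β) : decL β (incL β l) = l := by
  induction l with
  | nil => rfl
  | cons d l ih =>
    simp only [List.mem_cons, forall_eq_or_imp] at h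
    rw [incL]
    split_ifs with hd
    · rfl
    · have : d = β := by omega
      obtain ⟨d', l', hl⟩ := List.exists_cons_of_ne_nil (incL_ne_nil β l)
      rw [hl, decL, ← hl, ih h.2, this]

theorem decL_digs (β n : ℕ) : decL β (digs β n) = digs β (n - 1) := by
  cases n with
  | zero => rfl
  | succ n => rw [digs_succ, decL_incL (digs_le β n)]; rfl

theorem decL_spec {β : ℕ} {l : List ℕ} (h : ∀ d ∈ l, d ≤ β) (hl : l ≠ []) :
    incL β (decL β l) = l ∧ ∀ d ∈ decL β l, d ≤ β := by
  induction l with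
  | nil => exact absurd rfl hl
  | cons d l ih =>
    simp only [List.mem_cons, forall_eq_or_imp] at h
    match d, l with
    | d + 1, l =>
      rw [decL, incL, if_pos (by omega)]
      refine ⟨rfl, ?_⟩
      simp only [List.mem_cons, forall_eq_or_imp]
      exact ⟨by omega, h.2⟩
    | 0, [] => simp [decL, incL]
    | 0, d :: l =>
      have := ih h.2 (by simp)
      rw [decL, incL, if_neg (by omega), this.1]
      refine ⟨rfl, ?_⟩
      simp only [List.mem_cons, forall_eq_or_imp]
      exact ⟨le_rfl, this.2⟩

/-- A nonempty string is the increment of its decrement, so every string with admissible digits is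
reached by counting up from the empty one. -/
theorem digs_valL {β : ℕ} (n : ℕ) {l : List ℕ} (h : ∀ d ∈ l, d ≤ β) (hn : valL β l = n) :
    digs β n = l := by
  induction n generalizing l with
  | zero =>
    cases l with
    | nil => rfl
    | cons d l => simp [valL] at hn
  | succ n ih =>
    have hl : l ≠ [] := by rintro rfl; simp [valL] at hn
    obtain ⟨h1, h2⟩ := decL_spec h hl
    have h3 := valL_incL h2
    rw [h1, hn] at h3
    rw [digs_succ, ih h2 (by omega), h1]

theorem valL_replicate (β l : ℕ) : valL β (List.replicate l β) = maxVal β l := by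
  induction l with
  | zero => rfl
  | succ l ih => simp [List.replicate_succ, valL, maxVal, ih]

theorem digs_maxVal (β l : ℕ) : digs β (maxVal β l) = List.replicate l β :=
  digs_valL _ (by simp) (valL_replicate β l)

theorem valL_le_maxVal {β : ℕ} {l : List ℕ} (h : ∀ d ∈ l, d ≤ β) :
    valL β l ≤ maxVal β l.length := by
  induction l with
  | nil => simp [valL]
  | cons d l ih =>
    simp only [List.mem_cons, forall_eq_or_imp] at h
    have := Nat.mul_le_mul_left (β + 1) (ih h.2)
    simp only [valL, List.length_cons, maxVal]
    omega

theorem maxVal_lt_valL {β : ℕ} {l : List ℕ} {n : ℕ} (h : n < l.length) :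
    maxVal β n < valL β l := by
  induction l generalizing n with
  | nil => simp at h
  | cons d l ih =>
    cases n with
    | zero => simp [maxVal, valL]
    | succ n =>
      have := Nat.mul_le_mul_left (β + 1) (ih (n := n) (by simpa using h))
      simp only [valL, maxVal]
      rw [Nat.mul_succ] at this
      omega

/-- Strings of different lengths occupy disjoint consecutive blocks of values, so bounding the cells
used on a tape is the same as bounding the register. -/
theorem length_digs_le {β n l : ℕ} : (digs β n).length ≤ l ↔ n ≤ maxVal β l := by
  constructor
  · intro h
    by_contra! h'
    have h1 := valL_le_maxVal (digs_le β n)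
    rw [valL_digs] at h1
    have h2 : maxVal β (digs β n).length ≤ maxVal β l := by
      rcases h.lt_or_eq with h | h
      · have := maxVal_lt_valL (β := β) (l := List.replicate l β) (n := (digs β n).length) (by simpa)
        rw [valL_replicate] at this
        omega
      · rw [h]
    omega
  · intro h
    by_contra! h'
    have := maxVal_lt_valL (β := β) h'
    rw [valL_digs] at this
    omega

theorem pow_le_maxVal (β l : ℕ) : (β + 1) ^ l ≤ maxVal β l + 1 := by
  induction l with
  | zero => simp [maxVal]
  | succ l ih =>
    have := Nat.mul_le_mul_left (β + 1) ih
    rw [pow_succ', maxVal]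
    nlinarith

theorem maxVal_le_pow (β l : ℕ) : maxVal β l + 1 ≤ (β + 2) ^ l := by
  induction l with
  | zero => simp [maxVal]
  | succ l ih =>
    have := Nat.mul_le_mul_left (β + 2) ih
    rw [pow_succ', maxVal]
    nlinarith

/-! ## Tape contents -/

/-- `base` in cell `0` tells a returning head where to stop; `fence` makes an overflow visible to an
increment and tells `setmax` how far to write. -/
inductive TSym (b : ℕ)
  | base
  | blank
  | fence
  | dig (d : Fin (b + 1))

instance (b : ℕ) : Finite (TSym b) := by
  refine Finite.of_surjective (fun i : Option (Option (Option (Fin (b + 1)))) => match i with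
    | none => TSym.base
    | some none => TSym.blank
    | some (some none) => TSym.fence
    | some (some (some d)) => TSym.dig d) ?_
  rintro (_ | _ | _ | d)
  exacts [⟨none, rfl⟩, ⟨some none, rfl⟩, ⟨some (some none), rfl⟩, ⟨some (some (some d)), rfl⟩]

/-- The digit `d` as a tape symbol. -/
def digit (b d : ℕ) : TSym b := TSym.dig (Fin.ofNat (b + 1) d)

/-- The tape with a marker in cell `0`, followed by the digits in the list; there is a stop marker
in cell `m`, unless `m = 0`. -/
def content (b m : ℕ) (l : List ℕ) (j : ℕ) : TSym b :=
  if j = 0 then .base else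
    match l[j - 1]? with
    | some d => digit b d
    | none => if j = m then .fence else .blank

variable {b m : ℕ}

theorem content_zero (l : List ℕ) : content b m l 0 = .base := rfl

theorem content_head (pre : List ℕ) (d : ℕ) (l : List ℕ) :
    content b m (pre ++ d :: l) (pre.length + 1) = digit b d := by
  simp [content]

theorem content_end (pre : List ℕ) :
    content b m pre (pre.length + 1) = if pre.length + 1 = m then .fence else .blank := by
  simp [content]

theorem content_ne_base (l : List ℕ) {j : ℕ} (hj : j ≠ 0) : content b m l j ≠ .base := by
  simp only [content, hj, if_false]
  split
  · simp [digit]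
  · split_ifs <;> simp

theorem update_content_head (pre : List ℕ) (d d' : ℕ) (l : List ℕ) :
    Function.update (content b m (pre ++ d :: l)) (pre.length + 1) (digit b d') =
      content b m (pre ++ d' :: l) := by
  funext j
  by_cases h : j = pre.length + 1
  · subst h; simp [content]
  · rw [Function.update_of_ne h]
    by_cases h0 : j = 0
    · simp [content, h0]
    · have : (pre ++ d :: l)[j - 1]? = (pre ++ d' :: l)[j - 1]? := by
        rcases lt_or_ge (j - 1) pre.length with h1 | h1
        · rw [List.getElem?_append_left h1, List.getElem?_append_left h1]
        · rw [List.getElem?_append_right h1, List.getElem?_append_right h1]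
          obtain ⟨r, hr⟩ : ∃ r, j - 1 - pre.length = r + 1 :=
            ⟨j - 1 - pre.length - 1, by omega⟩
          rw [hr]; rfl
      simp [content, this]

theorem update_content_end (pre : List ℕ) (d : ℕ) :
    Function.update (content b m pre) (pre.length + 1) (digit b d) = content b m (pre ++ [d]) := by
  funext j
  by_cases h : j = pre.length + 1
  · subst h; simp [content]
  · rw [Function.update_of_ne h]
    by_cases h0 : j = 0
    · simp [content, h0]
    · have : pre[j - 1]? = (pre ++ [d])[j - 1]? := by
        rcases lt_or_ge (j - 1) pre.length with h1 | h1
        · rw [List.getElem?_append_left h1]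
        · rw [List.getElem?_append_right h1, List.getElem?_eq_none h1]
          obtain ⟨r, hr⟩ : ∃ r, j - 1 - pre.length = r + 1 :=
            ⟨j - 1 - pre.length - 1, by omega⟩
          rw [hr]; rfl
      simp [content, this]

theorem update_content_erase (pre : List ℕ) (d : ℕ) (hm : pre.length + 1 ≠ m) :
    Function.update (content b m (pre ++ [d])) (pre.length + 1) .blank = content b m pre := by
  rw [← update_content_end, Function.update_idem]
  convert Function.update_eq_self (pre.length + 1) (content b m pre) using 2
  rw [content_end, if_neg hm]

/-! ## Machines given by lists of instructions -/

/-- An instruction on a register takes several machine steps: `walk` propagates a carry or borrow to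
the right, `back` returns the head to cell `1`, and `erase` removes a top digit that a borrow has
made superfluous. -/
inductive Phase
  | run
  | walk
  | back
  | erase

instance : Finite Phase := by
  refine Finite.of_surjective
    (fun i : Fin 4 => ![Phase.run, Phase.walk, Phase.back, Phase.erase] i) ?_
  rintro (_ | _ | _ | _)
  exacts [⟨0, rfl⟩, ⟨1, rfl⟩, ⟨2, rfl⟩, ⟨3, rfl⟩]

/-- Instructions of a machine with registers indexed by `T`; the target of a jump is an absolute
address. -/
inductive Instr (A B T : Type)
  | inc (t : T)
  | dec (t : T)
  | setmax (t : T)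
  | jz (t : T) (j : ℕ)
  | jmp (j : ℕ)
  | fork (j : ℕ)
  | hreset
  | hright
  | jsym (a : InputSym A) (j : ℕ)
  | emit (b : B)
  | mark
  | fail

namespace Instr

variable {A B T Q : Type} {b : ℕ}

/-- The action that changes nothing but the state, the input head and the output. -/
def idle (q : Q) (s : T → TSym b) (d : Dir) (e : Option B) : Action Q (TSym b) T B :=
  ⟨q, s, fun _ => .stay, d, e⟩

/-- The action on the tape `t` only. -/
def onTape [DecidableEq T] (q : Q) (s : T → TSym b) (t : T) (a : TSym b) (d : Dir) :
    Action Q (TSym b) T B :=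
  ⟨q, Function.update s t a, Function.update (fun _ => .stay) t d, .stay, none⟩

open Classical in
/-- The actions for an instruction: `q ph` is the state with the same address and phase `ph`,
and `r j` is the state at the beginning of the instruction at address `j`; `n` is the
next address. -/
noncomputable def acts [DecidableEq T] (β : T → ℕ) (cnt : T) (q : Phase → Q) (r : ℕ → Q) (n : ℕ)
    (i : InputSym A) (s : T → TSym b) : Instr A B T → Phase → Set (Action Q (TSym b) T B)
  | inc t, .run | inc t, .walk => match s t with
    | .dig d => if d.val < β t then {onTape (q .back) s t (digit b (d.val + 1)) .stay}
        else {onTape (q .walk) s t (digit b 0) .right}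
    | .blank => {onTape (q .back) s t (digit b 0) .stay}
    | _ => ∅
  | dec t, .run => match s t with
    | .dig d => if d.val = 0 then {onTape (q .walk) s t (digit b (β t)) .right}
        else {onTape (q .back) s t (digit b (d.val - 1)) .stay}
    | _ => {idle (r n) s .stay none}
  | dec t, .walk => match s t with
    | .dig d => if d.val = 0 then {onTape (q .walk) s t (digit b (β t)) .right}
        else {onTape (q .back) s t (digit b (d.val - 1)) .stay}
    | a => {onTape (q .erase) s t a .left}
  | dec t, .erase => {onTape (q .back) s t .blank .stay}
  | setmax t, .run | setmax t, .walk => match s t with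
    | .base => ∅
    | .fence => {onTape (q .back) s t .fence .stay}
    | _ => {onTape (q .walk) s t (digit b (β t)) .right}
  | inc t, .back | dec t, .back | setmax t, .back => match s t with
    | .base => {onTape (r n) s t .base .right}
    | a => {onTape (q .back) s t a .left}
  | jz t j, .run => match s t with
    | .dig _ => {idle (r n) s .stay none}
    | _ => {idle (r j) s .stay none}
  | jmp j, .run => {idle (r j) s .stay none}
  | fork j, .run => {idle (r n) s .stay none, idle (r j) s .stay none}
  | hreset, .run => match i with
    | .leftEnd => {idle (r n) s .stay none}
    | _ => {idle (q .run) s .left none}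
  | hright, .run => {idle (r n) s .right none}
  | jsym a j, .run => if i = a then {idle (r j) s .stay none} else {idle (r n) s .stay none}
  | emit e, .run => {idle (r n) s .stay (some e)}
  | mark, .run | mark, .walk => match s cnt with
    | .dig _ => {⟨q .walk, s, fun _ => .right, .stay, none⟩}
    | _ => {⟨q .back, fun t => if t = cnt then s t else .fence, fun _ => .stay, .stay, none⟩}
  | mark, .back => match s cnt with
    | .base => {⟨r n, s, fun _ => .right, .stay, none⟩}
    | _ => {⟨q .back, s, fun _ => .left, .stay, none⟩}
  | _, _ => ∅

end Instr

section Mach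

variable {A B T : Type} [Finite T] [DecidableEq T]

/-- The machine for a list of instructions.  The register `t` is kept on the tape `t`, in bijective
base `β t + 1`. -/
noncomputable abbrev mach (b : ℕ) (β : T → ℕ) (cnt : T) (code : List (Instr A B T)) :
    Machine A B where
  State := Option (Fin (code.length + 1) × Phase)
  Sym := TSym b
  Tape := T
  finite_state := inferInstance
  finite_sym := inferInstance
  finite_tape := inferInstance
  blank := .blank
  start := none
  accept := {some (Fin.last _, .run)}
  instr q i s := match q with
    | none => {⟨some (0, .run), fun _ => .base, fun _ => .right, .stay, none⟩}
    | some (pc, ph) => match code[pc.val]? with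
      | none => ∅
      | some c => c.acts β cnt (fun ph => some (pc, ph))
          (fun j => some (Fin.ofNat (code.length + 1) j, .run)) (pc.val + 1) i s ph

variable (b : ℕ) (β : T → ℕ) (cnt : T) (code : List (Instr A B T))

/-- The configuration at address `pc` in phase `ph`. -/
def mcfg (pc : ℕ) (ph : Phase) (h : ℕ) (w : T → ℕ → TSym b) (hd : T → ℕ) (o : List B) :
    (mach b β cnt code).Cfg :=
  ⟨some (Fin.ofNat (code.length + 1) pc, ph), h, w, hd, o⟩

/-- The branches of the machine with heads in the cells up to `S`; they accept if the output
is `y`. -/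
abbrev MRun (x : List A) (S : ℕ) (y : List B) (t : ℕ) (c : (mach b β cnt code).Cfg) (n : ℕ) : Prop :=
  Run ((mach b β cnt code).Step x) (fun c => ∀ i, c.workHead i ≤ S)
    (fun c => c.state ∈ (mach b β cnt code).accept ∧ c.out = y) t c n

variable {b β cnt code} {x : List A} {S : ℕ} {y : List B} {t n : ℕ}

theorem MRun.step {c : (mach b β cnt code).Cfg} {a} (hen : (mach b β cnt code).enabled x c = {a})
    (hS : ∀ i, c.workHead i ≤ S) (h : MRun b β cnt code x S y t ((mach b β cnt code).apply x c a) n) :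
    MRun b β cnt code x S y (t + 1) c n := by
  refine Run.single (m := a) hS (fun m' d => ?_) h
  unfold Machine.Step
  rw [hen]
  constructor
  · rintro ⟨h1, rfl⟩
    obtain rfl := h1
    exact ⟨rfl, rfl⟩
  · rintro ⟨rfl, rfl⟩
    exact ⟨rfl, rfl⟩

variable {pc h : ℕ} {w : T → ℕ → TSym b} {hd : T → ℕ} {o : List B} {ph : Phase}
  {ins : Instr A B T}

theorem lt_of_getElem?_eq_some {α : Type} {l : List α} {i : ℕ} {a : α} (h : l[i]? = some a) :
    i < l.length := by
  obtain ⟨h, _⟩ := List.getElem?_eq_some_iff.1 h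
  exact h

theorem enabled_mcfg (hc : code[pc]? = some ins) :
    (mach b β cnt code).enabled x (mcfg b β cnt code pc ph h w hd o) =
      ins.acts β cnt (fun ph => some (Fin.ofNat (code.length + 1) pc, ph))
          (fun j => some (Fin.ofNat (code.length + 1) j, .run)) (pc + 1) (readInput x h)
          (fun i => w i (hd i)) ph := by
  have hlt : pc % (code.length + 1) = pc :=
    Nat.mod_eq_of_lt (by have := lt_of_getElem?_eq_some hc; omega)
  have hval : (Fin.ofNat (code.length + 1) pc).val = pc := hlt
  simp only [Machine.enabled, mcfg, hval, hc]

theorem apply_idle {pc' : ℕ} {ph' : Phase} {d : Dir} {e : Option B} :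
    (mach b β cnt code).apply x (mcfg b β cnt code pc ph h w hd o)
      (Instr.idle (some (Fin.ofNat (code.length + 1) pc', ph')) (fun i => w i (hd i)) d e) =
      mcfg b β cnt code pc' ph' (min (moveHead d h) (x.length + 1)) w hd (o ++ e.toList) := by
  simp [Machine.apply, mcfg, Instr.idle, moveHead]

theorem apply_onTape (hh : h ≤ x.length + 1) {pc' : ℕ} {ph' : Phase} {r : T} {a : TSym b} {d : Dir} :
    (mach b β cnt code).apply x (mcfg b β cnt code pc ph h w hd o)
      (Instr.onTape (some (Fin.ofNat (code.length + 1) pc', ph')) (fun i => w i (hd i)) r a d) =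
      mcfg b β cnt code pc' ph' h (Function.update w r (Function.update (w r) (hd r) a))
        (Function.update hd r (moveHead d (hd r))) o := by
  simp only [Machine.apply, mcfg, Instr.onTape, moveHead, min_eq_left hh, Option.toList_none,
    List.append_nil]
  congr 1
  · funext i
    by_cases hi : i = r
    · subst hi; simp
    · simp [hi]
  · funext i
    by_cases hi : i = r
    · subst hi; simp
    · simp [hi]

/-- The configuration at address `pc` in phase `ph`, with the contents `u` of the tape `r` and
the head of this tape in cell `j`. -/
abbrev tcfg (pc : ℕ) (ph : Phase) (h : ℕ) (w : T → ℕ → TSym b) (hd : T → ℕ) (o : List B)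
    (r : T) (u : ℕ → TSym b) (j : ℕ) : (mach b β cnt code).Cfg :=
  mcfg b β cnt code pc ph h (Function.update w r u) (Function.update hd r j) o

variable {r : T} {u : ℕ → TSym b} {j : ℕ}

theorem MRun.onTape (hc : code[pc]? = some ins) (hh : h ≤ x.length + 1) (hS : ∀ i, hd i ≤ S)
    (hj : j ≤ S) {pc' : ℕ} {ph' : Phase} {a : TSym b} {d : Dir}
    (hacts : ins.acts β cnt (fun ph => some (Fin.ofNat (code.length + 1) pc, ph))
      (fun j => some (Fin.ofNat (code.length + 1) j, .run)) (pc + 1) (readInput x h)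
      (fun i => (Function.update w r u) i ((Function.update hd r j) i)) ph =
      {Instr.onTape (some (Fin.ofNat (code.length + 1) pc', ph'))
        (fun i => (Function.update w r u) i ((Function.update hd r j) i)) r a d})
    (H : MRun b β cnt code x S y t
      (tcfg pc' ph' h w hd o r (Function.update u j a) (moveHead d j)) n) :
    MRun b β cnt code x S y (t + 1) (tcfg pc ph h w hd o r u j) n := by
  refine MRun.step ((enabled_mcfg hc).trans hacts) ?_ ?_
  · intro i
    change Function.update hd r j i ≤ S
    by_cases hi : i = r
    · subst hi; simpa
    · simpa [hi] using hS i
  · rw [apply_onTape hh]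
    simpa using H

theorem MRun.idle (hc : code[pc]? = some ins) (hS : ∀ i, hd i ≤ S)
    {pc' : ℕ} {ph' : Phase} {d : Dir} {e : Option B}
    (hacts : ins.acts β cnt (fun ph => some (Fin.ofNat (code.length + 1) pc, ph))
      (fun j => some (Fin.ofNat (code.length + 1) j, .run)) (pc + 1) (readInput x h)
      (fun i => w i (hd i)) ph =
      {Instr.idle (some (Fin.ofNat (code.length + 1) pc', ph')) (fun i => w i (hd i)) d e})
    (H : MRun b β cnt code x S y t
      (mcfg b β cnt code pc' ph' (min (moveHead d h) (x.length + 1)) w hd (o ++ e.toList)) n) :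
    MRun b β cnt code x S y (t + 1) (mcfg b β cnt code pc ph h w hd o) n :=
  MRun.step ((enabled_mcfg hc).trans hacts) hS (by rw [apply_idle]; exact H)

/-! ### The instructions that use a register -/

theorem MRun.back (hc : code[pc]? = some ins) (hins : ins = .inc r ∨ ins = .dec r ∨ ins = .setmax r)
    (hh : h ≤ x.length + 1) (hS : ∀ i, hd i ≤ S) (hj : j ≤ S)
    (hu : ∀ i, u i = .base ↔ i = 0)
    (H : MRun b β cnt code x S y t (tcfg (pc + 1) .run h w hd o r u 1) n) :
    MRun b β cnt code x S y (t + (j + 1)) (tcfg pc .back h w hd o r u j) n := by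
  induction j with
  | zero =>
    refine MRun.onTape hc hh hS hj (pc' := pc + 1) (ph' := .run) (a := .base) (d := .right) ?_ ?_
    · have : u 0 = .base := (hu 0).2 rfl
      rcases hins with rfl | rfl | rfl <;> simp [Instr.acts, this]
    · have : u 0 = .base := (hu 0).2 rfl
      rw [← this, Function.update_eq_self]
      exact H
  | succ j ih =>
    refine MRun.onTape hc hh hS hj (pc' := pc) (ph' := .back) (a := u (j + 1)) (d := .left) ?_ ?_
    · have : u (j + 1) ≠ .base := fun h => by simpa using (hu _).1 h
      rcases hins with rfl | rfl | rfl <;> simp only [Instr.acts, Function.update_self]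
    · rw [Function.update_eq_self]
      exact ih (by omega)

theorem content_base_iff {m : ℕ} {l : List ℕ} (i : ℕ) : content b m l i = .base ↔ i = 0 :=
  ⟨fun h => by_contra fun h0 => content_ne_base l h0 h, fun h => h ▸ rfl⟩

/-- The induction runs over the digits `l` from the head on, while `pre` collects those the carry
has already passed. The time covers the way out and the return over both parts. -/
theorem MRun.inc_walk (hc : code[pc]? = some (.inc r)) (hβ : β r ≤ b)
    (hh : h ≤ x.length + 1) (hS : ∀ i, hd i ≤ S) {m : ℕ} {pre l : List ℕ}
    (hl : ∀ d ∈ l, d ≤ β r) (hm : m = 0 ∨ pre.length + (incL (β r) l).length < m)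
    (hlen : pre.length + (incL (β r) l).length ≤ S) (hph : ph = .run ∨ ph = .walk)
    (H : MRun b β cnt code x S y t
      (tcfg (pc + 1) .run h w hd o r (content b m (pre ++ incL (β r) l)) 1) n) :
    MRun b β cnt code x S y (t + (2 * l.length + pre.length + 3))
      (tcfg pc ph h w hd o r (content b m (pre ++ l)) (pre.length + 1)) n := by
  induction l generalizing pre ph with
  | nil =>
    simp only [incL, List.length_singleton] at hm hlen
    have h1 := MRun.back hc (.inl rfl) hh hS (j := pre.length + 1) hlen content_base_iff H
    refine (MRun.onTape hc hh hS hlen (pc' := pc) (ph' := .back) (a := digit b 0) (d := .stay) ?_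
      ?_ (t := t + (pre.length + 1 + 1))).mono (by simp)
    · have : content b m (pre ++ []) (pre.length + 1) = .blank := by
        rw [List.append_nil, content_end, if_neg (by omega)]
      rcases hph with rfl | rfl <;> simp only [Instr.acts, Function.update_self, this]
    · rw [List.append_nil, update_content_end]
      exact h1
  | cons d l ih =>
    simp only [List.mem_cons, forall_eq_or_imp] at hl
    have hd' : d % (b + 1) = d := Nat.mod_eq_of_lt (by omega)
    by_cases hdβ : d < β r
    · rw [incL, if_pos hdβ] at H hm hlen
      have hlen' : pre.length + 1 ≤ S := by simp at hlen; omega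
      have h1 := MRun.back hc (.inl rfl) hh hS (j := pre.length + 1) hlen' content_base_iff H
      refine (MRun.onTape hc hh hS hlen' (pc' := pc) (ph' := .back) (a := digit b (d + 1))
        (d := .stay) ?_ ?_ (t := t + (pre.length + 1 + 1))).mono (by simp)
      · rcases hph with rfl | rfl <;> simp [Instr.acts, content_head, digit, hd', hdβ]
      · rw [update_content_head]
        exact h1
    · rw [incL, if_neg hdβ] at H hm hlen
      have hlen' : pre.length + 1 ≤ S := by simp at hlen; omega
      have h1 := ih (pre := pre ++ [0]) (ph := .walk) hl.2 (by simp at hm ⊢; omega)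
        (by simp at hlen ⊢; omega) (.inr rfl) (by simpa using H)
      refine (MRun.onTape hc hh hS hlen' (pc' := pc) (ph' := .walk) (a := digit b 0)
        (d := .right) ?_ ?_ (t := t + (2 * l.length + (pre.length + 1) + 3))).mono
        (by simp; omega)
      · rcases hph with rfl | rfl <;> simp [Instr.acts, content_head, digit, hd', hdβ]
      · rw [update_content_head]
        simpa [moveHead] using h1

/-- An increment beyond the stop marker. -/
theorem MRun.inc_stop (hc : code[pc]? = some (.inc r)) (hβ : β r ≤ b)
    (hh : h ≤ x.length + 1) (hS : ∀ i, hd i ≤ S) {m : ℕ} {pre l : List ℕ}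
    (hl : ∀ d ∈ l, d ≤ β r) (hm : m = pre.length + l.length + 1)
    (hlt : l.length < (incL (β r) l).length)
    (hlen : m ≤ S) (hph : ph = .run ∨ ph = .walk) :
    MRun b β cnt code x S y (t + l.length)
      (tcfg pc ph h w hd o r (content b m (pre ++ l)) (pre.length + 1)) 0 := by
  induction l generalizing pre ph with
  | nil =>
    have hno : (mach b β cnt code).enabled x (tcfg pc ph h w hd o r (content b m (pre ++ []))
        (pre.length + 1)) = ∅ := by
      refine (enabled_mcfg hc).trans ?_
      have : content b m (pre ++ []) (pre.length + 1) = .fence := by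
        rw [List.append_nil, content_end, if_pos (by simpa using hm.symm)]
      rcases hph with rfl | rfl <;> simp only [Instr.acts, Function.update_self, this]
    refine Run.reject ?_ ?_ ?_
    · intro i
      change Function.update hd r _ i ≤ S
      by_cases hi : i = r
      · subst hi; simp at hm ⊢; omega
      · simpa [hi] using hS i
    · rintro a c ⟨ha, _⟩
      rw [hno] at ha
      exact ha
    -- The machine is stuck at an address inside the code, whereas acceptance is the address just
    -- past it.
    · rintro ⟨hacc, -⟩
      have h1 := lt_of_getElem?_eq_some hc
      have h2 : Fin.ofNat (code.length + 1) pc = Fin.last _ := by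
        have : some (Fin.ofNat (code.length + 1) pc, ph) = some (Fin.last _, Phase.run) := hacc
        simp only [Option.some.injEq, Prod.mk.injEq] at this
        exact this.1
      have h3 := congrArg Fin.val h2
      simp only [Fin.ofNat, Fin.val_last] at h3
      rw [Nat.mod_eq_of_lt (by omega)] at h3
      omega
  | cons d l ih =>
    simp only [List.mem_cons, forall_eq_or_imp] at hl
    have hd' : d % (b + 1) = d := Nat.mod_eq_of_lt (by omega)
    have hdβ : ¬ d < β r := by
      intro h
      rw [incL, if_pos h] at hlt
      simp at hlt
    rw [incL, if_neg hdβ] at hlt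
    have h1 := ih (pre := pre ++ [0]) (ph := .walk) hl.2 (by simp at hm ⊢; omega)
      (by simpa using hlt) (.inr rfl)
    refine (MRun.onTape hc hh hS (by simp at hm; omega) (pc' := pc) (ph' := .walk)
      (a := digit b 0) (d := .right) ?_ ?_ (t := t + l.length)).mono (by simp)
    · rcases hph with rfl | rfl <;> simp [Instr.acts, content_head, digit, hd', hdβ]
    · rw [update_content_head]
      simpa [moveHead] using h1

/-- A borrow from the top digit shortens the string, but the head notices this only one cell further
on, at a blank or at the stop marker; hence the extra cell in `hlen` and the phase `erase`. -/
theorem MRun.dec_walk (hc : code[pc]? = some (.dec r)) (hβ : β r ≤ b)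
    (hh : h ≤ x.length + 1) (hS : ∀ i, hd i ≤ S) {m : ℕ} {pre l : List ℕ}
    (hl : ∀ d ∈ l, d ≤ β r) (hm : m = 0 ∨ pre.length + l.length < m)
    (hlen : pre.length + l.length + 1 ≤ S) (hne : l ≠ [])
    (hph : ph = .run ∨ ph = .walk)
    (H : MRun b β cnt code x S y t
      (tcfg (pc + 1) .run h w hd o r (content b m (pre ++ decL (β r) l)) 1) n) :
    MRun b β cnt code x S y (t + (2 * l.length + pre.length + 4))
      (tcfg pc ph h w hd o r (content b m (pre ++ l)) (pre.length + 1)) n := by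
  induction l generalizing pre ph with
  | nil => exact absurd rfl hne
  | cons d l ih =>
    simp only [List.mem_cons, forall_eq_or_imp] at hl
    have hd' : d % (b + 1) = d := Nat.mod_eq_of_lt (by omega)
    have hlen' : pre.length + 1 ≤ S := by simp at hlen; omega
    match d, l with
    | d + 1, l =>
      rw [decL] at H
      have h1 := MRun.back hc (.inr (.inl rfl)) hh hS (j := pre.length + 1) hlen' content_base_iff H
      refine (MRun.onTape hc hh hS hlen' (pc' := pc) (ph' := .back) (a := digit b d)
        (d := .stay) ?_ ?_ (t := t + (pre.length + 1 + 1))).mono (by simp; omega)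
      · rcases hph with rfl | rfl <;> simp [Instr.acts, content_head, digit, hd']
      · rw [update_content_head]
        exact h1
    | 0, [] =>
      rw [decL, List.append_nil] at H
      have h1 := MRun.back hc (.inr (.inl rfl)) hh hS (j := pre.length + 1) hlen' content_base_iff H
      have h2 : MRun b β cnt code x S y (t + (pre.length + 1 + 1) + 1) (tcfg pc .erase h w hd o r
          (content b m (pre ++ [β r])) (pre.length + 1)) n := by
        refine MRun.onTape hc hh hS hlen' (pc' := pc) (ph' := .back) (a := .blank)
          (d := .stay) ?_ ?_
        · simp [Instr.acts]
        · rw [update_content_erase _ _ (by simp at hm; omega)]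
          exact h1
      have h3 : MRun b β cnt code x S y (t + (pre.length + 1 + 1) + 1 + 1)
          (tcfg pc .walk h w hd o r (content b m (pre ++ [β r])) (pre.length + 1 + 1)) n := by
        refine MRun.onTape hc hh hS (by simpa using hlen) (pc' := pc) (ph' := .erase)
          (a := content b m (pre ++ [β r]) (pre.length + 1 + 1)) (d := .left) ?_ ?_
        · have := content_end (b := b) (m := m) (pre ++ [β r])
          simp only [List.length_append, List.length_singleton] at this
          simp only [Instr.acts, Function.update_self, this]
          split_ifs <;> rfl
        · rw [Function.update_eq_self]
          exact h2
      refine (MRun.onTape hc hh hS hlen' (pc' := pc) (ph' := .walk) (a := digit b (β r))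
        (d := .right) ?_ ?_ (t := t + (pre.length + 1 + 1) + 1 + 1)).mono (by simp; omega)
      · rcases hph with rfl | rfl <;> simp [Instr.acts, content_head, digit]
      · rw [update_content_head]
        exact h3
    | 0, d :: l =>
      rw [decL] at H
      have h1 := ih (pre := pre ++ [β r]) (ph := .walk) hl.2 (by simp at hm ⊢; omega)
        (by simp at hlen ⊢; omega) (by simp) (.inr rfl) (by simpa using H)
      refine (MRun.onTape hc hh hS hlen' (pc' := pc) (ph' := .walk) (a := digit b (β r))
        (d := .right) ?_ ?_
        (t := t + (2 * (d :: l).length + (pre ++ [β r]).length + 4))).mono (by simp; omega)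
      · rcases hph with rfl | rfl <;> simp [Instr.acts, content_head, digit]
      · rw [update_content_head]
        simpa [moveHead] using h1

/-- All cells before the stop marker receive the top digit whatever they held, so the result depends
only on the position of the marker. -/
theorem MRun.setmax_walk (hc : code[pc]? = some (.setmax r))
    (hh : h ≤ x.length + 1) (hS : ∀ i, hd i ≤ S) {m k : ℕ} {pre l : List ℕ}
    (hm : pre.length + k + 1 = m) (hl : l.length ≤ k)
    (hlen : m ≤ S) (hph : ph = .run ∨ ph = .walk)
    (H : MRun b β cnt code x S y t
      (tcfg (pc + 1) .run h w hd o r (content b m (pre ++ List.replicate k (β r))) 1) n) :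
    MRun b β cnt code x S y (t + (2 * k + pre.length + 3))
      (tcfg pc ph h w hd o r (content b m (pre ++ l)) (pre.length + 1)) n := by
  induction k generalizing pre ph l with
  | zero =>
    obtain rfl : l = [] := by simpa using hl
    have h1 := MRun.back hc (.inr (.inr rfl)) hh hS (j := pre.length + 1) (by omega)
      content_base_iff H
    refine (MRun.onTape hc hh hS (by omega) (pc' := pc) (ph' := .back) (a := .fence) (d := .stay) ?_
      ?_ (t := t + (pre.length + 1 + 1))).mono (by simp)
    · have : content b m (pre ++ []) (pre.length + 1) = .fence := by
        rw [List.append_nil, content_end, if_pos hm]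
      rcases hph with rfl | rfl <;> simp only [Instr.acts, Function.update_self, this]
    · have : (TSym.fence : TSym b) = content b m (pre ++ []) (pre.length + 1) := by
        rw [List.append_nil, content_end, if_pos (by omega)]
      rw [this, Function.update_eq_self]
      simpa [moveHead] using h1
  | succ k ih =>
    -- `l.tail` treats uniformly the cells that hold an old digit and the blank ones behind them.
    have h1 := ih (pre := pre ++ [β r]) (ph := .walk) (l := l.tail) (by simp; omega)
      (by simp; omega) (.inr rfl) (by simpa [List.replicate_succ] using H)
    refine (MRun.onTape hc hh hS (by omega) (pc' := pc) (ph' := .walk)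
      (a := digit b (β r)) (d := .right) ?_ ?_
      (t := t + (2 * k + (pre ++ [β r]).length + 3))).mono (by simp; omega)
    · cases l with
      | nil =>
        rcases hph with rfl | rfl <;> simp [Instr.acts, content_end,
          show pre.length + 1 ≠ m by omega]
      | cons d l =>
        rcases hph with rfl | rfl <;> simp [Instr.acts, content_head, digit]
    · cases l with
      | nil =>
        rw [List.append_nil, update_content_end]
        simpa [moveHead] using h1
      | cons d l =>
        rw [update_content_head]
        simpa [moveHead] using h1

end Mach

/-! ### The effect of single instructions on register values -/

section Reg

variable {A B T : Type} [Finite T] [DecidableEq T]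
variable (b : ℕ) (β : T → ℕ) (cnt : T) (code : List (Instr A B T)) (m : T → ℕ)

/-- The configuration at address `pc` in which the registers have the values `v`; the tape `r` has
a stop marker in cell `m r`. -/
def rcfg (pc : ℕ) (v : T → ℕ) (h : ℕ) (o : List B) : (mach b β cnt code).Cfg :=
  mcfg b β cnt code pc .run h (fun r => content b (m r) (digs (β r) (v r))) (fun _ => 1) o

variable {b β cnt code m} {x : List A} {S W : ℕ} {y : List B} {t n n' : ℕ}
  {pc j h : ℕ} {v : T → ℕ} {o : List B} {r : T}

theorem tcfg_eq_rcfg {z : ℕ} :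
    tcfg (b := b) (β := β) (cnt := cnt) (code := code) pc .run h
      (fun r => content b (m r) (digs (β r) (v r))) (fun _ => 1) o r
      (content b (m r) (digs (β r) z)) 1 = rcfg b β cnt code m pc (upd v r z) h o := by
  unfold tcfg rcfg
  congr 1
  · funext i
    by_cases hi : i = r
    · subst hi; simp
    · simp [hi]
  · simp

theorem tcfg_eq_rcfg_self :
    tcfg (b := b) (β := β) (cnt := cnt) (code := code) pc .run h
      (fun r => content b (m r) (digs (β r) (v r))) (fun _ => 1) o r
      (content b (m r) (digs (β r) (v r))) 1 = rcfg b β cnt code m pc v h o := by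
  rw [tcfg_eq_rcfg, upd_self]

theorem length_digs_succ (β n : ℕ) : (digs β n).length ≤ (digs β (n + 1)).length := by
  rw [length_digs_le]
  exact (Nat.le_succ n).trans (length_digs_le.1 le_rfl)

/-- Every instruction is charged the same time `W`, which covers a walk along `S` cells and back as
well as the return of the input head. The total time is then the number of instructions times `W`.
-/
theorem MRun.inc (hW : 2 * S + x.length + 10 ≤ W) (hc : code[pc]? = some (.inc r)) (hβ : β r ≤ b)
    (hh : h ≤ x.length + 1) (hm : m r = 0 ∨ (digs (β r) (v r + 1)).length < m r)
    (hlen : (digs (β r) (v r + 1)).length ≤ S)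
    (H : MRun b β cnt code x S y t (rcfg b β cnt code m (pc + 1) (upd v r (v r + 1)) h o) n) :
    MRun b β cnt code x S y (t + W) (rcfg b β cnt code m pc v h o) n := by
  have hl := length_digs_succ (β r) (v r)
  have hS : 1 ≤ S := le_trans (by
    rw [digs_succ]
    exact List.length_pos_of_ne_nil (incL_ne_nil _ _)) hlen
  rw [digs_succ] at hm hlen hl
  rw [← tcfg_eq_rcfg, digs_succ] at H
  have := MRun.inc_walk (pre := []) (ph := .run) hc hβ hh (fun _ => hS) (digs_le _ _) (by simpa using hm)
    (by simpa using hlen) (.inl rfl) H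
  rw [← tcfg_eq_rcfg_self (r := r)]
  refine Run.mono this ?_
  simp only [List.length_nil]
  omega

theorem MRun.inc_max (hW : 2 * S + x.length + 10 ≤ W) (hc : code[pc]? = some (.inc r))
    (hβ : β r ≤ b) (hh : h ≤ x.length + 1) (hm : m r = (digs (β r) (v r)).length + 1)
    (hlen : m r ≤ S) (hlt : (digs (β r) (v r)).length < (digs (β r) (v r + 1)).length) :
    MRun b β cnt code x S y (t + W) (rcfg b β cnt code m pc v h o) 0 := by
  rw [digs_succ] at hlt
  have := MRun.inc_stop (t := t) (y := y) (o := o) (pre := []) (ph := .run) (cnt := cnt) (b := b)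
    (w := (fun r => content b (m r) (digs (β r) (v r)))) (hd := fun _ => 1) (S := S) hc hβ hh
    (fun _ => by omega) (digs_le _ _) (by simpa using hm) hlt hlen (.inl rfl)
  rw [← tcfg_eq_rcfg_self (r := r)]
  exact Run.mono this (by omega)

theorem MRun.dec (hW : 2 * S + x.length + 10 ≤ W) (hc : code[pc]? = some (.dec r)) (hβ : β r ≤ b)
    (hh : h ≤ x.length + 1) (hm : m r = 0 ∨ (digs (β r) (v r)).length < m r)
    (hlen : (digs (β r) (v r)).length + 1 ≤ S)
    (H : MRun b β cnt code x S y t (rcfg b β cnt code m (pc + 1) (upd v r (v r - 1)) h o) n) :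
    MRun b β cnt code x S y (t + W) (rcfg b β cnt code m pc v h o) n := by
  by_cases h0 : v r = 0
  -- An empty tape shows a blank or the stop marker in cell `1`, and the machine moves on at once;
  -- this is the truncation `0 - 1 = 0`.
  · rw [h0, upd_eq_self (by omega)] at H
    refine (MRun.idle hc (fun _ => by omega) (pc' := pc + 1) (ph' := .run) (d := .stay) (e := none)
      ?_ (t := t) ?_).mono (by omega)
    · have : content b (m r) (digs (β r) (v r)) 1 = if 1 = m r then .fence else .blank := by
        rw [h0, digs_zero]; exact content_end (b := b) (m := m r) []
      simp only [Instr.acts, this]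
      by_cases h1 : 1 = m r <;> simp only [h1, if_true, if_false]
    · simpa [rcfg, moveHead, hh] using H
  · rw [← tcfg_eq_rcfg, ← decL_digs] at H
    have := MRun.dec_walk (pre := []) (ph := .run) hc hβ hh (fun _ => by omega) (digs_le _ _)
      (by simpa using hm) (by simpa using hlen) (by rwa [Ne, digs_eq_nil]) (.inl rfl) H
    rw [← tcfg_eq_rcfg_self (r := r)]
    refine Run.mono this ?_
    simp only [List.length_nil]
    omega

theorem MRun.setmax (hW : 2 * S + x.length + 10 ≤ W) (hc : code[pc]? = some (.setmax r))
    (hh : h ≤ x.length + 1) {L : ℕ} (hm : m r = L + 1) (hlen : L + 1 ≤ S)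
    (hv : v r ≤ maxVal (β r) L)
    (H : MRun b β cnt code x S y t
      (rcfg b β cnt code m (pc + 1) (upd v r (maxVal (β r) L)) h o) n) :
    MRun b β cnt code x S y (t + W) (rcfg b β cnt code m pc v h o) n := by
  rw [← tcfg_eq_rcfg, digs_maxVal] at H
  have := MRun.setmax_walk (pre := []) (ph := .run) (k := L) (l := digs (β r) (v r)) hc hh
    (fun _ => by omega) (by simpa using hm.symm) (length_digs_le.2 hv) (by omega) (.inl rfl) H
  rw [← tcfg_eq_rcfg_self (r := r)]
  refine Run.mono this ?_
  simp only [List.length_nil]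
  omega

theorem MRun.jz_pos (hW : 2 * S + x.length + 10 ≤ W) (hc : code[pc]? = some (.jz r j))
    (hh : h ≤ x.length + 1) (hS : 1 ≤ S) (hv : v r = 0)
    (H : MRun b β cnt code x S y t (rcfg b β cnt code m j v h o) n) :
    MRun b β cnt code x S y (t + W) (rcfg b β cnt code m pc v h o) n := by
  refine (MRun.idle hc (fun _ => hS) (pc' := j) (ph' := .run) (d := .stay) (e := none)
      ?_ (t := t) ?_).mono (by omega)
  · have : content b (m r) (digs (β r) (v r)) 1 = if 1 = m r then .fence else .blank := by
      rw [hv, digs_zero]; exact content_end (b := b) (m := m r) []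
    simp only [Instr.acts, this]
    by_cases h1 : 1 = m r <;> simp only [h1, if_true, if_false]
  · simpa [rcfg, moveHead, hh] using H

theorem MRun.jz_neg (hW : 2 * S + x.length + 10 ≤ W) (hc : code[pc]? = some (.jz r j))
    (hh : h ≤ x.length + 1) (hS : 1 ≤ S) (hv : v r ≠ 0)
    (H : MRun b β cnt code x S y t (rcfg b β cnt code m (pc + 1) v h o) n) :
    MRun b β cnt code x S y (t + W) (rcfg b β cnt code m pc v h o) n := by
  refine (MRun.idle hc (fun _ => hS) (pc' := pc + 1) (ph' := .run) (d := .stay) (e := none)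
      ?_ (t := t) ?_).mono (by omega)
  · obtain ⟨d, l, hl⟩ := List.exists_cons_of_ne_nil (mt digs_eq_nil.1 hv : digs (β r) (v r) ≠ [])
    have : content b (m r) (digs (β r) (v r)) 1 = digit b d := by
      rw [hl]; exact content_head [] d l
    simp only [Instr.acts, this, digit]
  · simpa [rcfg, moveHead, hh] using H

theorem MRun.jmp (hW : 2 * S + x.length + 10 ≤ W) (hc : code[pc]? = some (.jmp j))
    (hh : h ≤ x.length + 1) (hS : 1 ≤ S)
    (H : MRun b β cnt code x S y t (rcfg b β cnt code m j v h o) n) :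
    MRun b β cnt code x S y (t + W) (rcfg b β cnt code m pc v h o) n :=
  (MRun.idle hc (fun _ => hS) (pc' := j) (ph' := .run) (d := .stay) (e := none)
      (by simp only [Instr.acts]) (t := t) (by simpa [rcfg, moveHead, hh] using H)).mono (by omega)

theorem MRun.emit (hW : 2 * S + x.length + 10 ≤ W) {e : B} (hc : code[pc]? = some (.emit e))
    (hh : h ≤ x.length + 1) (hS : 1 ≤ S)
    (H : MRun b β cnt code x S y t (rcfg b β cnt code m (pc + 1) v h (o ++ [e])) n) :
    MRun b β cnt code x S y (t + W) (rcfg b β cnt code m pc v h o) n :=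
  (MRun.idle hc (fun _ => hS) (pc' := pc + 1) (ph' := .run) (d := .stay) (e := some e)
      (by simp only [Instr.acts]) (t := t) (by simpa [rcfg, moveHead, hh] using H)).mono (by omega)

theorem MRun.hright (hW : 2 * S + x.length + 10 ≤ W) (hc : code[pc]? = some .hright)
    (hS : 1 ≤ S)
    (H : MRun b β cnt code x S y t (rcfg b β cnt code m (pc + 1) v (min (h + 1) (x.length + 1)) o) n) :
    MRun b β cnt code x S y (t + W) (rcfg b β cnt code m pc v h o) n :=
  (MRun.idle hc (fun _ => hS) (pc' := pc + 1) (ph' := .run) (d := .right) (e := none)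
      (by simp only [Instr.acts]) (t := t) (by simpa [rcfg, moveHead] using H)).mono (by omega)

theorem MRun.hreset (hW : 2 * S + x.length + 10 ≤ W) (hc : code[pc]? = some .hreset)
    (hh : h ≤ x.length + 1) (hS : 1 ≤ S)
    (H : MRun b β cnt code x S y t (rcfg b β cnt code m (pc + 1) v 0 o) n) :
    MRun b β cnt code x S y (t + W) (rcfg b β cnt code m pc v h o) n := by
  have : MRun b β cnt code x S y (t + (h + 1)) (rcfg b β cnt code m pc v h o) n := by
    clear hW
    induction h with
    | zero =>
      exact (MRun.idle hc (fun _ => hS) (pc' := pc + 1) (ph' := .run) (d := .stay) (e := none)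
        (by simp only [Instr.acts, readInput]) (t := t) (by simpa [rcfg, moveHead, hh] using H))
    | succ h ih =>
      refine (MRun.idle hc (fun _ => hS) (pc' := pc) (ph' := .run) (d := .left) (e := none)
        ?_ (t := t + (h + 1)) ?_)
      · have : readInput x (h + 1) ≠ .leftEnd := by
          simp only [readInput]; split <;> simp
        simp only [Instr.acts]
      · have := ih (by omega)
        simpa [rcfg, moveHead, show h ≤ x.length + 1 by omega] using this
  exact this.mono (by omega)

theorem MRun.jsym (hW : 2 * S + x.length + 10 ≤ W) {a : InputSym A}
    (hc : code[pc]? = some (.jsym a j)) (hh : h ≤ x.length + 1) (hS : 1 ≤ S)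
    (H : readInput x h = a → MRun b β cnt code x S y t (rcfg b β cnt code m j v h o) n)
    (H' : readInput x h ≠ a → MRun b β cnt code x S y t (rcfg b β cnt code m (pc + 1) v h o) n) :
    MRun b β cnt code x S y (t + W) (rcfg b β cnt code m pc v h o) n := by
  by_cases ha : readInput x h = a
  · exact (MRun.idle hc (fun _ => hS) (pc' := j) (ph' := .run) (d := .stay) (e := none)
      (by simp only [Instr.acts, ha, if_true]) (t := t)
      (by simpa [rcfg, moveHead, hh] using H ha)).mono (by omega)
  · exact (MRun.idle hc (fun _ => hS) (pc' := pc + 1) (ph' := .run) (d := .stay) (e := none)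
      (by simp only [Instr.acts, ha, if_false]) (t := t)
      (by simpa [rcfg, moveHead, hh] using H' ha)).mono (by omega)

theorem MRun.fail (hc : code[pc]? = some .fail) (hS : 1 ≤ S) :
    MRun b β cnt code x S y t (rcfg b β cnt code m pc v h o) 0 := by
  refine Run.reject (fun _ => hS) ?_ ?_
  · rintro a c ⟨ha, _⟩
    rw [rcfg, enabled_mcfg hc] at ha
    exact ha
  · rintro ⟨hacc, -⟩
    have h1 := lt_of_getElem?_eq_some hc
    have h2 : some (Fin.ofNat (code.length + 1) pc, Phase.run) = some (Fin.last _, Phase.run) := hacc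
    simp only [Option.some.injEq, Prod.mk.injEq, and_true] at h2
    have h3 := congrArg Fin.val h2
    simp only [Fin.ofNat, Fin.val_last] at h3
    rw [Nat.mod_eq_of_lt (by omega)] at h3
    omega

open Classical in
theorem MRun.finish (hS : 1 ≤ S) :
    MRun b β cnt code x S y t (rcfg b β cnt code m code.length v h o) (if o = y then 1 else 0) := by
  have hno : ∀ a c, ¬ (mach b β cnt code).Step x (rcfg b β cnt code m code.length v h o) a c := by
    rintro a c ⟨ha, _⟩
    have hval : (Fin.ofNat (code.length + 1) code.length).val = code.length :=
      Nat.mod_eq_of_lt (by omega)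
    simp only [Machine.enabled, rcfg, mcfg, hval, List.getElem?_eq_none le_rfl] at ha
    exact ha
  have hst : (rcfg b β cnt code m code.length v h o).state ∈ (mach b β cnt code).accept := by
    change some (Fin.ofNat (code.length + 1) code.length, Phase.run) = some (Fin.last _, Phase.run)
    congr 2
    exact Fin.ext (Nat.mod_eq_of_lt (by omega))
  split_ifs with ho
  · exact Run.accept (fun _ => hS) hno ⟨hst, ho⟩
  · exact Run.reject (fun _ => hS) hno fun h => ho h.2

/-- Branches are counted as sequences of instructions. The two alternatives differ only in their
targets, so for `j = pc + 1` they would be one and the same instruction and be counted once. -/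
theorem MRun.fork (hW : 2 * S + x.length + 10 ≤ W) (hc : code[pc]? = some (.fork j))
    (hh : h ≤ x.length + 1) (hS : 1 ≤ S) (hj : j ≤ code.length) (hne : j ≠ pc + 1)
    (H : MRun b β cnt code x S y t (rcfg b β cnt code m (pc + 1) v h o) n)
    (H' : MRun b β cnt code x S y t (rcfg b β cnt code m j v h o) n') :
    MRun b β cnt code x S y (t + W) (rcfg b β cnt code m pc v h o) (n + n') := by
  have hlt := lt_of_getElem?_eq_some hc
  refine Run.mono (t := t + 1) ?_ (by omega)
  set w : T → ℕ → TSym b := fun r => content b (m r) (digs (β r) (v r)) with hw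
  refine Run.pair
    (m₁ := Instr.idle (some (Fin.ofNat (code.length + 1) (pc + 1), .run)) (fun i => w i 1) .stay none)
    (m₂ := Instr.idle (some (Fin.ofNat (code.length + 1) j, .run)) (fun i => w i 1) .stay none)
    (c₁ := rcfg b β cnt code m (pc + 1) v h o) (c₂ := rcfg b β cnt code m j v h o)
    (fun _ => hS) ?_ ?_ H H'
  · intro he
    have he := congrArg Action.next he
    simp only [Instr.idle, Option.some.injEq, Prod.mk.injEq, and_true] at he
    have h3 := congrArg Fin.val he
    simp only [Fin.ofNat] at h3
    rw [Nat.mod_eq_of_lt (by omega), Nat.mod_eq_of_lt (by omega)] at h3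
    omega
  · intro a c
    unfold Machine.Step
    rw [rcfg, enabled_mcfg hc]
    have happ : ∀ i, (mach b β cnt code).apply x (mcfg b β cnt code pc .run h w (fun _ => 1) o)
        (Instr.idle (some (Fin.ofNat (code.length + 1) i, .run)) (fun i => w i 1) .stay none) =
        rcfg b β cnt code m i v h o := by
      intro i
      refine (apply_idle (hd := fun _ => 1)).trans ?_
      simp [moveHead, hh, rcfg, w]
    constructor
    · rintro ⟨ha, rfl⟩
      rcases ha with rfl | rfl
      · exact .inl ⟨rfl, happ _⟩
      · exact .inr ⟨rfl, happ _⟩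
    · rintro (⟨rfl, rfl⟩ | ⟨rfl, rfl⟩)
      · exact ⟨.inl rfl, (happ _).symm⟩
      · exact ⟨.inr rfl, (happ _).symm⟩

end Reg

/-! ## Compilation of register programs -/

/-- The instructions `l` are found in `code` from the address `a` on. -/
def At {α : Type} (code : List α) : ℕ → List α → Prop
  | _, [] => True
  | a, i :: l => code[a]? = some i ∧ At code (a + 1) l

theorem At.append {α : Type} {code : List α} {a : ℕ} {l l' : List α} :
    At code a (l ++ l') ↔ At code a l ∧ At code (a + l.length) l' := by
  induction l generalizing a with
  | nil => simp [At]
  | cons i l ih =>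
    simp only [List.cons_append, At, ih, List.length_cons, and_assoc]
    rw [show a + 1 + l.length = a + (l.length + 1) by ring]

theorem At.self {α : Type} (pre l : List α) : At (pre ++ l) pre.length l := by
  induction l generalizing pre with
  | nil => trivial
  | cons i l ih =>
    refine ⟨by simp, ?_⟩
    simpa using ih (pre ++ [i])

namespace Prog

variable {A B ι : Type}

/-- The number of instructions of the compiled program. -/
def size : Prog A B ι → ℕ
  | skip => 0
  | fail | inc _ | dec _ | setmax _ | emit _ => 1
  | seq p q => p.size + q.size
  | choose p q | ifz _ p q => p.size + q.size + 2
  | ifsym _ _ p q => p.size + q.size + 16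
  | loop _ p => p.size + 12

/-- The nesting depth of loops. -/
def depth : Prog A B ι → ℕ
  | skip | fail | inc _ | dec _ | setmax _ | emit _ => 0
  | seq p q | choose p q | ifz _ p q => max p.depth q.depth
  | ifsym _ _ p q => max 1 (max p.depth q.depth)
  | loop _ p => p.depth + 1

/-- A bound for the number of instructions executed if registers are bounded by `K`. -/
def cost (K : ℕ) : Prog A B ι → ℕ
  | skip | fail => 0
  | inc _ | dec _ | setmax _ | emit _ => 1
  | seq p q => p.cost K + q.cost K
  | choose p q | ifz _ p q => p.cost K + q.cost K + 2
  | ifsym _ _ p q => p.cost K + q.cost K + (13 * K + 6)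
  | loop _ p => K * (p.cost K + 3) + 9 * K + 3

section Comp

variable (D : ℕ) [NeZero D]

/-- The tape for a register. -/
abbrev reg (i : ι) : Option (ι ⊕ Fin D) := some (.inl i)

/-- The index of a loop counter. -/
def hidx (d : ℕ) : Fin D := Fin.ofNat D d

/-- The tape for a loop counter. -/
abbrev hreg (d : ℕ) : Option (ι ⊕ Fin D) := some (.inr (hidx D d))

variable {D} in
theorem val_hidx {d : ℕ} (hd : d < D) : (hidx D d).val = d := Nat.mod_eq_of_lt hd

variable {D} in
theorem hidx_ne {d d' : ℕ} (hd : d < D) (hd' : d' < D) (h : d ≠ d') : hidx D d ≠ hidx D d' :=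
  fun e => h (by rw [← val_hidx hd, e, val_hidx hd'])

/-- Copying the register `i` to the `d`-th loop counter with the help of the next one. -/
def copyCode (a : ℕ) (i : ι) (d : ℕ) : List (Instr A B (Option (ι ⊕ Fin D))) :=
  [.jz (reg D i) (a + 5), .dec (reg D i), .inc (hreg D d), .inc (hreg D (d + 1)), .jmp a,
    .jz (hreg D (d + 1)) (a + 9), .dec (hreg D (d + 1)), .inc (reg D i), .jmp (a + 5)]

/-- The code of a program at address `a` that may use the loop counters from `d` on. -/
def comp : Prog A B ι → ℕ → ℕ → List (Instr A B (Option (ι ⊕ Fin D)))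
  | skip, _, _ => []
  | fail, _, _ => [.fail]
  | inc i, _, _ => [.inc (reg D i)]
  | dec i, _, _ => [.dec (reg D i)]
  | setmax i, _, _ => [.setmax (reg D i)]
  | emit e, _, _ => [.emit e]
  | seq p q, a, d => p.comp a d ++ q.comp (a + p.size) d
  | choose p q, a, d => .fork (a + p.size + 2) :: (p.comp (a + 1) d ++
      .jmp (a + p.size + q.size + 2) :: q.comp (a + 1 + p.size + 1) d)
  | ifz i p q, a, d => .jz (reg D i) (a + q.size + 2) :: (q.comp (a + 1) d ++
      .jmp (a + p.size + q.size + 2) :: p.comp (a + 1 + q.size + 1) d)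
  | ifsym i s p q, a, d => .hreset :: (copyCode D (a + 1) i d ++
      .jz (hreg D d) (a + 14) :: .dec (hreg D d) :: .hright :: .jmp (a + 10) ::
      .jsym s (a + q.size + 16) :: (q.comp (a + 1 + 9 + 1 + 1 + 1 + 1 + 1) d ++
      .jmp (a + p.size + q.size + 16) :: p.comp (a + 1 + 9 + 1 + 1 + 1 + 1 + 1 + q.size + 1) d))
  | loop i p, a, d => copyCode D a i d ++
      .jz (hreg D d) (a + p.size + 12) :: .dec (hreg D d) :: (p.comp (a + 9 + 1 + 1) (d + 1) ++
      [.jmp (a + 9)])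

theorem length_copyCode (a : ℕ) (i : ι) (d : ℕ) :
    (copyCode (A := A) (B := B) D a i d).length = 9 := rfl

theorem length_comp (p : Prog A B ι) (a d : ℕ) : (p.comp D a d).length = p.size := by
  induction p generalizing a d <;> simp [comp, size, length_copyCode, *] <;> omega

end Comp

end Prog

/-! ### Compiled instructions acting on stores and loop counters -/

section CompRun

variable {A B ι : Type} [Finite ι] [DecidableEq ι] {D : ℕ} [NeZero D]

/-- The bases of the tapes: the tape `none` is used for counting in base `2`. -/
def bases (b : ℕ) : Option (ι ⊕ Fin D) → ℕ
  | none => 1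
  | some _ => b

/-- The stop markers of the tapes. -/
def stops (L : ℕ) : Option (ι ⊕ Fin D) → ℕ
  | none => 0
  | some _ => L + 1

def vals (c : ℕ) (σ : ι → ℕ) (hid : Fin D → ℕ) : Option (ι ⊕ Fin D) → ℕ
  | none => c
  | some (.inl i) => σ i
  | some (.inr d) => hid d

theorem upd_vals_inl {c : ℕ} {σ : ι → ℕ} {hid : Fin D → ℕ} {i : ι} {z : ℕ} :
    upd (vals c σ hid) (some (.inl i)) z = vals c (upd σ i z) hid := by
  funext r
  rcases r with _ | r | r <;> simp [upd, vals]

theorem upd_vals_inr {c : ℕ} {σ : ι → ℕ} {hid : Fin D → ℕ} {d : Fin D} {z : ℕ} :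
    upd (vals c σ hid) (some (.inr d)) z = vals c σ (upd hid d z) := by
  funext r
  rcases r with _ | r | r <;> simp [upd, vals]

variable (b : ℕ) (code : List (Instr A B (Option (ι ⊕ Fin D)))) (L c : ℕ)

/-- The configuration at address `pc` with the store `σ` and the loop counters `hid`. -/
def scfg (pc : ℕ) (σ : ι → ℕ) (hid : Fin D → ℕ) (h : ℕ) (o : List B) :
    (mach b (bases b) none code).Cfg :=
  rcfg b (bases b) none code (stops L) pc (vals c σ hid) h o

variable {b code L c} {x : List A} {S W : ℕ} {y : List B} {t n n' : ℕ}
  {pc j h : ℕ} {σ : ι → ℕ} {hid : Fin D → ℕ} {o : List B}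

/-- The branches of the compiled program. -/
abbrev SRun (x : List A) (S : ℕ) (y : List B) (t : ℕ)
    (C : (mach b (bases b) (none : Option (ι ⊕ Fin D)) code).Cfg) (n : ℕ) : Prop :=
  MRun b (bases b) none code x S y t C n

section Instructions

variable (hW : 2 * S + x.length + 10 ≤ W) (hS : L + 2 ≤ S) (hh : h ≤ x.length + 1)
include hW hS hh

theorem SRun.inc_reg {i : ι} (hc : code[pc]? = some (.inc (some (.inl i))))
    (hσ : σ i < maxVal b L)
    (H : SRun x S y t (scfg b code L c (pc + 1) (upd σ i (σ i + 1)) hid h o) n) :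
    SRun x S y (t + W) (scfg b code L c pc σ hid h o) n := by
  have : (digs b (σ i + 1)).length ≤ L := length_digs_le.2 hσ
  refine MRun.inc hW hc le_rfl hh (.inr ?_) ?_ ?_
  · simpa [bases, vals, stops] using Nat.lt_succ_of_le this
  · simp only [bases, vals]; omega
  · rw [upd_vals_inl]; exact H

theorem SRun.inc_hid {d : Fin D} (hc : code[pc]? = some (.inc (some (.inr d))))
    (hσ : hid d < maxVal b L)
    (H : SRun x S y t (scfg b code L c (pc + 1) σ (upd hid d (hid d + 1)) h o) n) :
    SRun x S y (t + W) (scfg b code L c pc σ hid h o) n := by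
  have : (digs b (hid d + 1)).length ≤ L := length_digs_le.2 hσ
  refine MRun.inc hW hc le_rfl hh (.inr ?_) ?_ ?_
  · simpa [bases, vals, stops] using Nat.lt_succ_of_le this
  · simp only [bases, vals]; omega
  · rw [upd_vals_inr]; exact H

theorem SRun.inc_max {i : ι} (hc : code[pc]? = some (.inc (some (.inl i))))
    (hσ : σ i = maxVal b L) :
    SRun x S y (t + W) (scfg b code L c pc σ hid h o) 0 := by
  have h1 : (digs b (σ i)).length = L := by rw [hσ, digs_maxVal]; simp
  have h2 : L < (digs b (σ i + 1)).length := by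
    by_contra! h
    rw [length_digs_le] at h
    omega
  refine MRun.inc_max hW hc le_rfl hh ?_ ?_ ?_
  · simp [bases, vals, stops, h1]
  · simp only [stops]; omega
  · simpa [bases, vals, h1] using h2

theorem SRun.dec_reg {i : ι} (hc : code[pc]? = some (.dec (some (.inl i))))
    (hσ : σ i ≤ maxVal b L)
    (H : SRun x S y t (scfg b code L c (pc + 1) (upd σ i (σ i - 1)) hid h o) n) :
    SRun x S y (t + W) (scfg b code L c pc σ hid h o) n := by
  have : (digs b (σ i)).length ≤ L := length_digs_le.2 hσ
  refine MRun.dec hW hc le_rfl hh (.inr ?_) ?_ ?_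
  · simpa [bases, vals, stops] using Nat.lt_succ_of_le this
  · simp only [bases, vals]; omega
  · rw [upd_vals_inl]; exact H

theorem SRun.dec_hid {d : Fin D} (hc : code[pc]? = some (.dec (some (.inr d))))
    (hσ : hid d ≤ maxVal b L)
    (H : SRun x S y t (scfg b code L c (pc + 1) σ (upd hid d (hid d - 1)) h o) n) :
    SRun x S y (t + W) (scfg b code L c pc σ hid h o) n := by
  have : (digs b (hid d)).length ≤ L := length_digs_le.2 hσ
  refine MRun.dec hW hc le_rfl hh (.inr ?_) ?_ ?_
  · simpa [bases, vals, stops] using Nat.lt_succ_of_le this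
  · simp only [bases, vals]; omega
  · rw [upd_vals_inr]; exact H

theorem SRun.setmax {i : ι} (hc : code[pc]? = some (.setmax (some (.inl i))))
    (hσ : σ i ≤ maxVal b L)
    (H : SRun x S y t (scfg b code L c (pc + 1) (upd σ i (maxVal b L)) hid h o) n) :
    SRun x S y (t + W) (scfg b code L c pc σ hid h o) n :=
  MRun.setmax hW hc hh (L := L) rfl (by omega) hσ (by rw [upd_vals_inl]; exact H)

/-! ### Copying -/

variable {a d : ℕ} {i : ι} (hL : At code a (Prog.copyCode D a i d)) (hd : d + 1 < D)
include hL hd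

/-- Here `e` is what is left in the register and `j` what has been moved. The value goes into two
counters because one of them is used up in restoring the register. -/
theorem SRun.copy_first (e j : ℕ) (hej : e + j ≤ maxVal b L)
    (H : SRun x S y t (scfg b code L c (a + 5) (upd σ i 0)
      (upd (upd hid (Prog.hidx D d) (e + j)) (Prog.hidx D (d + 1)) (e + j)) h o) n) :
    SRun x S y (t + (e * (5 * W) + W)) (scfg b code L c a (upd σ i e)
      (upd (upd hid (Prog.hidx D d) j) (Prog.hidx D (d + 1)) j) h o) n := by
  obtain ⟨h0, h1, h2, h3, h4, -⟩ := hL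
  have hne : Prog.hidx D (d + 1) ≠ Prog.hidx D d := Prog.hidx_ne hd (by omega) (by omega)
  induction e generalizing j with
  | zero =>
    rw [Nat.zero_mul, Nat.zero_add]
    refine MRun.jz_pos hW h0 hh (by omega) (by simp [vals]) ?_
    rw [Nat.zero_add] at H
    exact H
  | succ e ih =>
    have h5 := ih (j + 1) (by omega) (by
      rw [show e + (j + 1) = e + 1 + j by ring]
      exact H)
    rw [show t + ((e + 1) * (5 * W) + W) = t + (e * (5 * W) + W) + W + W + W + W + W by ring]
    refine MRun.jz_neg hW h0 hh (by omega) (by simp [vals]) ?_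
    refine SRun.dec_reg hW hS hh h1 (by simp; omega) ?_
    refine SRun.inc_hid hW hS hh h2 (by simp [hne.symm]; omega) ?_
    refine SRun.inc_hid hW hS hh h3 (by simp [hne]; omega) ?_
    refine MRun.jmp hW h4 hh (by omega) ?_
    have he : ∀ u : Fin D → ℕ, u = upd (upd hid (Prog.hidx D d) j) (Prog.hidx D (d + 1)) j →
        upd (upd u (Prog.hidx D d) (u (Prog.hidx D d) + 1)) (Prog.hidx D (d + 1))
          (upd u (Prog.hidx D d) (u (Prog.hidx D d) + 1) (Prog.hidx D (d + 1)) + 1) =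
        upd (upd hid (Prog.hidx D d) (j + 1)) (Prog.hidx D (d + 1)) (j + 1) := by
      rintro u rfl
      funext z
      by_cases h1 : z = Prog.hidx D d <;> by_cases h2 : z = Prog.hidx D (d + 1) <;>
        simp_all [upd]
    rw [he _ rfl, upd_upd, upd_same, Nat.add_sub_cancel]
    exact h5

theorem SRun.copy_second (e j : ℕ) (hej : e + j ≤ maxVal b L)
    (H : SRun x S y t (scfg b code L c (a + 9) (upd σ i (e + j))
      (upd hid (Prog.hidx D (d + 1)) 0) h o) n) :
    SRun x S y (t + (e * (4 * W) + W)) (scfg b code L c (a + 5) (upd σ i j)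
      (upd hid (Prog.hidx D (d + 1)) e) h o) n := by
  obtain ⟨-, -, -, -, -, h0, h1, h2, h3, -⟩ := hL
  induction e generalizing j with
  | zero =>
    rw [Nat.zero_mul, Nat.zero_add]
    refine MRun.jz_pos hW h0 hh (by omega) (by simp [vals]) ?_
    rw [Nat.zero_add] at H
    exact H
  | succ e ih =>
    have h5 := ih (j + 1) (by omega) (by
      rw [show e + (j + 1) = e + 1 + j by ring]
      exact H)
    rw [show t + ((e + 1) * (4 * W) + W) = t + (e * (4 * W) + W) + W + W + W + W by ring]
    refine MRun.jz_neg hW h0 hh (by omega) (by simp [vals]) ?_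
    refine SRun.dec_hid hW hS hh h1 (by simp; omega) ?_
    refine SRun.inc_reg hW hS hh h2 (by simp; omega) ?_
    refine MRun.jmp hW h3 hh (by omega) ?_
    simp only [upd_upd, upd_same, Nat.add_sub_cancel]
    exact h5

theorem SRun.copy (hi : σ i ≤ maxVal b L) (h0 : hid (Prog.hidx D d) = 0)
    (h1 : hid (Prog.hidx D (d + 1)) = 0)
    (H : SRun x S y t (scfg b code L c (a + 9) σ (upd hid (Prog.hidx D d) (σ i)) h o) n) :
    SRun x S y (t + (9 * maxVal b L + 2) * W) (scfg b code L c a σ hid h o) n := by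
  have hne : Prog.hidx D (d + 1) ≠ Prog.hidx D d := Prog.hidx_ne hd (by omega) (by omega)
  have h2 := SRun.copy_second (hid := upd hid (Prog.hidx D d) (σ i)) (σ := σ) hW hS hh hL hd (σ i) 0
    (by omega) (t := t) (n := n) (c := c) (y := y) (o := o) (by
      have he : upd σ i (σ i + 0) = σ := by simp
      rw [upd_eq_self (i := Prog.hidx D (d + 1)) (by simp [hne, h1]), he]
      exact H)
  have h3 := SRun.copy_first hW hS hh hL hd (σ i) 0 (by omega) (by
    rw [Nat.add_zero]; exact h2)
  rw [upd_self, upd_eq_self h0, upd_eq_self h1] at h3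
  refine Run.mono h3 ?_
  have := Nat.mul_le_mul_right W hi
  nlinarith

end Instructions

end CompRun

/-! ### Correctness of the compiler -/

section CompRun

variable {A B ι : Type} [Finite ι] [DecidableEq ι] {D : ℕ} [NeZero D]
variable {b : ℕ} {code : List (Instr A B (Option (ι ⊕ Fin D)))} {L c : ℕ}
  {x : List A} {S W : ℕ} {y : List B} {t n n' : ℕ}
  {pc j h : ℕ} {σ : ι → ℕ} {hid : Fin D → ℕ} {o : List B}

theorem SRun.congr_pc {pc' : ℕ} (e : pc = pc')
    (H : SRun x S y t (scfg b code L c pc σ hid h o) n) :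
    SRun x S y t (scfg b code L c pc' σ hid h o) n := e ▸ H

theorem le_length_of_getElem?_eq_some {α : Type} {l : List α} {i j : ℕ} {a : α} (h : l[i]? = some a)
    (hj : j = i + 1) : j ≤ l.length := by
  have := lt_of_getElem?_eq_some h
  omega

/-- The counting semantics of emission: values depend on the output so far. -/
def emitOut (e : B) (r : List B → ℕ) : List B → ℕ := fun o => r (o ++ [e])

/-- The machine counts what `wp` computes because both are in continuation form: `k` gives the
number of accepting branches from the address behind the code, for every store and output, so
composition and iteration of programs become composition and iteration of continuations. The
position of the input head is left open, as every test of a symbol resets it first. The loop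
counters from `d` on are zero both on entry and on exit. -/
theorem comp_run (hW : 2 * S + x.length + 10 ≤ W) (hS : L + 2 ≤ S) (p : Prog A B ι) {a d : ℕ}
    {k : (ι → ℕ) → List B → ℕ} (hL : At code a (p.comp D a d)) (hd : p.depth + d < D)
    (hz : ∀ e : ℕ, d ≤ e → e < D → hid (Prog.hidx D e) = 0)
    (hk : ∀ σ' h' o', (∀ i, σ' i ≤ maxVal b L) → h' ≤ x.length + 1 →
      SRun x S y t (scfg b code L c (a + p.size) σ' hid h' o') (k σ' o'))
    (hσ : ∀ i, σ i ≤ maxVal b L) (hh : h ≤ x.length + 1) :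
    SRun x S y (t + p.cost (maxVal b L) * W) (scfg b code L c a σ hid h o)
      (wp x (maxVal b L) emitOut p k σ o) := by
  have hS1 : 1 ≤ S := by omega
  induction p generalizing a d hid t k σ h o with
  | skip => simpa [wp, Prog.cost, Prog.size] using hk σ h o hσ hh
  | fail => exact MRun.fail hL.1 hS1
  | inc i =>
    rw [Prog.cost, one_mul, wp]
    split_ifs with h1
    · exact SRun.inc_reg hW hS hh hL.1 h1 (hk _ _ _ (upd_le hσ h1) hh)
    · exact SRun.inc_max hW hS hh hL.1 (le_antisymm (hσ i) (not_lt.1 h1))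
  | dec i =>
    rw [Prog.cost, one_mul]
    exact SRun.dec_reg hW hS hh hL.1 (hσ i)
      (hk _ _ _ (upd_le hσ ((Nat.sub_le _ _).trans (hσ i))) hh)
  | setmax i =>
    rw [Prog.cost, one_mul]
    exact SRun.setmax hW hS hh hL.1 (hσ i) (hk _ _ _ (upd_le hσ le_rfl) hh)
  | emit e =>
    rw [Prog.cost, one_mul]
    exact MRun.emit hW hL.1 hh hS1 (hk _ _ _ hσ hh)
  | seq p q ihp ihq =>
    rw [Prog.depth] at hd
    rw [Prog.comp, At.append, Prog.length_comp] at hL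
    rw [Prog.cost, add_mul, add_comm (_ * _), ← add_assoc]
    refine ihp hL.1 (by omega) hz (fun σ' h' o' hσ' hh' => ?_) hσ hh
    refine ihq hL.2 (by omega) hz (fun σ'' h'' o'' hσ'' hh'' => ?_) hσ' hh'
    exact (hk σ'' h'' o'' hσ'' hh'').congr_pc (by rw [Prog.size]; ring)
  | choose p q ihp ihq =>
    rw [Prog.depth] at hd
    rw [Prog.comp, At, At.append, Prog.length_comp, At] at hL
    obtain ⟨h1, h2, h3, h4⟩ := hL
    have hp := ihp (k := k) (t := t + W) h2 (by omega) hz (fun σ' h' o' hσ' hh' => MRun.jmp hW h3 hh' hS1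
      ((hk σ' h' o' hσ' hh').congr_pc (by rw [Prog.size]; ring))) hσ hh (o := o)
    have hq := ihq (k := k) h4 (by omega) hz (fun σ' h' o' hσ' hh' =>
      (hk σ' h' o' hσ' hh').congr_pc (by rw [Prog.size]; ring)) hσ hh (o := o)
    refine (MRun.fork hW h1 hh hS1 (le_length_of_getElem?_eq_some h3 (by ring)) (by omega)
      (t := t + (p.cost (maxVal b L) + q.cost (maxVal b L) + 1) * W) (hp.mono (by nlinarith))
      ((hq.congr_pc (by ring)).mono (by nlinarith))).mono ?_
    rw [Prog.cost]; nlinarith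
  | ifz i p q ihp ihq =>
    rw [Prog.depth] at hd
    rw [Prog.comp, At, At.append, Prog.length_comp, At] at hL
    obtain ⟨h1, h2, h3, h4⟩ := hL
    rw [wp]
    split_ifs with h0
    · have hp := ihp (k := k) h4 (by omega) hz (fun σ' h' o' hσ' hh' =>
        (hk σ' h' o' hσ' hh').congr_pc (by rw [Prog.size]; ring)) hσ hh (o := o)
      refine (MRun.jz_pos hW h1 hh hS1 h0 (hp.congr_pc (by ring))).mono ?_
      rw [Prog.cost]; nlinarith
    · have hq := ihq (k := k) (t := t + W) h2 (by omega) hz (fun σ' h' o' hσ' hh' =>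
        MRun.jmp hW h3 hh' hS1 ((hk σ' h' o' hσ' hh').congr_pc (by rw [Prog.size]; ring))) hσ hh
        (o := o)
      refine (MRun.jz_neg hW h1 hh hS1 h0 hq).mono ?_
      rw [Prog.cost]; nlinarith
  | ifsym i s p q ihp ihq =>
    rw [Prog.depth] at hd
    rw [Prog.comp, At, At.append, Prog.length_copyCode, At, At, At, At, At, At.append,
      Prog.length_comp, At] at hL
    obtain ⟨h1, h2, h3, h4, h5, h6, h7, h8, h9, h10⟩ := hL
    have hd1 : d + 1 < D := by omega
    set dd := Prog.hidx D d with hdd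
    have hdz : hid dd = 0 := hz d le_rfl (by omega)
    have hpq : SRun x S y (t + (p.cost (maxVal b L) + q.cost (maxVal b L) + 1) * W + W)
        (scfg b code L c (a + 1 + 9 + 1 + 1 + 1 + 1) σ hid (min (σ i) (x.length + 1)) o)
        (wp x (maxVal b L) emitOut (.ifsym i s p q) k σ o) := by
      -- The head stops at the right end marker, and every position beyond it reads as that marker
      -- too.
      have hread : readInput x (min (σ i) (x.length + 1)) = readInput x (σ i) := by
        rcases le_total (σ i) (x.length + 1) with h | h
        · rw [min_eq_left h]
        · rw [min_eq_right h]
          obtain ⟨e, he⟩ : ∃ e, σ i = e + 1 := ⟨σ i - 1, by omega⟩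
          rw [he]
          simp only [readInput]
          rw [List.getElem?_eq_none (by omega), List.getElem?_eq_none (by omega)]
      refine MRun.jsym hW h7 (min_le_right _ _) hS1 (fun ha => ?_) (fun ha => ?_)
      · rw [hread] at ha
        rw [wp, if_pos ha]
        have hp := ihp (k := k) h10 (by omega) hz (fun σ' h' o' hσ' hh' =>
          (hk σ' h' o' hσ' hh').congr_pc (by rw [Prog.size]; ring)) hσ
          (min_le_right (σ i) (x.length + 1)) (o := o)
        exact (hp.congr_pc (by ring)).mono (by nlinarith)
      · rw [hread] at ha
        rw [wp, if_neg ha]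
        have hq := ihq (k := k) (t := t + W) h8 (by omega) hz (fun σ' h' o' hσ' hh' =>
          MRun.jmp hW h9 hh' hS1 ((hk σ' h' o' hσ' hh').congr_pc (by rw [Prog.size]; ring))) hσ
          (min_le_right (σ i) (x.length + 1)) (o := o)
        exact hq.mono (by nlinarith)
    -- `e` head moves are still to be made, `j` have been made.
    have hmove : ∀ e j, e + j = σ i →
        SRun x S y (t + (p.cost (maxVal b L) + q.cost (maxVal b L) + 1) * W + W + (e * (4 * W) + W))
        (scfg b code L c (a + 1 + 9) σ (upd hid dd e) (min j (x.length + 1)) o)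
        (wp x (maxVal b L) emitOut (.ifsym i s p q) k σ o) := by
      intro e
      induction e with
      | zero =>
        intro j hj
        rw [Nat.zero_mul, Nat.zero_add]
        refine MRun.jz_pos hW h3 (min_le_right _ _) hS1 (by simp [vals, hdd]) ?_
        rw [upd_eq_self hdz]
        rw [zero_add] at hj
        rw [hj]
        exact hpq.congr_pc (by ring)
      | succ e ih =>
        intro j hj
        have h11 := ih (j + 1) (by omega)
        have hle := hσ i
        refine Run.mono (t := t + (p.cost (maxVal b L) + q.cost (maxVal b L) + 1) * W + W +
          (e * (4 * W) + W) + W + W + W + W) ?_ (by nlinarith)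
        refine MRun.jz_neg hW h3 (min_le_right _ _) hS1 (by simp [vals, hdd]) ?_
        refine SRun.dec_hid hW hS (min_le_right _ _) h4 (by simp [← hdd]; omega) ?_
        refine MRun.hright hW h5 hS1 ?_
        refine MRun.jmp hW h6 (min_le_right _ _) hS1 ?_
        have hmin : min (min j (x.length + 1) + 1) (x.length + 1) = min (j + 1) (x.length + 1) := by
          omega
        rw [hmin, ← hdd, upd_same, upd_upd, Nat.add_sub_cancel]
        exact h11.congr_pc (by ring)
    have h12 := SRun.copy hW hS (Nat.zero_le _) h2 hd1 (hσ i) hdz (hz _ (by omega) hd1)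
      (hmove (σ i) 0 rfl)
    refine (MRun.hreset hW h1 hh hS1 h12).mono ?_
    rw [Prog.cost]
    have := Nat.mul_le_mul_right W (hσ i)
    nlinarith
  | loop i p ih =>
    rw [Prog.depth] at hd
    rw [Prog.comp, At.append, Prog.length_copyCode, At, At, At.append, Prog.length_comp, At] at hL
    obtain ⟨h2, h3, h4, h5, h6, -⟩ := hL
    have hd1 : d + 1 < D := by omega
    set dd := Prog.hidx D d with hdd
    have hdz : hid dd = 0 := hz d le_rfl (by omega)
    -- The loop counter holds the number `e` of remaining passes.
    have hiter : ∀ e, e ≤ maxVal b L → ∀ σ h o, (∀ i, σ i ≤ maxVal b L) → h ≤ x.length + 1 →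
        SRun x S y (t + e * ((p.cost (maxVal b L) + 3) * W) + W)
        (scfg b code L c (a + 9) σ (upd hid dd e) h o)
        ((wp x (maxVal b L) emitOut p)^[e] k σ o) := by
      intro e
      induction e with
      | zero =>
        intro _ σ h o hσ hh
        rw [Nat.zero_mul, Nat.add_zero]
        refine MRun.jz_pos hW h3 hh hS1 (by simp [vals, hdd]) ?_
        rw [upd_eq_self hdz]
        exact (hk σ h o hσ hh).congr_pc (by rw [Prog.size]; ring)
      | succ e ihe =>
        intro he σ h o hσ hh
        rw [Function.iterate_succ_apply']
        refine Run.mono (t := t + e * ((p.cost (maxVal b L) + 3) * W) + W + W +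
          p.cost (maxVal b L) * W + W + W) ?_ (by nlinarith)
        refine MRun.jz_neg hW h3 hh hS1 (by simp [vals, hdd]) ?_
        refine SRun.dec_hid hW hS hh h4 (by simp [← hdd]; omega) ?_
        rw [← hdd, upd_same, upd_upd, Nat.add_sub_cancel]
        refine ih h5 (by omega) ?_ (fun σ' h' o' hσ' hh' => ?_) hσ hh
        -- The body uses only counters above `d`, which the active counter of this loop does not
        -- disturb.
        · intro z hz1 hz2
          rw [upd_ne _ _ (Prog.hidx_ne hz2 (by omega) (by omega))]
          exact hz z (by omega) hz2
        · exact MRun.jmp hW (pc := a + 9 + 1 + 1 + p.size) h6 hh' hS1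
            (ihe (by omega) σ' h' o' hσ' hh')
    have h12 := SRun.copy hW hS hh h2 hd1 (hσ i) hdz (hz _ (by omega) hd1)
      (hiter (σ i) (hσ i) σ h o hσ hh)
    rw [wp]
    refine h12.mono ?_
    rw [Prog.cost]
    have := Nat.mul_le_mul_right ((p.cost (maxVal b L) + 3) * W) (hσ i)
    nlinarith

end CompRun

/-! ## Polynomial bounds -/

/-- One constant serves as factor and as exponent, which is the form of the time bound in
`Machine.Bounded`. -/
def PolyBdd (f : ℕ → ℕ) : Prop := ∃ C, ∀ n, f n ≤ C * (n + 1) ^ C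

theorem PolyBdd.of_le {f g : ℕ → ℕ} (hg : PolyBdd g) (h : ∀ n, f n ≤ g n) : PolyBdd f := by
  obtain ⟨C, hC⟩ := hg
  exact ⟨C, fun n => (h n).trans (hC n)⟩

theorem PolyBdd.const (c : ℕ) : PolyBdd fun _ => c :=
  ⟨c, fun n => Nat.le_mul_of_pos_right _ (by positivity)⟩

theorem PolyBdd.id : PolyBdd fun n => n := ⟨1, fun n => by simp⟩

theorem PolyBdd.add {f g : ℕ → ℕ} (hf : PolyBdd f) (hg : PolyBdd g) :
    PolyBdd fun n => f n + g n := by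
  obtain ⟨C, hC⟩ := hf
  obtain ⟨D, hD⟩ := hg
  refine ⟨C + D, fun n => (Nat.add_le_add (hC n) (hD n)).trans ?_⟩
  rw [add_mul]
  gcongr <;> omega

theorem PolyBdd.mul {f g : ℕ → ℕ} (hf : PolyBdd f) (hg : PolyBdd g) :
    PolyBdd fun n => f n * g n := by
  obtain ⟨C, hC⟩ := hf
  obtain ⟨D, hD⟩ := hg
  refine ⟨C * D + C + D, fun n => (Nat.mul_le_mul (hC n) (hD n)).trans ?_⟩
  rw [show C * (n + 1) ^ C * (D * (n + 1) ^ D) = C * D * (n + 1) ^ (C + D) by ring]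
  gcongr
  · omega
  · omega
  · omega

theorem PolyBdd.pow {f : ℕ → ℕ} (hf : PolyBdd f) (k : ℕ) : PolyBdd fun n => f n ^ k := by
  induction k with
  | zero => simpa using PolyBdd.const 1
  | succ k ih => simpa [pow_succ] using ih.mul hf

theorem PolyBdd.comp_cost {A B ι : Type} (p : Prog A B ι) {f : ℕ → ℕ} (hf : PolyBdd f) :
    PolyBdd fun n => p.cost (f n) := by
  induction p with
  | skip | fail => exact PolyBdd.const 0
  | inc | dec | setmax | emit => exact PolyBdd.const 1
  | seq p q ihp ihq => exact ihp.add ihq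
  | choose p q ihp ihq | ifz _ p q ihp ihq => exact (ihp.add ihq).add (.const 2)
  | ifsym _ _ p q ihp ihq =>
    exact (ihp.add ihq).add (((PolyBdd.const 13).mul hf).add (.const 6))
  | loop _ p ih =>
    exact ((hf.mul (ih.add (.const 3))).add ((PolyBdd.const 9).mul hf)).add (.const 3)

/-! ## The compiled machine -/

section Compile

variable {A B ι : Type} [Finite ι] [DecidableEq ι]

/-- The code that counts the cells of the input tape and sets the stop markers, followed by the code
of `p`. -/
def fullCode (p : Prog A B ι) : List (Instr A B (Option (ι ⊕ Fin (p.depth + 1)))) :=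
  [.inc none, .hright, .jsym .rightEnd 4, .jmp 0, .mark] ++ p.comp (p.depth + 1) 5 0

theorem length_fullCode (p : Prog A B ι) : (fullCode p).length = 5 + p.size := by
  simp [fullCode, Prog.length_comp]; ring

variable {p : Prog A B ι} {b : ℕ} {x : List A} {S W : ℕ} {y : List B} {t n : ℕ}

/-- The number of binary digits that is used for inputs of length `n`. -/
def numDigits (n : ℕ) : ℕ := (digs 1 (n + 1)).length

theorem readInput_succ_eq_rightEnd {i : ℕ} : readInput x (i + 1) = .rightEnd ↔ x.length ≤ i := by
  simp only [readInput]
  rcases lt_or_ge i x.length with h | h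
  · simp [h]
  · simp [h]

/-- The input head advances one cell per increment of the binary counter until it sees the right end
marker. The counter then holds `|x| + 1`, and the length of its binary expansion is the amount of
space that all registers will get. -/
theorem run_count (hW : 2 * S + x.length + 10 ≤ W) (hS : numDigits x.length + 2 ≤ S) (hb : 1 ≤ b)
    (e j : ℕ) (hej : e + j = x.length)
    (H : MRun b (bases b) none (fullCode p) x S y t
      (rcfg b (bases b) none (fullCode p) (fun _ => 0) 4
        (vals (x.length + 1) (fun _ => 0) (fun _ => 0)) (x.length + 1) []) n) :
    MRun b (bases b) none (fullCode p) x S y (t + (e + 1) * (4 * W))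
      (rcfg b (bases b) none (fullCode p) (fun _ => 0) 0
        (vals j (fun _ => 0) (fun _ => 0)) j []) n := by
  induction e generalizing j with
  | zero =>
    rw [Nat.zero_add] at hej
    subst hej
    refine Run.mono (t := t + W + W + W) ?_ (by nlinarith)
    refine MRun.inc hW (r := none) rfl hb (by omega) (.inl rfl) ?_ ?_
    · change (digs 1 (x.length + 1)).length ≤ S
      unfold numDigits at hS; omega
    refine MRun.hright hW rfl (by omega) ?_
    refine MRun.jsym hW rfl (min_le_right _ _) (by omega) (fun _ => ?_) (fun h => ?_)
    · have : upd (vals x.length (fun _ => 0) (fun _ => 0)) none (x.length + 1) =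
          vals (D := p.depth + 1) (x.length + 1) (fun _ : ι => 0) (fun _ => 0) := by
        funext r
        rcases r with _ | r | r <;> simp [upd, vals]
      simpa [vals, this] using H
    · rw [min_self] at h
      exact absurd (readInput_succ_eq_rightEnd.2 le_rfl) h
  | succ e ih =>
    have h1 := ih (j + 1) (by omega)
    refine Run.mono (t := t + (e + 1) * (4 * W) + W + W + W + W) ?_ (by nlinarith)
    refine MRun.inc hW (r := none) rfl hb (by omega) (.inl rfl) ?_ ?_
    · change (digs 1 (j + 1)).length ≤ S
      have : (digs 1 (j + 1)).length ≤ numDigits x.length :=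
        length_digs_le.2 ((by omega : j + 1 ≤ x.length + 1).trans (length_digs_le.1 le_rfl))
      omega
    refine MRun.hright hW rfl (by omega) ?_
    have hmin : min (j + 1) (x.length + 1) = j + 1 := by omega
    refine MRun.jsym hW rfl (min_le_right _ _) (by omega) (fun h => ?_) (fun _ => ?_)
    · rw [hmin, readInput_succ_eq_rightEnd] at h
      omega
    · refine MRun.jmp hW rfl (min_le_right _ _) (by omega) ?_
      have : upd (vals j (fun _ => 0) (fun _ => 0)) none (j + 1) =
          vals (D := p.depth + 1) (j + 1) (fun _ : ι => 0) (fun _ => 0) := by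
        funext r
        rcases r with _ | r | r <;> simp [upd, vals]
      rw [hmin]
      simp only [vals, this]
      exact h1

theorem run_all {code : List (Instr A B (Option (ι ⊕ Fin (p.depth + 1))))} {pc pc' h : ℕ}
    {ph ph' : Phase} {j : ℕ} {w w' : Option (ι ⊕ Fin (p.depth + 1)) → ℕ → TSym b} {o : List B}
    {d : Dir} {ins} {s : Option (ι ⊕ Fin (p.depth + 1)) → TSym b}
    (hc : code[pc]? = some ins) (hS : j ≤ S) (hh : h ≤ x.length + 1)
    (hacts : ins.acts (bases b) none (fun ph => some (Fin.ofNat (code.length + 1) pc, ph))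
      (fun j => some (Fin.ofNat (code.length + 1) j, .run)) (pc + 1) (readInput x h)
      (fun i => w i j) ph =
      {⟨some (Fin.ofNat (code.length + 1) pc', ph'), s, fun _ => d, .stay, none⟩})
    (hw : ∀ i, Function.update (w i) j (s i) = w' i)
    (H : MRun b (bases b) none code x S y t
      (mcfg b (bases b) none code pc' ph' h w' (fun _ => moveHead d j) o) n) :
    MRun b (bases b) none code x S y (t + 1)
      (mcfg b (bases b) none code pc ph h w (fun _ => j) o) n := by
  refine MRun.step ((enabled_mcfg hc).trans hacts) (fun _ => hS) ?_
  have : (mach b (bases b) none code).apply x (mcfg b (bases b) none code pc ph h w (fun _ => j) o)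
      ⟨some (Fin.ofNat (code.length + 1) pc', ph'), s, fun _ => d, .stay, none⟩ =
      mcfg b (bases b) none code pc' ph' h w' (fun _ => moveHead d j) o := by
    simp only [Machine.apply, mcfg, moveHead, min_eq_left hh, Option.toList_none, List.append_nil]
    congr 1
    funext i
    exact hw i
  rw [this]
  exact H

/-- All heads walk in parallel with the head on the counter tape. When that one leaves its last
digit, the others stand in the cell where their stop markers belong. -/
theorem run_mark (hW : 2 * S + x.length + 10 ≤ W) (hS : numDigits x.length + 2 ≤ S)
    (H : SRun x S y t (scfg b (fullCode p) (numDigits x.length) (x.length + 1) 5 (fun _ => 0)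
      (fun _ => 0) (x.length + 1) []) n) :
    MRun b (bases b) none (fullCode p) x S y (t + W)
      (rcfg b (bases b) none (fullCode p) (fun _ => 0) 4
        (vals (x.length + 1) (fun _ => 0) (fun _ => 0)) (x.length + 1) []) n := by
  have hc : (fullCode p)[4]? = some .mark := rfl
  set L := numDigits x.length with hL
  set w : Option (ι ⊕ Fin (p.depth + 1)) → ℕ → TSym b := fun r => content b 0 (digs (bases b r)
    (vals (x.length + 1) (fun _ => 0) (fun _ => 0) r)) with hw
  set w' : Option (ι ⊕ Fin (p.depth + 1)) → ℕ → TSym b := fun r => content b (stops L r)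
    (digs (bases b r) (vals (x.length + 1) (fun _ => 0) (fun _ => 0) r)) with hw'
  have hnone : ∀ j, w none j = content b 0 (digs 1 (x.length + 1)) j := fun _ => rfl
  have hnone' : ∀ j, w' none j = content b 0 (digs 1 (x.length + 1)) j := fun _ => rfl
  have hback : ∀ j, j ≤ L + 1 → MRun b (bases b) none (fullCode p) x S y (t + (j + 1))
      (mcfg b (bases b) none (fullCode p) 4 .back (x.length + 1) w' (fun _ => j) []) n := by
    intro j
    induction j with
    | zero =>
      intro _
      refine run_all hc (Nat.zero_le _) le_rfl (pc' := 5) (ph' := .run) (d := .right) (w' := w')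
        (s := fun i => w' i 0) ?_ (fun i => Function.update_eq_self _ _) H
      simp only [Instr.acts, hnone', content_zero]
    | succ j ih =>
      intro hj
      refine run_all hc (by omega) le_rfl (pc' := 4) (ph' := .back) (d := .left) (w' := w')
        (s := fun i => w' i (j + 1)) ?_ (fun i => Function.update_eq_self _ _) (ih (by omega))
      have := content_ne_base (b := b) (m := 0) (digs 1 (x.length + 1)) (Nat.succ_ne_zero j)
      simp only [Instr.acts, hnone']
  have hwalk : ∀ e j, e + j = L → ∀ ph, ph = Phase.run ∨ ph = Phase.walk →
      MRun b (bases b) none (fullCode p) x S y (t + (L + 1 + 1) + 1 + e)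
      (mcfg b (bases b) none (fullCode p) 4 ph (x.length + 1) w (fun _ => j + 1) []) n := by
    intro e
    induction e with
    | zero =>
      intro j hj ph hph
      rw [zero_add] at hj
      have hbl : content b 0 (digs 1 (x.length + 1)) (j + 1) = .blank := by
        rw [hj, hL]; exact content_end (b := b) (m := 0) (digs 1 (x.length + 1))
      refine run_all hc (by omega) le_rfl (pc' := 4) (ph' := .back) (d := .stay) (w' := w')
        (s := fun i => if i = none then w i (j + 1) else .fence) ?_ ?_
        (by rw [hj]; exact hback _ le_rfl)
      · rcases hph with rfl | rfl <;> simp only [Instr.acts, hnone, hbl]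
      · intro i
        rcases i with _ | i
        · exact Function.update_eq_self _ _
        -- All other registers are still zero, so their tapes hold nothing but the marker in cell
        -- `0`, and adding a stop marker is all that changes.
        · have h0 : digs b (vals (x.length + 1) (fun _ => 0) (fun _ => 0) (some i)) = [] := by
            rcases i with i | i <;> rfl
          simp only [hw, hw', bases, stops, h0, reduceCtorEq, if_false, hj]
          funext z
          by_cases hz : z = L + 1
          · subst hz; simp [content]
          · by_cases hz0 : z = 0 <;> simp [content, hz, hz0]
    | succ e ih =>
      intro j hj ph hph
      have hlt : j < (digs 1 (x.length + 1)).length := by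
        change j < numDigits x.length
        omega
      have hdig : content b 0 (digs 1 (x.length + 1)) (j + 1) =
          digit b ((digs 1 (x.length + 1))[j]) := by
        simp [content, List.getElem?_eq_getElem hlt]
      refine run_all hc (by omega) le_rfl (pc' := 4) (ph' := .walk) (d := .right) (w' := w)
        (s := fun i => w i (j + 1)) ?_ (fun i => Function.update_eq_self _ _)
        (ih (j + 1) (by omega) .walk (.inr rfl))
      rcases hph with rfl | rfl <;> simp only [Instr.acts, hnone, hdig, digit]
  exact (hwalk L 0 (by omega) .run (.inl rfl)).mono (by omega)

/-- The base that is used for registers with values at least up to `(n + 2) ^ C`. -/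
def baseFor (C : ℕ) : ℕ := 4 ^ (C + 1) - 1

/-- The values of the registers on inputs of length `n`. -/
def capFor (C n : ℕ) : ℕ := maxVal (baseFor C) (numDigits n)

theorem baseFor_succ (C : ℕ) : baseFor C + 1 = 4 ^ (C + 1) :=
  Nat.sub_add_cancel (Nat.one_le_pow _ _ (by norm_num))

/-- With `L` binary digits for the input length, `n + 2 ≤ 4 ^ L`; the base `4 ^ (C + 1)` raises this
to the power `C + 1`. The surplus in the exponent absorbs the `1` lost in `maxVal`. -/
theorem pow_le_capFor (C n : ℕ) : (n + 2) ^ C ≤ capFor C n := by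
  have h1 : n + 1 ≤ maxVal 1 (numDigits n) := length_digs_le.1 le_rfl
  have h2 := maxVal_le_pow 1 (numDigits n)
  have h3 : n + 2 ≤ 4 ^ numDigits n :=
    (by omega : n + 2 ≤ (1 + 2) ^ numDigits n).trans (Nat.pow_le_pow_left (by norm_num) _)
  have h4 : (n + 2) ^ (C + 1) ≤ maxVal (baseFor C) (numDigits n) + 1 := by
    refine le_trans ?_ (pow_le_maxVal _ _)
    rw [baseFor_succ, ← pow_mul, mul_comm, pow_mul]
    exact Nat.pow_le_pow_left h3 _
  have h5 : (n + 2) ^ C < (n + 2) ^ (C + 1) := Nat.pow_lt_pow_right (by omega) (by omega)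
  unfold capFor
  omega

theorem two_pow_numDigits_le (n : ℕ) : 2 ^ numDigits n ≤ 2 * (n + 1) := by
  obtain ⟨l, hl⟩ : ∃ l, numDigits n = l + 1 :=
    ⟨numDigits n - 1, by
      have : numDigits n ≠ 0 := by
        simp [numDigits, digs_eq_nil]
      omega⟩
  have h1 : maxVal 1 l < n + 1 := by
    by_contra! h
    have := length_digs_le.2 h
    change numDigits n ≤ l at this
    omega
  have h2 := pow_le_maxVal 1 l
  rw [hl, pow_succ]
  norm_num at h2
  omega

theorem numDigits_le_log (n : ℕ) : numDigits n ≤ Nat.log 2 n + 2 := by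
  have h1 := two_pow_numDigits_le n
  have h2 : n + 1 ≤ 2 ^ (Nat.log 2 n + 1) := Nat.lt_pow_succ_log_self (by norm_num) n
  have h3 : 2 ^ numDigits n ≤ 2 ^ (Nat.log 2 n + 2) := by
    rw [pow_succ]; omega
  exact (Nat.pow_le_pow_iff_right (by norm_num)).1 h3

/-- The base is a constant and `2 ^ numDigits n ≤ 2 * (n + 1)`, so a constant raised to the power
`numDigits n` is polynomial in `n`. -/
theorem capFor_polyBdd (C : ℕ) : PolyBdd (capFor C) := by
  have h : PolyBdd fun n => (2 * (n + 1)) ^ (2 * (C + 2)) :=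
    ((PolyBdd.const 2).mul (PolyBdd.id.add (.const 1))).pow _
  refine h.of_le fun n => ?_
  have h1 := maxVal_le_pow (baseFor C) (numDigits n)
  have h2 : baseFor C + 2 ≤ 4 ^ (C + 2) := by
    have := baseFor_succ C
    have h3 : 1 ≤ 4 ^ (C + 1) := Nat.one_le_pow _ _ (by norm_num)
    rw [show 4 ^ (C + 2) = 4 ^ (C + 1) * 4 from pow_succ _ _]
    omega
  calc capFor C n ≤ (baseFor C + 2) ^ numDigits n := by unfold capFor; omega
    _ ≤ (4 ^ (C + 2)) ^ numDigits n := Nat.pow_le_pow_left h2 _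
    _ = (2 ^ numDigits n) ^ (2 * (C + 2)) := by
      rw [show (4 : ℕ) = 2 ^ 2 by norm_num, ← pow_mul, ← pow_mul, ← pow_mul]
      congr 1
      ring
    _ ≤ _ := Nat.pow_le_pow_left (two_pow_numDigits_le n) _

open Classical in
/-- Register programs can be executed by logspace machines. -/
theorem exists_machine (p : Prog A B ι) (C : ℕ) : ∃ M : Machine A B, M.IsLogspace ∧
    ∀ x y, M.numAccOut x y =
      wp x (capFor C x.length) emitOut p (fun _ o => if o = y then 1 else 0) (fun _ => 0) [] := by
  set b := baseFor C with hb
  have hb1 : 1 ≤ b := by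
    have := baseFor_succ C
    have : 4 ≤ 4 ^ (C + 1) := Nat.le_self_pow (by omega) 4
    omega
  set M := mach b (bases b) none (fullCode p) with hM
  have key : ∀ x y, MRun b (bases b) none (fullCode p) x (numDigits x.length + 2) y
      (0 + p.cost (maxVal b (numDigits x.length)) * (2 * (numDigits x.length + 2) + x.length + 10) +
        (2 * (numDigits x.length + 2) + x.length + 10) +
        (x.length + 1) * (4 * (2 * (numDigits x.length + 2) + x.length + 10)) + 1) M.init
      (wp x (capFor C x.length) emitOut p (fun _ o => if o = y then 1 else 0) (fun _ => 0) []) := by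
    intro x y
    set S := numDigits x.length + 2 with hS
    have h1 : SRun x S y (0 + p.cost (maxVal b (numDigits x.length)) * (2 * S + x.length + 10))
        (scfg b (fullCode p) (numDigits x.length) (x.length + 1) 5 (fun _ => 0) (fun _ => 0)
          (x.length + 1) [])
        (wp x (capFor C x.length) emitOut p (fun _ o => if o = y then 1 else 0) (fun _ => 0) []) := by
      refine comp_run le_rfl le_rfl p (d := 0) (At.self [_, _, _, _, _] _) (by omega)
        (fun _ _ _ => rfl) (fun σ' h' o' _ _ => ?_) (fun _ => Nat.zero_le _) le_rfl
      rw [← length_fullCode]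
      exact MRun.finish (by omega)
    have h2 := run_count le_rfl le_rfl hb1 x.length 0 (by omega) (run_mark le_rfl le_rfl h1)
    -- The first step of the machine writes the marker into cell `0` of each tape and moves all
    -- heads to cell `1`, which makes every tape a register of value `0`.
    refine MRun.step (a := ⟨some (0, .run), fun _ => .base, fun _ => .right, .stay, none⟩) rfl
      (fun _ => Nat.zero_le _) ?_
    convert h2 using 1
    simp only [Machine.apply, Machine.init, moveHead, rcfg, mcfg]
    congr 1
    · funext r z
      have : digs (bases b r) (vals 0 (fun _ => 0) (fun _ => 0) r) = [] := by
        rcases r with _ | r | r <;> rfl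
      rw [this]
      by_cases hz : z = 0
      · subst hz; simp [content]
      · simp [content, hz]
        rfl
  refine ⟨M, ?_, fun x y => (key x y).numBranches_eq⟩
  have hT : PolyBdd fun n => 0 + p.cost (maxVal b (numDigits n)) * (2 * (numDigits n + 2) + n + 10) +
      (2 * (numDigits n + 2) + n + 10) + (n + 1) * (4 * (2 * (numDigits n + 2) + n + 10)) + 1 := by
    have hd : PolyBdd numDigits := (PolyBdd.id.add (.const 2)).of_le fun n =>
      (numDigits_le_log n).trans (Nat.add_le_add_right (Nat.log_le_self 2 n) 2)
    have hW : PolyBdd fun n => 2 * (numDigits n + 2) + n + 10 :=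
      (((PolyBdd.const 2).mul (hd.add (.const 2))).add .id).add (.const 10)
    exact ((((PolyBdd.const 0).add ((PolyBdd.comp_cost p (capFor_polyBdd C)).mul hW)).add hW).add
      ((PolyBdd.id.add (.const 1)).mul ((PolyBdd.const 4).mul hW))).add (.const 1)
  obtain ⟨T, hT⟩ := hT
  refine ⟨T + 4, fun x l c hl => ?_⟩
  -- The bounds on time and space are the same for every `y`, so any output word serves here.
  obtain ⟨h1, h2⟩ := (key x []).branch hl
  refine ⟨(h1.trans (hT _)).trans ?_, fun i => (h2 i).trans ?_⟩
  · gcongr <;> omega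
  · have := numDigits_le_log x.length
    nlinarith

end Compile

/-! ## Finite types -/

/-- A list of all elements. -/
noncomputable def elems (α : Type) [Finite α] : List α := (@Finset.univ α (Fintype.ofFinite α)).toList

theorem mem_elems {α : Type} [Finite α] (a : α) : a ∈ elems α := by
  let := Fintype.ofFinite α
  simp [elems]

theorem nodup_elems (α : Type) [Finite α] : (elems α).Nodup := Finset.nodup_toList _

/-- The distinguished element gets the number `0` so that, with the start state and the blank in
this role, the all-zero store represents the initial configuration. -/
theorem exists_numbering {α : Type} [Finite α] (a : α) :
    ∃ f : α → ℕ, Function.Injective f ∧ f a = 0 ∧ ∀ b, f b < Nat.card α := by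
  classical
  let e := Finite.equivFin α
  have h0 : 0 < Nat.card α := Nat.card_pos_iff.2 ⟨⟨a⟩, inferInstance⟩
  let e' := e.trans (Equiv.swap (e a) ⟨0, h0⟩)
  refine ⟨fun b => (e' b).val, fun b c h => e'.injective (Fin.ext h), ?_, fun b => (e' b).isLt⟩
  simp [e']

/-- A numbering of the elements of a finite type that starts with `a`. -/
noncomputable def num {α : Type} [Finite α] (a : α) : α → ℕ := (exists_numbering a).choose

theorem num_injective {α : Type} [Finite α] (a : α) : Function.Injective (num a) :=
  (exists_numbering a).choose_spec.1

theorem num_self {α : Type} [Finite α] (a : α) : num a a = 0 :=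
  (exists_numbering a).choose_spec.2.1

theorem num_lt {α : Type} [Finite α] (a b : α) : num a b < Nat.card α :=
  (exists_numbering a).choose_spec.2.2 b

/-! ## Tapes in registers -/

section Tape

variable {Sym : Type} (g : ℕ) (e : Sym → ℕ)

/-- The cells below the head as a number in base `g`. -/
def leftVal (u : ℕ → Sym) : ℕ → ℕ
  | 0 => 0
  | h + 1 => g * leftVal u h + e (u h) + 1

/-- The numbers `l`, `s`, `r` represent the part to the left of the head, the scanned symbol, and
the part to the right of the head; the cells from `S + 1` on are blank. -/
structure TapeEnc (S : ℕ) (u : ℕ → Sym) (h l s r : ℕ) : Prop where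
  left : l = leftVal g e u h
  cur : s = e (u h)
  right : ∀ j, e (u (h + 1 + j)) = r / g ^ j % g
  right_lt : r < g ^ (S + 1 - h)

variable {g e} {S h l s r : ℕ} {u : ℕ → Sym}

theorem leftVal_lt (hg : ∀ a, e a + 1 < g) (u : ℕ → Sym) (h : ℕ) : leftVal g e u h < g ^ h := by
  induction h with
  | zero => simp [leftVal]
  | succ h ih =>
    have h1 := hg (u h)
    have h2 := Nat.mul_le_mul_left g ih
    rw [Nat.mul_succ] at h2
    rw [pow_succ', leftVal]
    omega

theorem leftVal_congr {u' : ℕ → Sym} (h : ℕ) (hu : ∀ j < h, u j = u' j) :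
    leftVal g e u h = leftVal g e u' h := by
  induction h with
  | zero => rfl
  | succ h ih => rw [leftVal, leftVal, ih fun j hj => hu j (by omega), hu h (by omega)]

theorem TapeEnc.write (he : TapeEnc g e S u h l s r) (a : Sym) :
    TapeEnc g e S (Function.update u h a) h l (e a) r where
  left := he.left.trans (leftVal_congr h fun j hj => by simp [hj.ne])
  cur := by simp
  right j := by
    rw [Function.update_of_ne (by omega)]
    exact he.right j
  right_lt := he.right_lt

theorem TapeEnc.move_right (he : TapeEnc g e S u h l s r)
    (hS : h + 1 ≤ S) : TapeEnc g e S u (h + 1) (g * l + s + 1) (r % g) (r / g) where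
  left := by rw [leftVal, he.left, he.cur]
  cur := by simpa using (he.right 0).symm
  right j := by
    rw [show h + 1 + 1 + j = h + 1 + (j + 1) by ring, he.right, Nat.div_div_eq_div_mul, pow_succ']
  right_lt := by
    have h1 := he.right_lt
    rw [show S + 1 - h = S + 1 - (h + 1) + 1 by omega, pow_succ] at h1
    exact Nat.div_lt_of_lt_mul (by rwa [mul_comm])

/-- Digits to the left of the head are shifted by one, so that the value `0` means that the head is
in cell `0`; hence the `- 1` for the symbol popped. To the right they are not shifted, so that an
infinite blank tail contributes only zeros once the blank has number `0`. -/
theorem TapeEnc.move_left (hg : ∀ a, e a + 1 < g) (he : TapeEnc g e S u (h + 1) l s r)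
    (hS : h + 1 ≤ S) : TapeEnc g e S u h (l / g) (l % g - 1) (g * r + s) where
  left := by
    have := hg (u h)
    rw [he.left, leftVal, add_assoc, Nat.mul_add_div (by omega), Nat.div_eq_of_lt this, add_zero]
  cur := by
    have := hg (u h)
    rw [he.left, leftVal, add_assoc, Nat.mul_add_mod, Nat.mod_eq_of_lt this, Nat.add_sub_cancel]
  right j := by
    have h0 := hg (u (h + 1))
    cases j with
    | zero =>
      rw [pow_zero, Nat.div_one, Nat.mul_add_mod, he.cur, add_zero, Nat.mod_eq_of_lt (by omega)]
    | succ j =>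
      rw [show h + 1 + (j + 1) = h + 1 + 1 + j by ring, he.right, pow_succ', ← Nat.div_div_eq_div_mul,
        Nat.mul_add_div (by omega), he.cur, Nat.div_eq_of_lt (show e (u (h + 1)) < g by omega), add_zero]
  right_lt := by
    have h0 := hg (u (h + 1))
    have h1 := Nat.mul_le_mul_left g he.right_lt
    rw [show S + 1 - h = S + 1 - (h + 1) + 1 by omega, pow_succ']
    rw [Nat.mul_succ] at h1
    rw [he.cur]
    omega

end Tape

/-! ### Head moves as arithmetic on registers -/

section MoveTape

variable {A B ι : Type} {x : List A} {K : ℕ} {σ : ι → ℕ}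

namespace Prog

/-- The move of a head on a tape in the registers `l`, `s`, `r`, with the help of `t`. -/
def moveTape (g : ℕ) (l s r t : ι) : Dir → Prog A B ι
  | .stay => skip
  | .right => seq (push l s t g 1) (divMod r s t g)
  | .left => ifz l skip (seq (push r s t g 0) (seq (divMod l s t g) (dec s)))

end Prog

variable {Sym : Type} {g : ℕ} {e : Sym → ℕ} {S h : ℕ} {u : ℕ → Sym} {l s r t : ι}

/-- A move pushes the scanned symbol onto one of the two stacks and pops the next one from the
other. The bound `g ^ (S + 2) ≤ K` leaves room for the push. -/
theorem det_moveTape (hg : ∀ a, e a + 1 < g) (hK : g ^ (S + 2) ≤ K) (hls : l ≠ s) (hlr : l ≠ r)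
    (hlt : l ≠ t) (hsr : s ≠ r) (hst : s ≠ t) (hrt : r ≠ t) (ht : σ t = 0)
    (he : TapeEnc g e S u h (σ l) (σ s) (σ r)) (hS : h ≤ S) (d : Dir) (hS' : moveHead d h ≤ S) :
    ∃ σ', Det (B := B) x K (Prog.moveTape g l s r t d) σ σ' ∧
      TapeEnc g e S u (moveHead d h) (σ' l) (σ' s) (σ' r) ∧
      ∀ i, i ≠ l → i ≠ s → i ≠ r → σ' i = σ i := by
  have hg0 : 2 ≤ g := by have := hg (u 0); omega
  have hgK : g ≤ K := (Nat.le_self_pow (by omega) g).trans hK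
  have hl := he.left ▸ leftVal_lt hg u h
  have hpow : ∀ m ≤ S + 2, g ^ m ≤ K := fun m hm =>
    (Nat.pow_le_pow_right (by omega) hm).trans hK
  have hlK : σ l ≤ K := hl.le.trans (hpow _ (by omega))
  have hrK : σ r ≤ K := he.right_lt.le.trans (hpow _ (by omega))
  have hsg : σ s + 1 < g := he.cur ▸ hg _
  cases d with
  | stay => exact ⟨σ, Det.skip, he, fun _ _ _ _ => rfl⟩
  | right =>
    have hb : g * σ l + σ s + 1 ≤ K := by
      have h1 := Nat.mul_le_mul_left g hl
      have h2 := hpow (h + 1) (by omega)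
      rw [pow_succ'] at h2
      rw [Nat.mul_succ] at h1
      omega
    refine ⟨_, Det.seq (Det.push hlt hls ht hlK hb) (Det.divMod (i := r) (s := s) (t := t) hrt hsr.symm
      hst (by simp [hlt.symm, ht]) (by simpa [hlr.symm] using hrK) (by omega) hgK), ?_, ?_⟩
    · have := he.move_right hS'
      simpa [hls, hls.symm, hlr, hlr.symm, hsr, hsr.symm, moveHead] using this
    · intro i h1 h2 h3
      simp [h1, h2, h3]
  | left =>
    cases h with
    | zero =>
      refine ⟨σ, Det.ifz_pos (by rw [he.left, leftVal]) Det.skip, he, fun _ _ _ _ => rfl⟩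
    | succ h =>
      have hl0 : σ l ≠ 0 := by rw [he.left, leftVal]; omega
      have hb : g * σ r + σ s + 0 ≤ K := by
        have h1 := Nat.mul_le_mul_left g he.right_lt
        have h2 := hpow (S + 1 - (h + 1) + 1) (by omega)
        rw [pow_succ'] at h2
        rw [Nat.mul_succ] at h1
        omega
      refine ⟨_, Det.ifz_neg hl0 (Det.seq (Det.push hrt hsr.symm ht hrK hb)
        (Det.seq (Det.divMod (i := l) (s := s) (t := t) hlt hls hst (by simp [hrt.symm, ht])
          (by simpa [hlr] using hlK) (by omega) hgK) (Det.dec s))), ?_, ?_⟩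
      · have := he.move_left hg hS
        simpa [hls, hls.symm, hlr, hlr.symm, hsr, hsr.symm, moveHead] using this
      · intro i h1 h2 h3
        simp [h1, h2, h3]

end MoveTape

/-! ## Configurations in registers -/

/-- The registers for a configuration of a machine with the tapes `T`. -/
inductive CReg (T : Type)
  | st
  | hd
  | left (t : T)
  | cur (t : T)
  | right (t : T)

instance {T : Type} [Finite T] : Finite (CReg T) := by
  refine Finite.of_surjective (fun i : (Option Unit) ⊕ (T ⊕ T ⊕ T) => match i with
    | .inl none => CReg.st
    | .inl (some ()) => CReg.hd
    | .inr (.inl t) => CReg.left t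
    | .inr (.inr (.inl t)) => CReg.cur t
    | .inr (.inr (.inr t)) => CReg.right t) ?_
  rintro (_ | _ | t | t | t)
  exacts [⟨.inl none, rfl⟩, ⟨.inl (some ()), rfl⟩, ⟨.inr (.inl t), rfl⟩, ⟨.inr (.inr (.inl t)), rfl⟩,
    ⟨.inr (.inr (.inr t)), rfl⟩]

section Config

variable {A B₀ : Type} (M : Machine A B₀)

instance : Finite M.State := M.finite_state
instance : Finite M.Sym := M.finite_sym
instance : Finite M.Tape := M.finite_tape

/-- The base for the numbers that represent tape contents. -/
noncomputable def Machine.radix : ℕ := Nat.card M.Sym + 1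

theorem Machine.num_lt_radix (a : M.Sym) : num M.blank a + 1 < M.radix := by
  have := num_lt M.blank a
  unfold Machine.radix
  omega

/-- The values `v` represent the configuration `c`, the heads of which are in the cells up to `S`. -/
structure Enc (x : List A) (S : ℕ) (c : M.Cfg) (v : CReg M.Tape → ℕ) : Prop where
  st : v .st = num M.start c.state
  hd : v .hd = c.inputHead
  hd_le : c.inputHead ≤ x.length + 1
  tape : ∀ t, TapeEnc M.radix (num M.blank) S (c.work t) (c.workHead t) (v (.left t)) (v (.cur t))
    (v (.right t))
  head_le : ∀ t, c.workHead t ≤ S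

/-- `K` is large enough for configurations with heads in the cells up to `S`. -/
structure Big (x : List A) (S K : ℕ) : Prop where
  state : Nat.card M.State ≤ K
  input : x.length + 1 ≤ K
  tape : M.radix ^ (S + 2) ≤ K

theorem Enc.init (x : List A) (S : ℕ) : Enc M x S M.init (fun _ => 0) where
  st := (num_self _).symm
  hd := rfl
  hd_le := Nat.zero_le _
  tape _ :=
    { left := rfl
      cur := (num_self _).symm
      right := fun j => by simp [Machine.init, num_self]
      right_lt := Nat.pow_pos (by unfold Machine.radix; omega) }
  head_le _ := Nat.zero_le _

variable {M} {B ι : Type} {x : List A} {S K : ℕ} {c : M.Cfg} {σ : ι → ℕ} {v : CReg M.Tape → ℕ}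

theorem Enc.le (hE : Enc M x S c v) (hK : Big M x S K) (r : CReg M.Tape) : v r ≤ K := by
  have hg : 0 < M.radix := by unfold Machine.radix; omega
  have hpow : ∀ m ≤ S + 2, M.radix ^ m ≤ K := fun m hm =>
    (Nat.pow_le_pow_right hg hm).trans hK.tape
  cases r with
  | st => rw [hE.st]; exact (num_lt _ _).le.trans hK.state
  | hd => rw [hE.hd]; exact hE.hd_le.trans hK.input
  | left t =>
    rw [(hE.tape t).left]
    have := hE.head_le t
    exact (leftVal_lt M.num_lt_radix _ _).le.trans (hpow _ (by omega))
  | cur t =>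
    rw [(hE.tape t).cur]
    have := M.num_lt_radix (c.work t (c.workHead t))
    have h1 := hpow 1 (by omega)
    rw [pow_one] at h1
    omega
  | right t => exact (hE.tape t).right_lt.le.trans (hpow _ (by omega))

namespace Prog

/-- The effect of an instruction on the registers for tape `t`. -/
noncomputable def tapeAct (β : CReg M.Tape → ι) (τ : ι) (a : M.Act) (t : M.Tape) : Prog A B ι :=
  seq (setc (β (.cur t)) (num M.blank (a.write t)))
    (moveTape M.radix (β (.left t)) (β (.cur t)) (β (.right t)) τ (a.moveWork t))

def headAct (i : ι) : Dir → Prog A B ι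
  | .stay => skip
  | .left => dec i
  | .right => ifsym i .rightEnd skip (inc i)

/-- The effect of an instruction on the registers for a configuration. -/
noncomputable def act (β : CReg M.Tape → ι) (τ : ι) (a : M.Act) : Prog A B ι :=
  seq (setc (β .st) (num M.start a.next))
    (seq (headAct (β .hd) a.moveInput) (each (tapeAct β τ a) (elems M.Tape)))

end Prog

theorem det_headAct {i : ι} (hi : σ i ≤ x.length + 1) (hK : x.length + 1 ≤ K) (d : Dir) :
    Det (B := B) x K (Prog.headAct i d) σ (upd σ i (min (moveHead d (σ i)) (x.length + 1))) := by
  cases d with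
  | stay =>
    have h : min (moveHead .stay (σ i)) (x.length + 1) = σ i := min_eq_left hi
    rw [h, upd_self]
    exact Det.skip
  | left =>
    have h : min (moveHead .left (σ i)) (x.length + 1) = σ i - 1 := by
      simp only [moveHead]; omega
    rw [h]
    exact Det.dec i
  | right =>
    constructor
    intro R _ em k
    rw [Prog.headAct, wp]
    have hr : readInput x (σ i) = .rightEnd ↔ σ i = x.length + 1 := by
      rcases h : σ i with _ | j
      · simp [readInput]
      · rw [readInput_succ_eq_rightEnd]; omega
    by_cases h : σ i = x.length + 1
    · rw [if_pos (hr.2 h), wp]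
      simp only [moveHead]
      rw [min_eq_right (by omega), ← h, upd_self]
    · rw [if_neg (mt hr.1 h), wp, if_pos (by omega)]
      simp only [moveHead]
      rw [min_eq_left (by omega)]

theorem det_tapeAct {β : CReg M.Tape → ι} (hβ : Function.Injective β) {τ : ι}
    (hτ : τ ∉ Set.range β) (h0 : σ τ = 0) (hK : Big M x S K) (a : M.Act) (t : M.Tape)
    (he : TapeEnc M.radix (num M.blank) S (c.work t) (c.workHead t) (σ (β (.left t)))
      (σ (β (.cur t))) (σ (β (.right t)))) (hS : c.workHead t ≤ S)
    (hS' : (M.apply x c a).workHead t ≤ S) :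
    ∃ σ', Det (B := B) x K (Prog.tapeAct β τ a t) σ σ' ∧
      TapeEnc M.radix (num M.blank) S ((M.apply x c a).work t) ((M.apply x c a).workHead t)
        (σ' (β (.left t))) (σ' (β (.cur t))) (σ' (β (.right t))) ∧
      ∀ i, i ≠ β (.left t) → i ≠ β (.cur t) → i ≠ β (.right t) → σ' i = σ i := by
  have hne : ∀ r, β r ≠ τ := fun r h => hτ ⟨r, h⟩
  have h1 : β (.left t) ≠ β (.cur t) := hβ.ne (by simp)
  have h2 : β (.left t) ≠ β (.right t) := hβ.ne (by simp)
  have h3 : β (.cur t) ≠ β (.right t) := hβ.ne (by simp)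
  have hK1 : num M.blank (a.write t) ≤ K := by
    have h4 := M.num_lt_radix (a.write t)
    have h5 : M.radix ≤ M.radix ^ (S + 2) := Nat.le_self_pow (by omega) _
    have h6 := hK.tape
    omega
  obtain ⟨σ', hd, he', hfr⟩ := det_moveTape (A := A) (B := B) (x := x) (K := K)
    (σ := upd σ (β (.cur t)) (num M.blank (a.write t))) (S := S)
    (u := Function.update (c.work t) (c.workHead t) (a.write t)) (h := c.workHead t)
    (l := β (.left t)) (s := β (.cur t)) (r := β (.right t)) (t := τ) M.num_lt_radix hK.tape h1 h2
    (hne _) h3 (hne _) (hne _) (by simp [(hne _).symm, h0])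
    (by simpa [h1, h3.symm] using he.write (a.write t)) hS (a.moveWork t) hS'
  exact ⟨σ', Det.seq (Det.setc hK1) hd, he', fun i h4 h5 h6 => by simp [hfr i h4 h5 h6, h5]⟩

/-- The program `act` performs an instruction. -/
theorem det_act {β : CReg M.Tape → ι} (hβ : Function.Injective β) {τ : ι}
    (hτ : τ ∉ Set.range β) (h0 : σ τ = 0) (hK : Big M x S K) (a : M.Act)
    (hE : Enc M x S c fun r => σ (β r)) (hS : ∀ t, (M.apply x c a).workHead t ≤ S) :
    ∃ σ', Det (B := B) x K (Prog.act β τ a) σ σ' ∧ Enc M x S (M.apply x c a) (fun r => σ' (β r)) ∧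
      ∀ i, i ∉ Set.range β → σ' i = σ i := by
  set σ₁ := upd σ (β .st) (num M.start a.next) with hσ₁
  have hd1 : Det (B := B) x K (Prog.setc (β .st) (num M.start a.next)) σ σ₁ :=
    Det.setc ((num_lt _ _).le.trans hK.state)
  have hhd : σ₁ (β .hd) = c.inputHead := by
    rw [hσ₁, upd_ne _ _ (hβ.ne (by simp))]; exact hE.hd
  set σ₂ := upd σ₁ (β .hd) (min (moveHead a.moveInput (σ₁ (β .hd))) (x.length + 1)) with hσ₂
  have hd2 : Det (B := B) x K (Prog.headAct (β .hd) a.moveInput) σ₁ σ₂ :=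
    det_headAct (hhd ▸ hE.hd_le) hK.input _
  have hne : ∀ r, β r ≠ τ := fun r h => hτ ⟨r, h⟩
  have h20 : ∀ i, i ≠ β .st → i ≠ β .hd → σ₂ i = σ i := by
    intro i h1 h2
    rw [hσ₂, upd_ne _ _ h2, hσ₁, upd_ne _ _ h1]
  have hl : ∀ l : List M.Tape, l.Nodup → ∃ σ', Det (B := B) x K (Prog.each (Prog.tapeAct β τ a) l) σ₂ σ' ∧
      (∀ t ∈ l, TapeEnc M.radix (num M.blank) S ((M.apply x c a).work t)
        ((M.apply x c a).workHead t) (σ' (β (.left t))) (σ' (β (.cur t))) (σ' (β (.right t)))) ∧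
      ∀ i, (∀ t ∈ l, i ≠ β (.left t) ∧ i ≠ β (.cur t) ∧ i ≠ β (.right t)) → σ' i = σ₂ i := by
    -- The induction over the tapes needs an arbitrary current store that still agrees with `σ₂` on
    -- the tapes not yet treated.
    suffices H : ∀ l : List M.Tape, l.Nodup → ∀ ρ : ι → ℕ, (∀ t ∈ l, ρ (β (.left t)) = σ₂ (β (.left t))
        ∧ ρ (β (.cur t)) = σ₂ (β (.cur t)) ∧ ρ (β (.right t)) = σ₂ (β (.right t))) → ρ τ = 0 →
        ∃ σ', Det (B := B) x K (Prog.each (Prog.tapeAct β τ a) l) ρ σ' ∧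
      (∀ t ∈ l, TapeEnc M.radix (num M.blank) S ((M.apply x c a).work t)
        ((M.apply x c a).workHead t) (σ' (β (.left t))) (σ' (β (.cur t))) (σ' (β (.right t)))) ∧
      ∀ i, (∀ t ∈ l, i ≠ β (.left t) ∧ i ≠ β (.cur t) ∧ i ≠ β (.right t)) → σ' i = ρ i by
      intro l hl
      refine H l hl σ₂ (fun _ _ => ⟨rfl, rfl, rfl⟩) ?_
      rw [h20 τ (hne _).symm (hne _).symm, h0]
    intro l
    induction l with
    | nil => exact fun _ ρ _ _ => ⟨ρ, Det.skip, by simp, fun _ _ => rfl⟩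
    | cons t l ih =>
      intro hnd ρ hρ hρ0
      obtain ⟨hr1, hr2, hr3⟩ := hρ t (by simp)
      obtain ⟨ρ', hd, he, hfr⟩ := det_tapeAct (B := B) (c := c) hβ hτ hρ0 hK a t
        (by
          rw [hr1, hr2, hr3, h20 _ (hβ.ne (by simp)) (hβ.ne (by simp)),
            h20 _ (hβ.ne (by simp)) (hβ.ne (by simp)), h20 _ (hβ.ne (by simp)) (hβ.ne (by simp))]
          exact hE.tape t) (hE.head_le t) (hS t)
      have hnot : ∀ t' ∈ l, t' ≠ t := fun t' ht' h => (List.nodup_cons.1 hnd).1 (h ▸ ht')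
      obtain ⟨σ', hd', he', hfr'⟩ := ih (List.nodup_cons.1 hnd).2 ρ' (by
        intro t' ht'
        have := hnot t' ht'
        rw [hfr _ (hβ.ne (by simpa)) (hβ.ne (by simp)) (hβ.ne (by simp)),
          hfr _ (hβ.ne (by simp)) (hβ.ne (by simpa)) (hβ.ne (by simp)),
          hfr _ (hβ.ne (by simp)) (hβ.ne (by simp)) (hβ.ne (by simpa))]
        exact hρ t' (by simp [ht'])) (by rw [hfr _ (hne _).symm (hne _).symm (hne _).symm, hρ0])
      refine ⟨σ', Det.seq hd hd', ?_, ?_⟩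
      · intro t' ht'
        rcases List.mem_cons.1 ht' with rfl | ht'
        · rw [hfr' _ fun t'' h'' => ⟨hβ.ne (by simpa using (hnot t'' h'').symm), hβ.ne (by simp),
              hβ.ne (by simp)⟩,
            hfr' _ fun t'' h'' => ⟨hβ.ne (by simp), hβ.ne (by simpa using (hnot t'' h'').symm),
              hβ.ne (by simp)⟩,
            hfr' _ fun t'' h'' => ⟨hβ.ne (by simp), hβ.ne (by simp),
              hβ.ne (by simpa using (hnot t'' h'').symm)⟩]
          exact he
        · exact he' t' ht'
      · intro i hi
        obtain ⟨h4, h5, h6⟩ := hi t (by simp)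
        rw [hfr' i fun t' ht' => hi t' (by simp [ht']), hfr i h4 h5 h6]
  obtain ⟨σ', hd3, he', hfr⟩ := hl (elems M.Tape) (nodup_elems _)
  refine ⟨σ', Det.seq hd1 (Det.seq hd2 hd3), ⟨?_, ?_, ?_, fun t => he' t (mem_elems t), hS⟩, ?_⟩
  · rw [hfr _ fun t _ => ⟨hβ.ne (by simp), hβ.ne (by simp), hβ.ne (by simp)⟩, hσ₂,
      upd_ne _ _ (hβ.ne (by simp)), hσ₁, upd_same]
    rfl
  · rw [hfr _ fun t _ => ⟨hβ.ne (by simp), hβ.ne (by simp), hβ.ne (by simp)⟩, hσ₂, upd_same, hhd]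
    rfl
  · exact min_le_right _ _
  · intro i hi
    have hi' : ∀ r, i ≠ β r := fun r h => hi ⟨r, h.symm⟩
    rw [hfr i fun t _ => ⟨hi' _, hi' _, hi' _⟩, h20 i (hi' _) (hi' _)]

/-! ### Case distinction on what a machine sees -/

/-- The state and the scanned symbols. -/
abbrev Machine.View (M : Machine A B₀) : Type := M.State × InputSym A × (M.Tape → M.Sym)

/-- What the machine sees in a configuration. -/
def Machine.view (M : Machine A B₀) (x : List A) (c : M.Cfg) : M.View :=
  (c.state, readInput x c.inputHead, fun t => c.work t (c.workHead t))

namespace Prog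

noncomputable def ifTapes (β : CReg M.Tape → ι) (s : M.Tape → M.Sym) (p q : Prog A B ι) :
    List M.Tape → Prog A B ι
  | [] => p
  | t :: l => ifeq (β (.cur t)) (num M.blank (s t)) (ifTapes β s p q l) q

noncomputable def ifView (β : CReg M.Tape → ι) (v : M.View) (p q : Prog A B ι) : Prog A B ι :=
  ifeq (β .st) (num M.start v.1) (ifsym (β .hd) v.2.1 (ifTapes β v.2.2 p q (elems M.Tape)) q) q

noncomputable def caseViews (β : CReg M.Tape → ι) (f : M.View → Prog A B ι) :
    List M.View → Prog A B ι
  | [] => fail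
  | v :: l => ifView β v (f v) (caseViews β f l)

/-- Case distinction on what the machine sees. -/
noncomputable def caseView [Finite A] (β : CReg M.Tape → ι) (f : M.View → Prog A B ι) :
    Prog A B ι := caseViews β f (elems M.View)

end Prog

variable {R : Type} [AddCommMonoid R] {em : B → R → R} {k : (ι → ℕ) → R} {β : CReg M.Tape → ι}
  {p q : Prog A B ι}

open Classical in
theorem wp_ifTapes (hK : Big M x S K) (hE : Enc M x S c fun r => σ (β r)) (s : M.Tape → M.Sym)
    (l : List M.Tape) : wp x K em (Prog.ifTapes β s p q l) k σ =
      if ∀ t ∈ l, c.work t (c.workHead t) = s t then wp x K em p k σ else wp x K em q k σ := by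
  induction l with
  | nil => simp [Prog.ifTapes]
  | cons t l ih =>
    have h1 : σ (β (.cur t)) = num M.blank (s t) ↔ c.work t (c.workHead t) = s t := by
      rw [(hE.tape t).cur]
      exact (num_injective _).eq_iff
    rw [Prog.ifTapes, wp_ifeq (hE.le hK _), ih]
    simp only [h1, List.mem_cons, forall_eq_or_imp]
    by_cases h2 : c.work t (c.workHead t) = s t <;> simp [h2]

open Classical in
theorem wp_ifView (hK : Big M x S K) (hE : Enc M x S c fun r => σ (β r)) (v : M.View) :
    wp x K em (Prog.ifView β v p q) k σ =
      if v = M.view x c then wp x K em p k σ else wp x K em q k σ := by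
  obtain ⟨s, i, w⟩ := v
  have h1 : σ (β .st) = num M.start s ↔ c.state = s := by
    rw [hE.st]
    exact (num_injective _).eq_iff
  have h2 : σ (β .hd) = c.inputHead := hE.hd
  rw [Prog.ifView, wp_ifeq (hE.le hK _), wp, wp_ifTapes hK hE]
  simp only [h1, h2, mem_elems, forall_const, Machine.view, Prod.mk.injEq, funext_iff]
  by_cases h3 : c.state = s
  · by_cases h4 : readInput x c.inputHead = i
    · simp [h3, h4, eq_comm]
    · simp [h3, h4, Ne.symm h4]
  · simp [h3, Ne.symm h3]

theorem wp_caseView [Finite A] (hK : Big M x S K) (hE : Enc M x S c fun r => σ (β r))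
    (f : M.View → Prog A B ι) :
    wp x K em (Prog.caseView β f) k σ = wp x K em (f (M.view x c)) k σ := by
  have : ∀ l : List M.View, M.view x c ∈ l →
      wp x K em (Prog.caseViews β f l) k σ = wp x K em (f (M.view x c)) k σ := by
    intro l hl
    induction l with
    | nil => simp at hl
    | cons v l ih =>
      rw [Prog.caseViews, wp_ifView hK hE]
      by_cases h : v = M.view x c
      · rw [if_pos h, h]
      · rw [if_neg h, ih]
        rcases List.mem_cons.1 hl with h' | h'
        · exact absurd h'.symm h
        · exact h'
  exact this _ (mem_elems _)

end Config

/-! ## Copying and clearing many registers -/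

section Banks

variable {A B ι κ : Type} [Finite κ] {x : List A} {K : ℕ} {σ : ι → ℕ}

namespace Prog

noncomputable def copyAll (f g : κ → ι) : Prog A B ι := each (fun r => copy (f r) (g r)) (elems κ)

noncomputable def clearAll (f : κ → ι) : Prog A B ι := each (fun r => clear (f r)) (elems κ)

end Prog

theorem det_copyAll {f g : κ → ι} (hg : Function.Injective g) (hfg : ∀ r s, f r ≠ g s)
    (h : ∀ r, σ (f r) ≤ K) : ∃ σ', Det (B := B) x K (Prog.copyAll f g) σ σ' ∧
      (∀ r, σ' (g r) = σ (f r)) ∧ ∀ i, i ∉ Set.range g → σ' i = σ i := by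
  have key : ∀ l : List κ, l.Nodup → ∀ ρ : ι → ℕ, (∀ r, ρ (f r) = σ (f r)) →
      ∃ σ', Det (B := B) x K (Prog.each (fun r => Prog.copy (f r) (g r)) l) ρ σ' ∧
        (∀ r ∈ l, σ' (g r) = σ (f r)) ∧ ∀ i, (∀ r ∈ l, i ≠ g r) → σ' i = ρ i := by
    intro l
    induction l with
    | nil => exact fun _ ρ _ => ⟨ρ, Det.skip, by simp, fun _ _ => rfl⟩
    | cons r l ih =>
      intro hl ρ hρ
      rw [List.nodup_cons] at hl
      obtain ⟨σ', hd, h1, h2⟩ := ih hl.2 (upd ρ (g r) (ρ (f r)))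
        fun s => by rw [upd_ne _ _ (hfg s r), hρ]
      refine ⟨σ', Det.seq (Det.copy (hfg r r) (hρ r ▸ h r)) hd, ?_, ?_⟩
      · intro s hs
        rcases List.mem_cons.1 hs with rfl | hs
        · rw [h2 _ fun s' hs' e => hl.1 (by rwa [hg e]), upd_same, hρ]
        · exact h1 s hs
      · intro i hi
        rw [h2 i fun s hs => hi s (by simp [hs]), upd_ne _ _ (hi r (by simp))]
  obtain ⟨σ', hd, h1, h2⟩ := key _ (nodup_elems κ) σ fun _ => rfl
  exact ⟨σ', hd, fun r => h1 r (mem_elems r), fun i hi => h2 i fun r _ e => hi ⟨r, e.symm⟩⟩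

theorem det_clearAll (f : κ → ι) : ∃ σ', Det (B := B) x K (Prog.clearAll f) σ σ' ∧
      (∀ r, σ' (f r) = 0) ∧ ∀ i, i ∉ Set.range f → σ' i = σ i := by
  have key : ∀ l : List κ, ∀ ρ : ι → ℕ,
      ∃ σ', Det (B := B) x K (Prog.each (fun r => Prog.clear (f r)) l) ρ σ' ∧
        (∀ r ∈ l, σ' (f r) = 0) ∧ (∀ i, ρ i = 0 → σ' i = 0) ∧
        ∀ i, (∀ r ∈ l, i ≠ f r) → σ' i = ρ i := by
    intro l
    induction l with
    | nil => exact fun ρ => ⟨ρ, Det.skip, by simp, fun _ h => h, fun _ _ => rfl⟩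
    | cons r l ih =>
      intro ρ
      obtain ⟨σ', hd, h1, h0, h2⟩ := ih (upd ρ (f r) 0)
      refine ⟨σ', Det.seq (Det.clear _) hd, ?_, ?_, ?_⟩
      · intro s hs
        rcases List.mem_cons.1 hs with rfl | hs
        · exact h0 _ (by simp)
        · exact h1 s hs
      · intro i hi
        refine h0 i ?_
        by_cases h : i = f r
        · subst h; simp
        · rwa [upd_ne _ _ h]
      · intro i hi
        rw [h2 i fun s hs => hi s (by simp [hs]), upd_ne _ _ (hi r (by simp))]
  obtain ⟨σ', hd, h1, -, h2⟩ := key (elems κ) σ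
  exact ⟨σ', hd, fun r => h1 r (mem_elems r), fun i hi => h2 i fun r _ e => hi ⟨r, e.symm⟩⟩

theorem wp_switch_none {α : Type} {R : Type} [AddCommMonoid R] {em : B → R → R}
    {k : (ι → ℕ) → R} {i : ι} {c : α → ℕ} (f : α → Prog A B ι) {l : List α}
    (hc : ∀ a ∈ l, σ i ≠ c a) (hK : σ i ≤ K) : wp x K em (Prog.switch i c f l) k σ = 0 := by
  induction l with
  | nil => rfl
  | cons a l ih =>
    rw [Prog.switch, wp_ifeq hK, if_neg (hc a (by simp)), ih fun a' h => hc a' (by simp [h])]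

end Banks

/-! ## The instructions for a view -/

section Acts

variable {A B₀ : Type} [Finite B₀] (M : Machine A B₀)

open Classical in
/-- The list of the instructions for a view. -/
noncomputable def Machine.acts (v : M.View) : List M.Act :=
  (elems M.Act).filter fun a => a ∈ M.instr v.1 v.2.1 v.2.2

variable {M} {x : List A} {c : M.Cfg}

theorem Machine.mem_acts {a : M.Act} : a ∈ M.acts (M.view x c) ↔ a ∈ M.enabled x c := by
  simp only [Machine.acts, List.mem_filter, mem_elems, Machine.view, Machine.enabled, true_and]
  exact @decide_eq_true_iff _ (Classical.dec _)

theorem Machine.nodup_acts (v : M.View) : (M.acts v).Nodup := (nodup_elems _).filter _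

theorem Machine.length_acts_le (v : M.View) : (M.acts v).length ≤ (elems M.Act).length :=
  List.length_filter_le _ _

/-- `Rest ok t c i N`: if the first `i` instructions are not used in the first step, there are
`N` accepting branches from `c`; here `t` bounds their length and all configurations
satisfy `ok`. -/
inductive Rest (x : List A) (ok : M.Cfg → Prop) : ℕ → M.Cfg → ℕ → ℕ → Prop
  | accept {t c} : M.acts (M.view x c) = [] → c.state ∈ M.accept → Rest x ok t c 0 1
  | reject {t c} : M.acts (M.view x c) = [] → c.state ∉ M.accept → Rest x ok t c 0 0
  | move {t c i} (ν : M.Act → ℕ) : M.acts (M.view x c) ≠ [] → i ≤ (M.acts (M.view x c)).length →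
      (∀ a ∈ M.acts (M.view x c),
        Run (M.Step x) ok (fun c => c.state ∈ M.accept) t (M.apply x c a) (ν a)) →
      Rest x ok (t + 1) c i (((M.acts (M.view x c)).drop i).map ν).sum

/-- The sum over an unordered set of moves becomes a sum over the list of instructions; its order
allows branches to be sorted by first instruction, one instruction at a time. -/
theorem Run.rest {ok : M.Cfg → Prop} {t N : ℕ}
    (h : Run (M.Step x) ok (fun c => c.state ∈ M.accept) t c N) : Rest x ok t c 0 N := by
  have hnil : (∀ m c', ¬ M.Step x c m c') → M.acts (M.view x c) = [] := by
    intro hno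
    rw [List.eq_nil_iff_forall_not_mem]
    intro a ha
    exact hno a _ ⟨Machine.mem_acts.1 ha, rfl⟩
  cases h with
  | accept _ hno ha => exact .accept (hnil hno) ha
  | reject _ hno ha => exact .reject (hnil hno) ha
  | move s f n _ hs hne hr =>
    have h1 : ∀ a, a ∈ M.acts (M.view x c) ↔ a ∈ s := by
      intro a
      rw [Machine.mem_acts]
      constructor
      · intro ha
        exact ((hs a _).1 ⟨ha, rfl⟩).1
      · intro ha
        exact ((hs a _).2 ⟨ha, rfl⟩).1
    have h2 : ∀ a ∈ s, f a = M.apply x c a := fun a ha => ((hs a _).2 ⟨ha, rfl⟩).2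
    classical
    have h3 : s = (M.acts (M.view x c)).toFinset := by
      ext a; rw [List.mem_toFinset, h1]
    have := Rest.move (t := _) (i := 0) (x := x) (ok := ok) n
      (by obtain ⟨a, ha⟩ := hne; exact List.ne_nil_of_mem ((h1 a).2 ha)) (Nat.zero_le _)
      (fun a ha => by rw [← h2 a ((h1 a).1 ha)]; exact hr a ((h1 a).1 ha))
    rw [List.drop_zero] at this
    rwa [h3, List.sum_toFinset _ (Machine.nodup_acts _)]

end Acts

/-! ## Counting sets of accepting branches -/

/-- The registers for counting sets of at most `k` branches. -/
inductive TReg (k : ℕ) (T : Type)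
  | scratch
  | clock
  | idx (j : Fin (k + 1))
  | fin (j : Fin (k + 1))
  | conf (j : Fin (k + 1)) (r : CReg T)

instance {k : ℕ} {T : Type} [Finite T] : Finite (TReg k T) := by
  refine Finite.of_surjective (fun i : Bool ⊕ (Fin (k + 1) × Option (Option (CReg T))) => match i with
    | .inl true => TReg.scratch
    | .inl false => TReg.clock
    | .inr (j, none) => TReg.idx j
    | .inr (j, some none) => TReg.fin j
    | .inr (j, some (some r)) => TReg.conf j r) ?_
  rintro (_ | _ | j | j | ⟨j, r⟩)
  exacts [⟨.inl true, rfl⟩, ⟨.inl false, rfl⟩, ⟨.inr (j, none), rfl⟩, ⟨.inr (j, some none), rfl⟩,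
    ⟨.inr (j, some (some r)), rfl⟩]

namespace TReg

variable {k : ℕ} {T : Type}

/-- The level `m`, for `m ≤ k`. -/
def lvl (m : ℕ) : Fin (k + 1) := ⟨min m k, by omega⟩

theorem lvl_val {m : ℕ} (h : m ≤ k) : (lvl (k := k) m).val = m := min_eq_left h

abbrev idxAt (m : ℕ) : TReg k T := idx (lvl m)
abbrev finAt (m : ℕ) : TReg k T := fin (lvl m)
abbrev confAt (m : ℕ) (r : CReg T) : TReg k T := conf (lvl m) r

/-- `scratch` lies above all levels and so counts as preserved. `clock` lies at the bottom, and
every subprogram may overwrite it, since a loop reads its length only on entry. -/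
def level : TReg k T → ℕ
  | scratch => k + 1
  | clock => 0
  | idx j => j
  | fin j => j
  | conf j _ => j

theorem confAt_injective (m : ℕ) : Function.Injective (confAt (k := k) (T := T) m) := by
  intro r s h
  injection h

/-- The stores agree above level `m`. -/
def Above (m : ℕ) (σ σ' : TReg k T → ℕ) : Prop := ∀ r : TReg k T, m < r.level → σ' r = σ r

theorem Above.refl (m : ℕ) (σ : TReg k T → ℕ) : Above m σ σ := fun _ _ => rfl

theorem Above.trans {m m' : ℕ} {σ σ' σ'' : TReg k T → ℕ} (h : Above m σ σ') (h' : Above m' σ' σ'')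
    (hm : m' ≤ m) : Above m σ σ'' := fun r hr => (h' r (by omega)).trans (h r hr)

theorem Above.mono {m m' : ℕ} {σ σ' : TReg k T → ℕ} (h : Above m σ σ') (hm : m ≤ m') :
    Above m' σ σ' := fun r hr => h r (by omega)

theorem Above.upd {m : ℕ} (σ : TReg k T → ℕ) {i : TReg k T} (hi : i.level ≤ m) (v : ℕ) :
    Above m σ (upd σ i v) := fun r hr => upd_ne _ _ fun e => by subst e; omega

theorem Above.of_range {κ : Type} {m : ℕ} {σ σ' : TReg k T → ℕ} {g : κ → TReg k T}
    (h : ∀ i, i ∉ Set.range g → σ' i = σ i) (hg : ∀ r, (g r).level ≤ m) : Above m σ σ' :=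
  fun r hr => h r fun ⟨s, e⟩ => by
    have := hg s
    rw [e] at this
    omega

end TReg

open TReg

section Tokens

variable {A B B₀ : Type} [Finite A] [Finite B₀] {M : Machine A B₀} {k : ℕ}

namespace Prog

/-- `t` of the `m` branches begin with the instruction `a`. -/
noncomputable def splitOff (sub : ℕ → Prog A B (TReg k M.Tape)) (m : ℕ) (a : M.Act) (t : ℕ) :
    Prog A B (TReg k M.Tape) :=
  if t = 0 then inc (idxAt m) else
  if t = m then seq (act (confAt m) scratch a) (clear (idxAt m)) else
  seq (copyAll (confAt m) (confAt t)) (seq (act (confAt t) scratch a) (seq (clear (idxAt t))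
    (seq (sub t) (seq (inc (idxAt m)) (seq (copyAll (confAt m) (confAt (m - t)))
      (seq (copy (idxAt m) (idxAt (m - t))) (seq (sub (m - t)) (inc (finAt m)))))))))

-- From a halted configuration there is only the empty branch, so a nonempty set of accepting
-- branches exists only for `m = 1` and an accepting state. Otherwise the number of chosen branches
-- that begin with the instruction numbered by `idx` is guessed.
open Classical in
noncomputable def tokenCase (sub : ℕ → Prog A B (TReg k M.Tape)) (m : ℕ) (v : M.View) :
    Prog A B (TReg k M.Tape) :=
  if M.acts v = [] then (if v.1 ∈ M.accept ∧ m = 1 then inc (finAt m) else fail) else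
  switch (idxAt m) (fun i => i.val)
    (fun i => anyOf (splitOff sub m ((M.acts v).get i)) (List.range (m + 1)))
    (List.finRange (M.acts v).length)

/-- The register maximum serves as time bound, and the flag `fin` makes the remaining passes idle
once the set is complete. -/
noncomputable def tokens (sub : ℕ → Prog A B (TReg k M.Tape)) (m : ℕ) :
    Prog A B (TReg k M.Tape) :=
  seq (clear (finAt m)) (seq (setmax clock)
    (loop clock (ifz (finAt m) (caseView (confAt m) (tokenCase sub m)) skip)))

end Prog

/-- The program `p` counts the sets of `m` accepting branches from the configuration represented on
level `m`. -/
def CountsSets (M : Machine A B₀) (k : ℕ) (x : List A) (S K m : ℕ) (p : Prog A B (TReg k M.Tape)) :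
    Prop :=
  ∀ {R : Type} [AddCommMonoid R] (em : B → R → R) (f : (TReg k M.Tape → ℕ) → R) (r : R)
    (σ : TReg k M.Tape → ℕ) (c : M.Cfg) (t i N : ℕ), Rest x (fun c => ∀ t, c.workHead t ≤ S) t c i N →
    σ scratch = 0 → Enc M x S c (fun q => σ (confAt m q)) → σ (idxAt m) = i →
    t * ((elems M.Act).length + 2) + ((elems M.Act).length + 1 - i) ≤ K →
    (∀ σ', Above m σ σ' → f σ' = r) → wp x K em p f σ = N.choose m • r

variable {x : List A} {S K : ℕ}

/-- Vandermonde's identity: `m` branches that begin with the `i`-th or a later instruction are `j`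
branches beginning with the `i`-th and `m - j` beginning with a later one. For `j = 0` and `j = m`
the set stays together and the loop goes on with the next instruction or with the successor.
Otherwise both parts are strictly smaller and are left to subprograms on lower levels, so one stored
configuration per level suffices. Each pass that keeps the set together decreases `t * (s + 2) + (s
+ 1 - i)`: either `i` grows, or `t` drops and `i` returns to `0`. -/
theorem countsSets_tokens (hK : Big M x S K) {m : ℕ} (hm : 1 ≤ m) (hmk : m ≤ k)
    {sub : ℕ → Prog A B (TReg k M.Tape)}
    (hsub : ∀ t, 1 ≤ t → t < m → CountsSets M k x S K t (sub t)) :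
    CountsSets M k x S K m (Prog.tokens sub m) := by
  intro R _ em f r σ₀ c₀ t₀ i₀ N₀ hR₀ hs₀ hE₀ hi₀ hK₀ hf₀
  set s := (elems M.Act).length with hs
  have lev : ∀ t ≤ k, (lvl (k := k) t).val = t := fun t ht => lvl_val ht
  have lne : ∀ t ≤ k, ∀ t' ≤ k, t ≠ t' → lvl (k := k) t ≠ lvl (k := k) t' :=
    fun t ht t' ht' h e => h (by rw [← lev t ht, ← lev t' ht', e])
  set body : Prog A B (TReg k M.Tape) :=
    .ifz (finAt m) (Prog.caseView (confAt m) (Prog.tokenCase sub m)) .skip with hbody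
  -- Once the flag is set, the remaining passes change nothing.
  have hdone : ∀ n (σ : TReg k M.Tape → ℕ), σ (finAt m) ≠ 0 → (∀ σ', Above m σ σ' → f σ' = r) →
      (wp x K em body)^[n] f σ = r := by
    intro n σ h0 hf
    induction n with
    | zero => exact hf σ (.refl _ _)
    | succ n ih => rw [Function.iterate_succ_apply', hbody, wp, if_neg h0, wp]; exact ih
  have hfr : ∀ {t : ℕ} {σ σ' : TReg k M.Tape → ℕ}, Above t σ σ' → t < m →
      (∀ q, σ' (confAt m q) = σ (confAt m q)) ∧ σ' (idxAt m) = σ (idxAt m) ∧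
      σ' (finAt m) = σ (finAt m) ∧ σ' scratch = σ scratch := by
    intro t σ σ' h ht
    refine ⟨fun q => h _ ?_, h _ ?_, h _ ?_, h _ ?_⟩ <;> simp only [level, lev m hmk] <;> omega
  have main : ∀ n (σ : TReg k M.Tape → ℕ) c t i N,
      Rest x (fun c => ∀ t, c.workHead t ≤ S) t c i N →
      σ (finAt m) = 0 → σ scratch = 0 → Enc M x S c (fun q => σ (confAt m q)) → σ (idxAt m) = i →
      t * (s + 2) + (s + 1 - i) ≤ n → n ≤ K →
      (∀ σ', Above m σ σ' → f σ' = r) → (wp x K em body)^[n] f σ = N.choose m • r := by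
    intro n
    induction n with
    | zero =>
      intro σ c t i N hR h0 hs0 hE hi hn hnK hf
      -- As `i ≤ s`, the measure is positive: the clock cannot run out before the set is complete.
      have hi' : i ≤ s := by
        cases hR with
        | accept => omega
        | reject => omega
        | move _ _ h => exact h.trans (M.length_acts_le _)
      omega
    | succ n ih =>
      intro σ c t i N hR h0 hs0 hE hi hn hnK hf
      rw [Function.iterate_succ_apply', hbody, wp, if_pos h0, wp_caseView hK hE]
      have hK1 : 1 ≤ K := le_trans (by omega) hK.input
      cases hR with
      | accept h1 h2 =>
        rw [Prog.tokenCase, if_pos h1]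
        by_cases hm1 : m = 1
        · rw [if_pos ⟨h2, hm1⟩, wp, if_pos (by omega), hdone n _ (by simp)]
          · simp [hm1]
          · exact fun σ' h => hf σ' ((Above.upd σ (by simp [level, lev m hmk]) _).trans h le_rfl)
        · rw [if_neg (by tauto), wp, Nat.choose_eq_zero_of_lt (by omega), zero_smul]
      | reject h1 h2 =>
        rw [Prog.tokenCase, if_pos h1, if_neg (fun h => h2 h.1), wp,
          Nat.choose_eq_zero_of_lt (by omega), zero_smul]
      | @move t _ i ν h1 h2 h3 =>
        rw [Prog.tokenCase, if_neg h1]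
        have hlen := M.length_acts_le (M.view x c)
        set l := M.acts (M.view x c) with hl
        have hiK : i + 1 ≤ K := by
          have : i ≤ s := h2.trans hlen
          have : i + 1 ≤ s + 2 := by omega
          have h5 : s + 2 ≤ (t + 1) * (s + 2) := Nat.le_mul_of_pos_left _ (by omega)
          omega
        rcases h2.lt_or_eq with h4 | h4
        swap
        -- All instructions have been passed over, so there is nothing left to choose `m ≥ 1`
        -- branches from.
        · rw [wp_switch_none, h4, List.drop_length, List.map_nil, List.sum_nil,
            Nat.choose_eq_zero_of_lt (by omega), zero_smul]
          · intro j _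
            rw [hi, h4]
            exact j.isLt.ne'
          · rw [hi]; omega
        rw [wp_switch (a := ⟨i, h4⟩) _ (List.mem_finRange _) (fun j _ h => Fin.ext h) hi
          (show i ≤ K by omega), wp_anyOf, List.drop_eq_getElem_cons h4, List.map_cons, List.sum_cons,
          Nat.add_choose_eq, Finset.Nat.sum_antidiagonal_eq_sum_range_succ_mk, Finset.sum_smul,
          ← List.sum_toFinset _ (List.nodup_range), List.toFinset_range]
        refine Finset.sum_congr rfl fun j hj => ?_
        rw [Finset.mem_range] at hj
        simp only [List.get_eq_getElem]
        have ha : l[i] ∈ l := List.getElem_mem h4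
        have hrun := h3 _ ha
        set a := l[i] with ha'
        have hok := hrun.ok_start
        set N' := ((l.drop (i + 1)).map ν).sum with hN'
        have hrest : Rest x (fun c => ∀ t, c.workHead t ≤ S) (t + 1) c (i + 1) N' :=
          Rest.move ν h1 h4 h3
        have hconf : ∀ t ≤ k, ∀ i : TReg k M.Tape, (∀ q, i ≠ confAt t q) → i ∉ Set.range
          (confAt (k := k) (T := M.Tape) t) := fun t _ i h ⟨q, e⟩ => h q e.symm
        rw [Prog.splitOff]
        by_cases hj0 : j = 0
        · subst hj0
          rw [if_pos rfl, wp, if_pos (by omega), ih _ c (t + 1) (i + 1) N' hrest (by simpa using h0)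
            (by simpa using hs0) (by simpa using hE) (by simp [hi]) (by omega) (by omega)
            (fun σ' h => hf σ' ((Above.upd σ (by simp [level, lev m hmk]) _).trans h le_rfl))]
          simp
        rw [if_neg hj0]
        by_cases hjm : j = m
        · subst hjm
          rw [if_pos rfl]
          obtain ⟨σ', hd, hE', hfr'⟩ := det_act (B := B) (confAt_injective j)
            (hconf j hmk scratch (by simp)) hs0 hK a hE hok
          rw [(hd.seq (Det.clear _)).wp_eq, ih _ (M.apply x c a) t 0 _ hrun.rest]
          · simp
          · simp [hfr' _ (hconf j hmk (finAt j) (by simp)), h0]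
          · simp [hfr' _ (hconf j hmk scratch (by simp)), hs0]
          · simpa using hE'
          · simp
          · rw [add_mul] at hn
            omega
          · omega
          · refine fun σ'' h => hf σ'' (Above.trans (Above.of_range hfr' ?_)
              ((Above.upd σ' ?_ _).trans h le_rfl) le_rfl) <;> simp [level, lev j hmk]
        rw [if_neg hjm]
        have hjm' : j < m := by omega
        have hjk : j ≤ k := by omega
        have hne : lvl (k := k) m ≠ lvl (k := k) j := lne _ hmk _ hjk (by omega)
        have hne' : lvl (k := k) m ≠ lvl (k := k) (m - j) :=
          lne _ hmk _ (by omega) (by omega)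
        obtain ⟨σ₁, hd₁, hc₁, hf₁⟩ := det_copyAll (B := B) (x := x) (K := K) (σ := σ)
          (f := confAt (k := k) (T := M.Tape) m) (confAt_injective j)
          (fun q q' => by simp [hne]) (fun q => hE.le hK q)
        have ha₁ : Above j σ σ₁ := Above.of_range hf₁ (fun q => by simp [level, lev j hjk])
        obtain ⟨σ₂, hd₂, hE₂, hf₂⟩ := det_act (B := B) (c := c) (confAt_injective j)
            (hconf j hjk scratch (by simp)) (σ := σ₁) (by rw [(hfr ha₁ hjm').2.2.2, hs0]) hK a
            (by simpa only [hc₁] using hE) hok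
        have ha₂ : Above j σ σ₂ := ha₁.trans (Above.of_range hf₂
          (fun q => by simp [level, lev j hjk])) le_rfl
        have ha₃ : Above j σ (upd σ₂ (idxAt j) 0) :=
          ha₂.trans (Above.upd σ₂ (by simp [level, lev j hjk]) _) le_rfl
        -- Whatever store the first subprogram leaves, the rest contributes `N'.choose (m - j) • r`.
        -- With this constant as the value of its continuation, the two counts multiply.
        rw [hd₁.wp_seq, hd₂.wp_seq, (Det.clear _).wp_seq, wp, hsub j (by omega) hjm' em _
          (N'.choose (m - j) • r) (upd σ₂ (idxAt j) 0) _ t 0 _ hrun.rest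
          (by rw [(hfr ha₃ hjm').2.2.2, hs0]) (by simpa using hE₂) (by simp)
          (show t * (s + 2) + (s + 1 - 0) ≤ K by
            rw [add_mul] at hn
            omega), mul_smul]
        intro σ₄ h₄
        have ha₄ : Above j σ σ₄ := ha₃.trans h₄ le_rfl
        obtain ⟨hc₄, hi₄, hfin₄, hs₄⟩ := hfr ha₄ hjm'
        set σ₅ := upd σ₄ (idxAt m) (i + 1) with hσ₅
        obtain ⟨σ₆, hd₆, hc₆, hf₆⟩ := det_copyAll (B := B) (x := x) (K := K) (σ := σ₅)
          (f := confAt (k := k) (T := M.Tape) m) (confAt_injective (m - j))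
          (fun q q' => by simp [hne']) (fun q => by
            rw [hσ₅, upd_ne _ _ (by simp), hc₄]; exact hE.le hK q)
        have hi₆ : σ₆ (idxAt m) = i + 1 := by
          rw [hf₆ _ (hconf _ (by omega) _ (by simp)), hσ₅, upd_same]
        have hfin₆ : σ₆ (finAt m) = 0 := by
          rw [hf₆ _ (hconf _ (by omega) _ (by simp)), hσ₅, upd_ne _ _ (by simp), hfin₄, h0]
        have ha₅ : Above m σ σ₅ :=
          (ha₄.mono hjm'.le).trans (Above.upd σ₄ (by simp [level, lev m hmk]) _) le_rfl
        have ha₆ : Above m σ σ₆ := ha₅.trans (Above.of_range hf₆ (m := m - j)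
            (fun q => by simp [level, lev (m - j) (by omega)])) (by omega)
        have hs₆ : σ₆ scratch = 0 := by rw [ha₆ _ (by simp [level]; omega), hs0]
        rw [wp, wp, if_pos (by omega), hi₄, hi, hd₆.wp_seq,
          (Det.copy (by simp [hne']) (by omega)).wp_seq, hi₆, wp,
          hsub (m - j) (by omega) (by omega) em _ r _ c (t + 1) (i + 1) N' hrest]
        · simpa using hs₆
        · simpa [hc₆, hσ₅, hc₄] using hE
        · simp
        · show (t + 1) * (s + 2) + (s + 1 - (i + 1)) ≤ K
          omega
        · intro σ₇ h₇
          obtain ⟨-, -, hfin₇, -⟩ := hfr h₇ (by omega)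
          have ha₇ : Above m σ σ₇ := (ha₆.trans (Above.upd σ₆
            (by simp [level, lev (m - j) (by omega)]) _) le_rfl).trans h₇ (by omega)
          rw [wp, if_pos (by rw [hfin₇]; simp [hfin₆]; omega)]
          refine hdone n _ (by simp) fun σ' h' => hf σ' ?_
          exact (ha₇.trans (Above.upd σ₇ (by simp [level, lev m hmk]) _) le_rfl).trans h' le_rfl
  rw [Prog.tokens, (Det.clear _).wp_seq, (Det.setmax _).wp_seq, wp, upd_same]
  refine main K _ c₀ t₀ i₀ N₀ hR₀ (by simp) (by simpa using hs₀) (by simpa using hE₀)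
    (by simpa using hi₀) (by omega) le_rfl fun σ' h => hf₀ σ' ?_
  exact ((Above.upd σ₀ (by simp [level, lev m hmk]) _).trans
    (Above.upd _ (by simp [level]) _) le_rfl).trans h le_rfl

theorem exists_countsSets (M : Machine A B₀) (B : Type) (k m : ℕ) (hm : 1 ≤ m) (hmk : m ≤ k) :
    ∃ p : Prog A B (TReg k M.Tape), ∀ x S K, Big M x S K → CountsSets M k x S K m p := by
  induction m using Nat.strong_induction_on with
  | _ m ih =>
    have : ∀ t, ∃ p : Prog A B (TReg k M.Tape), 1 ≤ t → t < m → ∀ x S K, Big M x S K →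
        CountsSets M k x S K t p := by
      intro t
      by_cases h : 1 ≤ t ∧ t < m
      · obtain ⟨p, hp⟩ := ih t h.2 h.1 (by omega)
        exact ⟨p, fun _ _ => hp⟩
      · exact ⟨.fail, fun h1 h2 => absurd ⟨h1, h2⟩ h⟩
    choose sub hsub using this
    exact ⟨_, fun x S K hK => countsSets_tokens hK hm hmk fun t h1 h2 => hsub t h1 h2 x S K hK⟩

end Tokens

/-- For a large enough polynomial bound on the registers, configurations fit and there is time for
all branches. -/
theorem exists_big {B₀ : Type} (M : Machine A B₀) (C s : ℕ) : ∃ D, ∀ (x : List A) K,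
    (x.length + 2) ^ D ≤ K → Big M x (C * (Nat.log 2 x.length + 1)) K ∧
      C * (x.length + 1) ^ C * (s + 2) + (s + 1) ≤ K := by
  set g := M.radix
  set E := C * (s + 2) + (s + 1)
  -- The exponent adds up those needed for the tape contents, for the states and the input
  -- positions, and for the time.
  refine ⟨(2 * g * C + 2 * g) + (Nat.card M.State + 1 + (E + C)), fun x K hK => ?_⟩
  set n := x.length
  have hpow : ∀ m ≤ (2 * g * C + 2 * g) + (Nat.card M.State + 1 + (E + C)), (n + 2) ^ m ≤ K :=
    fun m hm => (Nat.pow_le_pow_right (by omega) hm).trans hK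
  have htwo : ∀ m, m ≤ (n + 2) ^ m := fun m =>
    Nat.lt_two_pow_self.le.trans (Nat.pow_le_pow_left (by omega) m)
  refine ⟨⟨(htwo _).trans (hpow _ (by omega)), ?_, ?_⟩, ?_⟩
  · have := hpow 1 (by omega)
    rw [pow_one] at this
    omega
  · have h1 : 2 ^ (Nat.log 2 n + 1) ≤ (n + 2) ^ 2 := by
      rcases Nat.eq_zero_or_pos n with h | h
      · simp [h]
      · have := Nat.pow_log_le_self 2 h.ne'
        rw [pow_succ]
        nlinarith
    -- A constant to a logarithmic power is polynomial: `g ≤ 2 ^ g`, and `2 ^ (Nat.log 2 n + 1)` is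
    -- at most `(n + 2) ^ 2`.
    calc g ^ (C * (Nat.log 2 n + 1) + 2) ≤ (2 ^ g) ^ (C * (Nat.log 2 n + 1) + 2) :=
          Nat.pow_le_pow_left Nat.lt_two_pow_self.le _
      _ = (2 ^ (Nat.log 2 n + 1)) ^ (g * C) * 2 ^ (2 * g) := by
          rw [← pow_mul, ← pow_mul, ← pow_add]
          congr 1
          ring
      _ ≤ ((n + 2) ^ 2) ^ (g * C) * (n + 2) ^ (2 * g) :=
          Nat.mul_le_mul (Nat.pow_le_pow_left h1 _) (Nat.pow_le_pow_left (by omega) _)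
      _ = (n + 2) ^ (2 * g * C + 2 * g) := by
          rw [← pow_mul, ← pow_add]
          congr 1
          ring
      _ ≤ K := hpow _ (by omega)
  · have h1 : 1 ≤ (n + 1) ^ C := Nat.one_le_pow _ _ (by omega)
    calc C * (n + 1) ^ C * (s + 2) + (s + 1) ≤ E * (n + 1) ^ C := by
          simp only [E]
          nlinarith
      _ ≤ (n + 2) ^ E * (n + 2) ^ C := Nat.mul_le_mul (htwo E) (Nat.pow_le_pow_left (by omega) _)
      _ = (n + 2) ^ (E + C) := (pow_add _ _ _).symm
      _ ≤ K := hpow _ (by omega)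

/-- A single exponent `D` serves all `m ≤ k`, and `K` may be any larger number. So the programs can
later run under a cap that belongs to an input other than their own. -/
theorem exists_choose_prog [Finite A] (V : Machine A Empty) (hV : V.IsLogspace) (B : Type) (k : ℕ) :
    ∃ (ι : Type) (_ : Finite ι) (q : ℕ → Prog A B ι) (D : ℕ), ∀ m ≤ k, ∀ x K,
      (x.length + 2) ^ D ≤ K → ∀ {R : Type} [AddCommMonoid R] (em : B → R → R) (r : R),
        wp x K em (q m) (fun _ => r) (fun _ => 0) = (V.numAcc x).choose m • r := by
  obtain ⟨C, hC⟩ := hV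
  obtain ⟨D, hD⟩ := exists_big V C (elems V.Act).length
  have : ∀ m, ∃ p : Prog A B (TReg k V.Tape), m ≤ k → ∀ x K,
      (x.length + 2) ^ D ≤ K → ∀ {R : Type} [AddCommMonoid R] (em : B → R → R) (r : R),
        wp x K em p (fun _ => r) (fun _ => 0) = (V.numAcc x).choose m • r := by
    intro m
    rcases Nat.eq_zero_or_pos m with rfl | hm
    -- There is exactly one empty set of branches, hence one branch that does nothing.
    · exact ⟨.skip, fun _ x K _ R _ em r => by simp [wp]⟩
    by_cases hmk : m ≤ k
    · obtain ⟨p, hp⟩ := exists_countsSets V B k m hm hmk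
      refine ⟨p, fun _ x K hK R _ em r => ?_⟩
      obtain ⟨hB, hT⟩ := hD x K hK
      obtain ⟨N, hN⟩ := exists_run (step := V.Step x) (acc := fun c => c.state ∈ V.accept)
        (ok := fun c => ∀ t, c.workHead t ≤ C * (Nat.log 2 x.length + 1))
        (fun c => (V.enabled x c).toFinite.toFinset) (fun c a => V.apply x c a)
        (fun c m c' => by simp [Machine.Step]) (C * (x.length + 1) ^ C) V.init (hC x)
      rw [Machine.numAcc, hN.numBranches_eq]
      exact hp x _ K hB em _ r _ V.init _ 0 N hN.rest rfl (Enc.init V x _) rfl hT fun _ _ => rfl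
    · exact ⟨.fail, fun h => absurd h hmk⟩
  choose q hq using this
  exact ⟨_, inferInstance, q, D, hq⟩

/-! ## Residues modulo prime powers from binomial coefficients modulo the prime -/

section Binomial

/-- Newton interpolation: `n.choose q` vanishes for `n < q` and equals `1` at `n = q`, so the
coefficient of index `q` corrects the value at `q` without disturbing earlier ones. -/
theorem exists_binomial_expansion {R : Type} [CommRing R] (f : ℕ → R) (q : ℕ) :
    ∃ c : ℕ → R, ∀ n < q, ∑ i ∈ Finset.range q, c i * (n.choose i : R) = f n := by
  induction q with
  | zero => exact ⟨0, by simp⟩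
  | succ q ih =>
    obtain ⟨c, hc⟩ := ih
    refine ⟨Function.update c q (f q - ∑ i ∈ Finset.range q, c i * (q.choose i : R)), fun n hn => ?_⟩
    have h : ∀ n : ℕ, ∑ i ∈ Finset.range q, Function.update c q
        (f q - ∑ i ∈ Finset.range q, c i * (q.choose i : R)) i * (n.choose i : R) =
        ∑ i ∈ Finset.range q, c i * (n.choose i : R) := fun n =>
      Finset.sum_congr rfl fun i hi => by
        rw [Function.update_of_ne (Finset.mem_range.1 hi).ne]
    rw [Finset.sum_range_succ, h, Function.update_self]
    rcases (Nat.lt_succ_iff.1 hn).lt_or_eq with h' | rfl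
    · rw [hc n h', Nat.choose_eq_zero_of_lt h', Nat.cast_zero, mul_zero, add_zero]
    · rw [Nat.choose_self, Nat.cast_one, mul_one]
      ring

/-- In Vandermonde's sum only the term `j = 0` survives, because `p` divides `(p ^ e).choose j` for
`0 < j < p ^ e`. -/
theorem choose_prime_pow_add {p e i : ℕ} (hp : p.Prime) (hi : i < p ^ e) (m : ℕ) :
    ((p ^ e + m).choose i : ZMod p) = (m.choose i : ZMod p) := by
  rw [Nat.add_choose_eq, Finset.Nat.sum_antidiagonal_eq_sum_range_succ_mk, Nat.cast_sum,
    Finset.sum_eq_single 0]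
  · simp
  · intro j hj h0
    rw [Finset.mem_range] at hj
    have := hp.dvd_choose_pow h0 (show j ≠ p ^ e by omega)
    rw [Nat.cast_mul, (ZMod.natCast_eq_zero_iff _ _).2 this, zero_mul]
  · simp

theorem choose_mod_prime_pow {p e i : ℕ} (hp : p.Prime) (hi : i < p ^ e) (n : ℕ) :
    ((n % p ^ e).choose i : ZMod p) = (n.choose i : ZMod p) := by
  have key : ∀ a b : ℕ, ((p ^ e * a + b).choose i : ZMod p) = (b.choose i : ZMod p) := by
    intro a b
    induction a with
    | zero => simp
    | succ a ih => rw [Nat.mul_succ, add_comm _ (p ^ e), add_assoc, choose_prime_pow_add hp hi, ih]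
  conv_rhs => rw [← Nat.div_add_mod n (p ^ e)]
  rw [key]

end Binomial

/-! ## Programs for residues -/

/-- The indicator of a residue is a combination of binomial coefficients modulo `p`, and both sums
and coefficients are realised by nondeterministic choice. The resulting number of branches `w r x`
is not itself `0` or `1`, but it is so modulo `p`. -/
theorem exists_residue_prog {p e : ℕ} (hp : p.Prime) {A : Type} [Finite A]
    {f : List A → ZMod (p ^ e)} (hf : f ∈ SharpModL (p ^ e) A) (B : Type) :
    ∃ (ι : Type) (_ : Finite ι) (q : ZMod (p ^ e) → Prog A B ι) (D : ℕ)
      (w : ZMod (p ^ e) → List A → ℕ), (∀ x, (w (f x) x : ZMod p) = 1) ∧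
      (∀ r x, f x ≠ r → (w r x : ZMod p) = 0) ∧
      ∀ r x K, (x.length + 2) ^ D ≤ K → ∀ {R : Type} [AddCommMonoid R] (em : B → R → R) (ρ : R),
        wp x K em (q r) (fun _ => ρ) (fun _ => 0) = w r x • ρ := by
  obtain ⟨φ, ⟨V, hV, hφ⟩, hf⟩ := hf
  obtain ⟨ι, hι, q, D, hq⟩ := exists_choose_prog V hV B (p ^ e)
  have : NeZero (p ^ e) := ⟨(Nat.pow_pos hp.pos).ne'⟩
  have : NeZero p := ⟨hp.ne_zero⟩
  choose c hc using fun r : ZMod (p ^ e) =>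
    exists_binomial_expansion (fun n => if (n : ZMod (p ^ e)) = r then (1 : ZMod p) else 0) (p ^ e)
  have hw : ∀ r x, ((∑ i ∈ Finset.range (p ^ e), (c r i).val * (φ x).choose i : ℕ) : ZMod p) =
      if f x = r then 1 else 0 := by
    intro r x
    -- The expansion is valid only below `p ^ e`; it is used at the remainder, which changes neither
    -- the residue nor the binomial coefficients modulo `p`.
    have := hc r (φ x % p ^ e) (Nat.mod_lt _ (NeZero.pos _))
    rw [ZMod.natCast_mod, ← hf] at this
    rw [← this, Nat.cast_sum]
    refine Finset.sum_congr rfl fun i hi => ?_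
    rw [choose_mod_prime_pow hp (Finset.mem_range.1 hi), Nat.cast_mul, ZMod.natCast_val,
      ZMod.cast_id', id]
  -- The outer choice selects the term; the inner one, among `(c r i).val` identical alternatives,
  -- supplies its coefficient.
  refine ⟨ι, hι, fun r => .anyOf (fun i => .anyOf (fun _ => q i) (List.range (c r i).val))
    (List.range (p ^ e)), D, fun r x => ∑ i ∈ Finset.range (p ^ e), (c r i).val * (φ x).choose i,
    fun x => by rw [hw, if_pos rfl], fun r x h => by rw [hw, if_neg h], ?_⟩
  intro r x K hK R _ em ρ
  rw [wp_anyOf, ← List.sum_toFinset _ List.nodup_range, List.toFinset_range, Finset.sum_smul]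
  refine Finset.sum_congr rfl fun i hi => ?_
  rw [wp_anyOf, hq i (Finset.mem_range.1 hi).le x K hK em ρ, List.map_const', List.length_range,
    List.sum_replicate, ← hφ, mul_smul]

theorem wp_each_emit {A B ι : Type} {x : List A} {K : ℕ} (l : List B) (ρ : List B → ℕ)
    (σ : ι → ℕ) : wp x K emitOut (Prog.each Prog.emit l) (fun _ => ρ) σ = fun o => ρ (o ++ l) := by
  induction l generalizing ρ with
  | nil => simp [Prog.each, wp]
  | cons b l ih =>
    rw [Prog.each, wp, wp, ih]
    funext o
    simp [emitOut]

/-- The residue is guessed and confirmed before anything is written. Modulo `p` only the guess `f x`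
has nonzero weight, so only the word `enc (f x)` is left. -/
theorem lift_mem_FUL {p e : ℕ} (hp : p.Prime) {A B : Type} [Finite A]
    (enc : ZMod (p ^ e) → List B) {f : List A → ZMod (p ^ e)}
    (hf : f ∈ SharpModL (p ^ e) A) :
    (PFun.lift (fun x => enc (f x)) : List A →. List B) ∈ FUL p A B := by
  classical
  obtain ⟨ι, hι, q, D, w, h1, h0, hq⟩ := exists_residue_prog hp hf B
  have : NeZero (p ^ e) := ⟨(Nat.pow_pos hp.pos).ne'⟩
  obtain ⟨M, hM, hcount⟩ := exists_machine
    (Prog.anyOf (fun r => Prog.seq (q r) (Prog.each Prog.emit (enc r))) (elems (ZMod (p ^ e)))) D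
  have key : ∀ x y, (M.numAccOut x y : ZMod p) = if enc (f x) = y then 1 else 0 := by
    intro x y
    rw [hcount, wp_anyOf]
    have : ∀ r, wp x (capFor D x.length) emitOut ((q r).seq (Prog.each Prog.emit (enc r)))
        (fun _ o => if o = y then 1 else 0) (fun _ => 0) =
        w r x • fun o => if o ++ enc r = y then 1 else 0 := by
      intro r
      rw [wp, ← hq r x _ (pow_le_capFor D x.length) emitOut]
      congr 1
      funext σ
      rw [wp_each_emit]
    simp only [this]
    rw [← List.sum_toFinset _ (nodup_elems _), Finset.sum_apply, Nat.cast_sum,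
      Finset.sum_eq_single (f x)]
    · simp [h1]
    · intro r _ hr
      simp [h0 r x hr.symm]
    · intro h
      exact absurd (List.mem_toFinset.2 (mem_elems _)) h
  refine ⟨M, hM, fun x y => ⟨fun hy => ?_, fun hy => ?_⟩⟩
  · rw [← ZMod.natCast_eq_natCast_iff, key, if_pos, Nat.cast_one]
    simpa [eq_comm] using hy
  · rw [← ZMod.natCast_eq_natCast_iff, key, if_neg, Nat.cast_zero]
    simpa [eq_comm] using hy

/-- The counting semantics is built from sums only, so it commutes with additive maps; this allows
reduction modulo `p` before the simulation is analysed. -/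
theorem map_wp {A B ι R R' : Type} [AddCommMonoid R] [AddCommMonoid R'] (h : R →+ R')
    {em : B → R → R} {em' : B → R' → R'} (hem : ∀ b r, h (em b r) = em' b (h r)) {x : List A} {K : ℕ}
    (p : Prog A B ι) (k : (ι → ℕ) → R) (σ : ι → ℕ) :
    h (wp x K em p k σ) = wp x K em' p (fun σ => h (k σ)) σ := by
  induction p generalizing k σ with
  | skip | dec | setmax => rfl
  | fail => exact map_zero h
  | inc i =>
    simp only [wp]
    split_ifs
    · rfl
    · exact map_zero h
  | emit b => exact hem b _
  | seq p q ihp ihq =>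
    simp only [wp, ihp]
    congr 1
    funext σ
    exact ihq k σ
  | choose p q ihp ihq => simp only [wp, map_add, ihp, ihq]
  | ifz i p q ihp ihq | ifsym i a p q ihp ihq =>
    simp only [wp]
    split_ifs
    · exact ihp k σ
    · exact ihq k σ
  | loop i p ih =>
    simp only [wp]
    generalize σ i = n
    induction n generalizing σ with
    | zero => rfl
    | succ n ihn =>
      rw [Function.iterate_succ_apply', Function.iterate_succ_apply', ih]
      congr 1
      funext σ
      exact ihn σ

/-! ## Reading -/

section Read

variable {A : Type} {x : List A} {j : ℕ}

theorem readInput_eq_leftEnd : readInput x j = .leftEnd ↔ j = 0 := by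
  cases j with
  | zero => simp [readInput]
  | succ j =>
    simp only [readInput]
    cases x[j]? <;> simp

theorem readInput_eq_rightEnd : readInput x j = .rightEnd ↔ j - x.length ≠ 0 := by
  cases j with
  | zero => simp [readInput]
  | succ j =>
    rw [readInput_succ_eq_rightEnd]
    omega

theorem readInput_eq_sym {a : A} : readInput x j = .sym a ↔ 0 < j ∧ x[j - 1]? = some a := by
  cases j with
  | zero => simp [readInput]
  | succ j =>
    simp only [readInput, Nat.add_sub_cancel]
    cases x[j]? <;> simp

theorem readInput_concat_eq_sym {a b : A} : readInput (x ++ [b]) j = .sym a ↔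
    readInput x j = .sym a ∨ j = x.length + 1 ∧ a = b := by
  simp only [readInput_eq_sym, List.getElem?_append, List.getElem?_singleton]
  by_cases h : j - 1 < x.length
  · rw [if_pos h]
    constructor
    · exact Or.inl
    · rintro (h' | h')
      · exact h'
      · omega
  · rw [if_neg h, List.getElem?_eq_none (by omega)]
    by_cases h' : j - 1 - x.length = 0
    · simp only [h', if_true, Option.some.injEq]
      constructor
      · rintro ⟨h1, rfl⟩
        exact .inr ⟨by omega, rfl⟩
      · rintro (⟨_, h1⟩ | ⟨h1, rfl⟩)
        · simp at h1
        · exact ⟨by omega, rfl⟩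
    · simp only [h', if_false]
      constructor
      · rintro ⟨_, h1⟩
        simp at h1
      · rintro (⟨_, h1⟩ | ⟨h1, _⟩)
        · simp at h1
        · omega

end Read

/-! ## Following an oracle machine deterministically -/

namespace OracleMachine

variable {A B R : Type} [Finite B] (M : OracleMachine A B R)

def Reach (f : List B → R) (x : List A) (c : M.Cfg) : Prop :=
  ∃ l, Branch (M.Step f x) M.init l c

/-- The result of the first instruction; the machine stays in query states and when it has halted. -/
noncomputable def follow (x : List A) (c : M.Cfg) : M.Cfg :=
  match M.query c.state with
  | some _ => c
  | none => match M.acts (M.view x c) with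
    | [] => c
    | a :: _ => M.apply x c a

variable {M} {f : List B → R} {x : List A} {c c' : M.Cfg}

theorem Reach.step (h : M.Reach f x c) {m} (hs : M.Step f x c m c') : M.Reach f x c' :=
  h.elim fun _ hl => ⟨_, hl.append (.cons hs (.nil _))⟩

theorem Reach.follow (h : M.Reach f x c) : M.Reach f x (M.follow x c) := by
  unfold OracleMachine.follow
  split
  · exact h
  · rename_i hq
    split
    · exact h
    · rename_i a l hl
      exact h.step (.work hq (Machine.mem_acts.1 (hl ▸ List.mem_cons_self)))

theorem Reach.follow_iterate (h : M.Reach f x c) (n : ℕ) : M.Reach f x ((M.follow x)^[n] c) := by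
  induction n with
  | zero => exact h
  | succ n ih => rw [Function.iterate_succ_apply']; exact ih.follow

/-- Each step appends at most one letter, so queries have polynomial length and programs run on them
stay within polynomial bounds. -/
theorem length_out_le {l : List (Option M.Act)} (h : Branch (M.Step f x) c l c') :
    c'.out.length ≤ c.out.length + l.length := by
  induction h with
  | nil => simp
  | cons hs _ ih =>
    cases hs with
    | @work a _ _ =>
      have : a.emit.toList.length ≤ 1 := by cases a.emit <;> simp
      simp only [Machine.apply, List.length_append, List.length_cons] at ih ⊢
      omega
    | ask _ =>
      simp only [List.length_nil, List.length_cons] at ih ⊢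
      omega

end OracleMachine

/-! ## Looking up letters of a query -/

/-- Working registers for the evaluation of a program on a query; `κ` are the registers of the
program. -/
inductive WReg (T κ : Type)
  | clock
  | pos
  | ans
  | det (r : CReg T)
  | test (j : κ)

/-- The registers for the simulation of an oracle machine: `cur` for the current configuration, and
`sav` for the latest configuration in which the oracle tape was empty. -/
inductive OReg (T κ : Type)
  | scratch
  | wr
  | cur (r : CReg T)
  | sav (r : CReg T)
  | work (j : WReg T κ)

instance {T κ : Type} [Finite T] [Finite κ] : Finite (WReg T κ) := by
  refine Finite.of_surjective (fun i : Fin 3 ⊕ (CReg T ⊕ κ) => match i with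
    | .inl 0 => WReg.clock
    | .inl 1 => WReg.pos
    | .inl 2 => WReg.ans
    | .inr (.inl r) => WReg.det r
    | .inr (.inr j) => WReg.test j) ?_
  rintro (_ | _ | _ | r | j)
  exacts [⟨.inl 0, rfl⟩, ⟨.inl 1, rfl⟩, ⟨.inl 2, rfl⟩, ⟨.inr (.inl r), rfl⟩, ⟨.inr (.inr j), rfl⟩]

instance {T κ : Type} [Finite T] [Finite κ] : Finite (OReg T κ) := by
  refine Finite.of_surjective (fun i : Fin 2 ⊕ (CReg T ⊕ (CReg T ⊕ WReg T κ)) => match i with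
    | .inl 0 => OReg.scratch
    | .inl 1 => OReg.wr
    | .inr (.inl r) => OReg.cur r
    | .inr (.inr (.inl r)) => OReg.sav r
    | .inr (.inr (.inr j)) => OReg.work j) ?_
  rintro (_ | _ | r | r | j)
  exacts [⟨.inl 0, rfl⟩, ⟨.inl 1, rfl⟩, ⟨.inr (.inl r), rfl⟩, ⟨.inr (.inr (.inl r)), rfl⟩,
    ⟨.inr (.inr (.inr j)), rfl⟩]

namespace OReg
variable {T κ : Type}
abbrev clock : OReg T κ := work .clock
abbrev pos : OReg T κ := work .pos
abbrev ans : OReg T κ := work .ans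
abbrev det (r : CReg T) : OReg T κ := work (.det r)
abbrev test (j : κ) : OReg T κ := work (.test j)
end OReg

section Lookup

variable {A B R κ : Type} [Finite A] [Finite B] {M : OracleMachine A B R}

namespace Prog

open Classical in
/-- Taking notice of an emission while waiting for the letter number `pos`. -/
noncomputable def note (P : Set B) : Option B → Prog A Empty (OReg M.Tape κ)
  | none => skip
  | some b => ifz .pos skip
      (seq (dec .pos) (ifz .pos (if b ∈ P then setc .ans 1 else skip) skip))

noncomputable def lookStep (P : Set B) : Prog A Empty (OReg M.Tape κ) :=
  caseView .det fun v : M.View => match M.query v.1 with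
    | some _ => skip
    | none => match M.acts v with
      | [] => skip
      | a :: _ => seq (act .det .scratch a) (note P a.emit)

/-- With `j` the value of the register `i`: determine whether the letter number `j` of the query
that is prepared from the configuration `sav` on is in `P`, and whether it exists. -/
noncomputable def lookup (i : OReg M.Tape κ) (P : Set B) : Prog A Empty (OReg M.Tape κ) :=
  seq (copy i .pos) (seq (clear .ans) (seq (copyAll .sav .det) (seq (setmax .clock)
    (loop .clock (lookStep P)))))

end Prog

variable {x : List A} {S K : ℕ} {σ : OReg M.Tape κ → ℕ} {c : M.Cfg} {P : Set B} {j : ℕ}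

/-- The registers `pos` and `ans` are correct for the letter number `j` of the word `w`. -/
structure Looked (P : Set B) (j : ℕ) (w : List B) (σ : OReg M.Tape κ → ℕ) : Prop where
  pos : σ .pos = j - w.length
  ans : σ .ans ≠ 0 ↔ ∃ b ∈ P, readInput w j = .sym b

/-- `pos` counts the letters still awaited, and the emission that takes it from `1` to `0` is letter
number `j`. Letters are numbered from `1`, as cell `0` of an input tape is the left end marker. -/
theorem det_note (hK : 1 ≤ K) {w : List B} (h : Looked P j w σ) (b : Option B) :
    ∃ σ', Det x K (Prog.note P b) σ σ' ∧ Looked P j (w ++ b.toList) σ' ∧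
      ∀ i, i ≠ .pos → i ≠ .ans → σ' i = σ i := by
  cases b with
  | none => exact ⟨σ, Det.skip, by simpa using h, fun _ _ _ => rfl⟩
  | some b =>
    have hl : (w ++ (some b).toList).length = w.length + 1 := by simp
    have hr : ∀ a, readInput (w ++ (some b).toList) j = .sym a ↔
      readInput w j = .sym a ∨ j = w.length + 1 ∧ a = b := fun a => readInput_concat_eq_sym
    have hp := h.pos
    by_cases h0 : σ .pos = 0
    · refine ⟨σ, Det.ifz_pos h0 Det.skip, ⟨by omega, ?_⟩, fun _ _ _ => rfl⟩
      rw [h.ans]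
      simp only [hr, show ¬ j = w.length + 1 by omega, false_and, or_false]
    -- While letters are awaited, position `j` lies beyond what has been written so far and reads as
    -- the right end marker.
    · have hno : ¬ ∃ b ∈ P, readInput w j = .sym b := by
        rintro ⟨a, -, ha⟩
        have := readInput_eq_rightEnd.2 (hp ▸ h0)
        rw [this] at ha
        cases ha
      set σ₁ := upd σ .pos (σ .pos - 1) with hσ₁
      by_cases h1 : σ .pos = 1
      · by_cases hb : b ∈ P
        · refine ⟨upd σ₁ .ans 1, Det.ifz_neg h0 (Det.seq (Det.dec _) (Det.ifz_pos (by simp [h1]) ?_)),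
            ⟨?_, ?_⟩, fun i h2 h3 => by simp [hσ₁, h2, h3]⟩
          · rw [if_pos hb]
            exact Det.setc hK
          · simp [hσ₁]; omega
          · simp only [upd_same, ne_eq, one_ne_zero, not_false_eq_true, true_iff]
            exact ⟨b, hb, (hr b).2 (.inr ⟨by omega, rfl⟩)⟩
        · refine ⟨σ₁, Det.ifz_neg h0 (Det.seq (Det.dec _) (Det.ifz_pos (by simp [h1]) ?_)),
            ⟨?_, ?_⟩, fun i h2 h3 => by simp [hσ₁, h2]⟩
          · rw [if_neg hb]
            exact Det.skip
          · simp [hσ₁]; omega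
          · rw [hσ₁, upd_ne _ _ (by simp), h.ans]
            refine iff_of_false hno ?_
            rintro ⟨a, ha, h2⟩
            rcases (hr a).1 h2 with h3 | ⟨-, rfl⟩
            · exact hno ⟨a, ha, h3⟩
            · exact hb ha
      · refine ⟨σ₁, Det.ifz_neg h0 (Det.seq (Det.dec _) (Det.ifz_neg (by simp; omega) Det.skip)),
            ⟨?_, ?_⟩, fun i h2 h3 => by simp [hσ₁, h2]⟩
        · simp [hσ₁]; omega
        · rw [hσ₁, upd_ne _ _ (by simp), h.ans]
          simp only [hr, show ¬ j = w.length + 1 by omega, false_and, or_false]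

theorem det_lookStep (hK : Big M.toMachine x S K) (h0 : σ .scratch = 0)
    (hE : Enc M.toMachine x S c fun r => σ (.det r)) (hS : ∀ t, (M.follow x c).workHead t ≤ S)
    (hl : Looked P j c.out σ) : ∃ σ', Det x K (Prog.lookStep P) σ σ' ∧
      Enc M.toMachine x S (M.follow x c) (fun r => σ' (.det r)) ∧
      Looked P j (M.follow x c).out σ' ∧
      ∀ i, i ≠ .pos → i ≠ .ans → i ∉ Set.range OReg.det → σ' i = σ i := by
  have hcase : ∀ σ', Det x K (match M.query c.state with
      | some _ => Prog.skip
      | none => match M.acts (M.view x c) with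
        | [] => Prog.skip
        | a :: _ => .seq (.act .det .scratch a) (.note P a.emit)) σ σ' →
      Det x K (Prog.lookStep P) σ σ' := fun σ' h => ⟨fun em k => by
    rw [Prog.lookStep, wp_caseView hK hE]
    exact h.wp_eq em k⟩
  rcases hq : M.query c.state with _ | g
  · rcases ha : M.acts (M.view x c) with _ | ⟨a, l⟩
    · have hf : M.follow x c = c := by simp [OracleMachine.follow, hq, ha]
      rw [hf]
      exact ⟨σ, hcase σ (by rw [hq, ha]; exact Det.skip), hE, hl, fun _ _ _ _ => rfl⟩
    · have hf : M.follow x c = M.apply x c a := by simp [OracleMachine.follow, hq, ha]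
      rw [hf] at hS ⊢
      obtain ⟨σ₁, hd₁, hE₁, hf₁⟩ := det_act (B := Empty) (β := OReg.det)
        (fun r s h => by injection h with h; injection h) (τ := .scratch) (by simp) h0 hK a hE hS
      obtain ⟨σ₂, hd₂, hl₂, hf₂⟩ := det_note (x := x) (P := P) (j := j) (σ := σ₁)
        (le_trans (by omega) hK.input)
        ⟨by rw [hf₁ _ (by simp)]; exact hl.pos, by rw [hf₁ _ (by simp)]; exact hl.ans⟩ a.emit
      refine ⟨σ₂, hcase _ (by rw [hq, ha]; exact hd₁.seq hd₂), ?_, hl₂, fun i h1 h2 h3 => ?_⟩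
      · have : (fun r => σ₂ (.det r)) = fun r => σ₁ (.det r) :=
          funext fun r => hf₂ _ (by simp) (by simp)
        rw [this]
        exact hE₁
      · rw [hf₂ i h1 h2, hf₁ i h3]
  · have hf : M.follow x c = c := by simp [OracleMachine.follow, hq]
    rw [hf]
    exact ⟨σ, hcase σ (by rw [hq]; exact Det.skip), hE, hl, fun _ _ _ _ => rfl⟩

/-- A copy of the saved configuration is followed for `K` steps regardless of the length of the
query, since `follow` does not leave a query state. -/
theorem det_lookup (hK : Big M.toMachine x S K) (h0 : σ .scratch = 0)
    (hE : Enc M.toMachine x S c fun r => σ (.sav r)) (hc : c.out = [])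
    (hS : ∀ n t, ((M.follow x)^[n] c).workHead t ≤ S) (i : κ) (hi : σ (.test i) ≤ K) :
    ∃ σ', Det x K (Prog.lookup (.test i) P) σ σ' ∧
      Looked P (σ (.test i)) ((M.follow x)^[K] c).out σ' ∧ (∀ j, σ' (.test j) = σ (.test j)) ∧
      ∀ r, (∀ j, r ≠ .work j) → σ' r = σ r := by
  set σ₁ := upd (upd σ .pos (σ (.test i))) .ans 0 with hσ₁
  obtain ⟨σ₂, hd₂, hc₂, hf₂⟩ := det_copyAll (B := Empty) (x := x) (K := K) (σ := σ₁)
    (f := OReg.sav) (g := OReg.det) (fun r s h => by injection h with h; injection h) (by simp)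
    (fun r => by simpa [hσ₁] using hE.le hK r)
  set σ₃ := upd σ₂ .clock K with hσ₃
  -- `Det.loop` asks for the sequence of all intermediate stores, so it is constructed along with
  -- the induction.
  have hloop : ∀ n, ∃ I : ℕ → OReg M.Tape κ → ℕ, I 0 = σ₃ ∧
      (∀ m < n, Det x K (Prog.lookStep P) (I m) (I (m + 1))) ∧
      Enc M.toMachine x S ((M.follow x)^[n] c) (fun r => I n (.det r)) ∧
      Looked P (σ (.test i)) ((M.follow x)^[n] c).out (I n) ∧
      ∀ i, i ≠ .pos → i ≠ .ans → i ∉ Set.range OReg.det → I n i = σ₃ i := by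
    intro n
    induction n with
    | zero =>
      refine ⟨fun _ => σ₃, rfl, by simp, ?_, ⟨?_, ?_⟩, fun _ _ _ _ => rfl⟩
      · simpa [hσ₃, hc₂, hσ₁] using hE
      · simp [hσ₃, hf₂, hσ₁, hc]
      · simp only [hσ₃, Function.iterate_zero, id, hc, readInput_eq_sym]
        rw [upd_ne _ _ (by simp), hf₂ _ (by simp), hσ₁]
        simp
    | succ n ih =>
      obtain ⟨I, hI0, hI, hE', hl, hf⟩ := ih
      obtain ⟨σ', hd, hE'', hl', hf'⟩ := det_lookStep (P := P) hK
        (by rw [hf _ (by simp) (by simp) (by simp), hσ₃, upd_ne _ _ (by simp), hf₂ _ (by simp), hσ₁]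
            simpa using h0) hE' (by rw [← Function.iterate_succ_apply' (M.follow x)]; exact hS _) hl
      refine ⟨fun m => if m ≤ n then I m else σ', by simp [hI0], ?_, ?_, ?_, ?_⟩
      · intro m hm
        rcases (Nat.lt_succ_iff.1 hm).lt_or_eq with h | rfl
        · simpa [h.le, Nat.succ_le_of_lt h] using hI m h
        · simpa using hd
      · rw [Function.iterate_succ_apply']
        simpa using hE''
      · rw [Function.iterate_succ_apply']
        simpa using hl'
      · intro i h1 h2 h3
        simp [hf' i h1 h2 h3, hf i h1 h2 h3]
  obtain ⟨I, hI0, hI, -, hl, hf⟩ := hloop K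
  have hck : σ₃ .clock = K := by simp [hσ₃]
  refine ⟨I K, (Det.copy (by simp) hi).seq ((Det.clear _).seq (hd₂.seq ((Det.setmax _).seq ?_))),
    hl, ?_, ?_⟩
  · have := Det.loop (σ := σ₃) (i := OReg.clock) I hI0 (by rwa [hck])
    rwa [hck] at this
  · intro j
    rw [hf _ (by simp) (by simp) (by simp), hσ₃, upd_ne _ _ (by simp), hf₂ _ (by simp), hσ₁]
    simp
  · intro r hr
    rw [hf _ (hr _) (hr _) fun ⟨s, h⟩ => hr _ h.symm, hσ₃, upd_ne _ _ (hr _),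
      hf₂ _ fun ⟨s, h⟩ => hr _ h.symm, hσ₁, upd_ne _ _ (hr _), upd_ne _ _ (hr _)]

/-! ### Programs that read the query -/

namespace Prog

/-- The left end marker is position `0`. The right end marker shows in letters still being awaited
when the query is complete, so no set of letters is needed for it. -/
noncomputable def ifLetter (i : κ) (p q : Prog A Empty (OReg M.Tape κ)) :
    InputSym B → Prog A Empty (OReg M.Tape κ)
  | .leftEnd => ifz (.test i) p q
  | .sym b => seq (lookup (.test i) {b}) (ifz .ans q p)
  | .rightEnd => seq (lookup (.test i) ∅) (ifz .pos q p)

/-- The program `p` with the query in the place of the input. -/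
noncomputable def virt : Prog B Empty κ → Prog A Empty (OReg M.Tape κ)
  | .skip => skip
  | .fail => fail
  | .inc i => inc (.test i)
  | .dec i => dec (.test i)
  | .setmax i => setmax (.test i)
  | .emit b => b.elim
  | .seq p q => seq (virt p) (virt q)
  | .choose p q => choose (virt p) (virt q)
  | .ifz i p q => ifz (.test i) (virt p) (virt q)
  | .ifsym i a p q => ifLetter i (virt p) (virt q) a
  | .loop i p => loop (.test i) (virt p)

end Prog

/-- The store `σ` consists of `τ` in the registers `test`, and of `σ₀` outside the working
registers. -/
structure Overlay (σ₀ : OReg M.Tape κ → ℕ) (K : ℕ) (σ : OReg M.Tape κ → ℕ) (τ : κ → ℕ) : Prop where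
  test : ∀ j, σ (.test j) = τ j
  le : ∀ j, τ j ≤ K
  base : ∀ r, (∀ j, r ≠ .work j) → σ r = σ₀ r

theorem Overlay.upd {σ₀ : OReg M.Tape κ → ℕ} {τ : κ → ℕ} (h : Overlay σ₀ K σ τ) (i : κ) {v : ℕ}
    (hv : v ≤ K) : Overlay σ₀ K (upd σ (.test i) v) (upd τ i v) where
  test j := by
    by_cases hj : j = i
    · subst hj; simp
    · simp [hj, h.test]
  le := upd_le h.le hv
  base r hr := by rw [upd_ne _ _ (hr _), h.base r hr]

/-- The query is never stored. A program on it differs from a program on the input only in how a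
symbol is read, and here each reading recomputes the query from the saved configuration. Such a
lookup has a single branch and touches only working registers outside `test`, so the counts agree.
-/
theorem wp_virt (hK : Big M.toMachine x S K) {σ₀ : OReg M.Tape κ → ℕ} (h0 : σ₀ .scratch = 0)
    (hE : Enc M.toMachine x S c fun r => σ₀ (.sav r)) (hc : c.out = [])
    (hS : ∀ n t, ((M.follow x)^[n] c).workHead t ≤ S) {V : Type} [AddCommMonoid V]
    {em : Empty → V → V} (p : Prog B Empty κ) {k : (OReg M.Tape κ → ℕ) → V} {k' : (κ → ℕ) → V}
    (hk : ∀ σ τ, Overlay σ₀ K σ τ → k σ = k' τ) {τ : κ → ℕ} (h : Overlay σ₀ K σ τ) :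
    wp x K em (Prog.virt p) k σ = wp ((M.follow x)^[K] c).out K em p k' τ := by
  have hlook : ∀ (i : κ) (P : Set B) {σ τ}, Overlay σ₀ K σ τ → ∃ σ',
      Det x K (Prog.lookup (.test i) P) σ σ' ∧
      Looked P (τ i) ((M.follow x)^[K] c).out σ' ∧ Overlay σ₀ K σ' τ := by
    intro i P σ τ h
    obtain ⟨σ', hd, hl, ht, hr⟩ := det_lookup (P := P) hK (σ := σ) (by rw [h.base _ (by simp), h0])
      (c := c) (by
        have : (fun r => σ (.sav r)) = fun r => σ₀ (.sav r) := funext fun r => h.base _ (by simp)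
        rwa [this]) hc hS i (h.test i ▸ h.le i)
    exact ⟨σ', hd, h.test i ▸ hl, fun j => (ht j).trans (h.test j), h.le,
      fun r hr' => (hr r hr').trans (h.base r hr')⟩
  induction p generalizing k k' σ τ with
  | skip => exact hk _ _ h
  | fail => rfl
  | inc i =>
    simp only [Prog.virt, wp, h.test]
    split_ifs with h1
    · exact hk _ _ (h.upd i h1)
    · rfl
  | dec i =>
    simp only [Prog.virt, wp, h.test]
    exact hk _ _ (h.upd i ((Nat.sub_le _ _).trans (h.le i)))
  | setmax i => exact hk _ _ (h.upd i le_rfl)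
  | emit b => exact b.elim
  | seq p q ihp ihq => exact ihp (fun σ τ h => ihq hk h) h
  | choose p q ihp ihq => simp only [Prog.virt, wp, ihp hk h, ihq hk h]
  | ifz i p q ihp ihq =>
    simp only [Prog.virt, wp, h.test, ihp hk h, ihq hk h]
  | ifsym i a p q ihp ihq =>
    rw [Prog.virt, wp]
    cases a with
    | leftEnd =>
      simp only [Prog.ifLetter, wp, h.test, ihp hk h, ihq hk h, readInput_eq_leftEnd]
    | sym b =>
      obtain ⟨σ', hd, hl, h'⟩ := hlook i {b} h
      have : σ' .ans = 0 ↔ ¬ readInput ((M.follow x)^[K] c).out (τ i) = .sym b := by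
        rw [← not_iff_not, not_not]
        exact hl.ans.trans (by simp)
      rw [Prog.ifLetter, hd.wp_seq, wp, ihp hk h', ihq hk h']
      by_cases h1 : readInput ((M.follow x)^[K] c).out (τ i) = .sym b
      · rw [if_neg (fun h2 => this.1 h2 h1), if_pos h1]
      · rw [if_pos (this.2 h1), if_neg h1]
    | rightEnd =>
      obtain ⟨σ', hd, hl, h'⟩ := hlook i ∅ h
      rw [Prog.ifLetter, hd.wp_seq, wp, ihp hk h', ihq hk h']
      by_cases h1 : readInput ((M.follow x)^[K] c).out (τ i) = .rightEnd
      · rw [if_neg (by rw [hl.pos]; exact readInput_eq_rightEnd.1 h1), if_pos h1]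
      · rw [if_pos (by rw [hl.pos]; exact not_not.1 (mt readInput_eq_rightEnd.2 h1)), if_neg h1]
  | loop i p ih =>
    simp only [Prog.virt, wp, h.test]
    generalize τ i = n
    induction n generalizing σ τ with
    | zero => exact hk _ _ h
    | succ n ihn =>
      rw [Function.iterate_succ_apply', Function.iterate_succ_apply']
      exact ih (fun σ τ h => ihn h) h

end Lookup

/-! ## Simulation of oracle machines modulo a prime -/

section Simulation

variable {A B R κ : Type} [Finite A] [Finite B] [Finite R] [Finite κ] {M : OracleMachine A B R}

namespace Prog

open Classical in
/-- The move by the instruction `a`. -/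
noncomputable def workStep (a : M.Act) : Prog A Empty (OReg M.Tape κ) :=
  seq (act .cur .scratch a) (if a.emit = none then skip else setc .wr 1)

/-- The answer `r` to a query, to be confirmed by the program `q r`. -/
noncomputable def askStep (q : R → Prog B Empty κ) (g : R → M.State) (r : R) :
    Prog A Empty (OReg M.Tape κ) :=
  seq (virt (q r)) (seq (clearAll .work) (seq (setc (.cur .st) (num M.start (g r))) (clear .wr)))

/-- The current configuration is saved before each move made with an empty oracle tape, so `sav`
always holds a point from which the present query can be reproduced. -/
noncomputable def oracleStep (q : R → Prog B Empty κ) : Prog A Empty (OReg M.Tape κ) :=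
  seq (ifz .wr (copyAll .cur .sav) skip) (caseView .cur fun v : M.View =>
    match M.query v.1 with
    | some g => anyOf (askStep q g) (elems R)
    | none => match M.acts v with
      | [] => skip
      | a :: l => anyOf workStep (a :: l))

-- Passes in a halted configuration are idle, so acceptance is tested only after the loop.
open Classical in
noncomputable def oracleEnd : Prog A Empty (OReg M.Tape κ) :=
  caseView .cur fun v : M.View =>
    if M.query v.1 = none ∧ M.acts v = [] ∧ v.1 ∈ M.accept then skip else fail

noncomputable def oracleSim (q : R → Prog B Empty κ) : Prog A Empty (OReg M.Tape κ) :=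
  seq (setmax .clock) (seq (loop .clock (oracleStep q)) oracleEnd)

end Prog

/-- After `n` deterministic steps from the configuration in the registers `sav`, the machine is in the
configuration `c`. -/
def Saved (M : OracleMachine A B R) (f : List B → R) (x : List A) (S : ℕ) (c : M.Cfg)
    (σ : OReg M.Tape κ → ℕ) : Prop :=
  ∃ c₀ n l, M.Reach f x c₀ ∧ c₀.out = [] ∧ (M.follow x)^[n] c₀ = c ∧
    Branch (M.Step f x) M.init l c ∧ n ≤ l.length ∧ Enc M.toMachine x S c₀ fun r => σ (.sav r)

structure Simulates (M : OracleMachine A B R) (f : List B → R) (x : List A) (S : ℕ) (c : M.Cfg)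
    (σ : OReg M.Tape κ → ℕ) : Prop where
  scratch : σ .scratch = 0
  test : ∀ j, σ (.test j) = 0
  cur : Enc M.toMachine x S c fun r => σ (.cur r)
  wr : σ .wr = 0 ↔ c.out = []
  saved : c.out ≠ [] → Saved M f x S c σ

variable {f : List B → R} {x : List A} {S K : ℕ} {c : M.Cfg} {σ : OReg M.Tape κ → ℕ}

theorem cur_injective {T : Type} : Function.Injective (OReg.cur (T := T) (κ := κ)) :=
  fun r s h => by injection h

theorem det_save (hK : Big M.toMachine x S K) (hc : M.Reach f x c) (h : Simulates M f x S c σ) :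
    ∃ σ', Det (B := Empty) x K (Prog.ifz .wr (Prog.copyAll .cur .sav) .skip) σ σ' ∧
      Simulates M f x S c σ' ∧ Saved M f x S c σ' := by
  by_cases h0 : σ .wr = 0
  · have hout := h.wr.1 h0
    obtain ⟨σ', hd, h1, h2⟩ := det_copyAll (B := Empty) (x := x) (K := K) (σ := σ)
      (f := OReg.cur) (g := OReg.sav) (fun r s h => by injection h) (by simp)
      (fun r => h.cur.le hK r)
    have hcur : (fun r => σ' (.cur r)) = fun r => σ (.cur r) := funext fun r => h2 _ (by simp)
    refine ⟨σ', Det.ifz_pos h0 hd, ⟨?_, fun j => ?_, ?_, ?_, fun h => absurd hout h⟩, ?_⟩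
    · rw [h2 _ (by simp), h.scratch]
    · rw [h2 _ (by simp), h.test]
    · rw [hcur]; exact h.cur
    · rw [h2 _ (by simp), h.wr]
    · obtain ⟨l, hl⟩ := hc
      refine ⟨c, 0, l, ⟨l, hl⟩, hout, rfl, hl, Nat.zero_le _, ?_⟩
      simpa only [h1] using h.cur
  · exact ⟨σ, Det.ifz_neg h0 Det.skip, h, h.saved fun h' => h0 (h.wr.2 h')⟩

/-- A move without a query. -/
theorem det_workStep (hK : Big M.toMachine x S K) (hS : ∀ c, M.Reach f x c → ∀ t, c.workHead t ≤ S)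
    (hdet : M.DetQueries f) (hc : M.Reach f x c) (h : Simulates M f x S c σ)
    (hsav : Saved M f x S c σ) (hq : M.query c.state = none) {a : M.Act}
    (ha : a ∈ M.enabled x c) : ∃ σ', Det x K (Prog.workStep a) σ σ' ∧
      Simulates M f x S (M.apply x c a) σ' := by
  have hstep : M.Step f x c (some a) (M.apply x c a) := .work hq ha
  obtain ⟨σ₁, hd₁, hE₁, hf₁⟩ := det_act (B := Empty) cur_injective (τ := .scratch) (by simp) h.scratch
    hK a h.cur (hS _ (hc.step hstep))
  have hwr₁ : σ₁ .wr = σ .wr := hf₁ _ (by simp)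
  have hsc₁ : σ₁ .scratch = 0 := by rw [hf₁ _ (by simp), h.scratch]
  have ht₁ : ∀ j, σ₁ (.test j) = 0 := fun j => by rw [hf₁ _ (by simp), h.test]
  have hs₁ : (fun r => σ₁ (.sav r)) = fun r => σ (.sav r) := funext fun r => hf₁ _ (by simp)
  have hsaved : (M.apply x c a).out ≠ [] → ∀ σ' : OReg M.Tape κ → ℕ,
      (fun r => σ' (.sav r)) = (fun r => σ (.sav r)) → Saved M f x S (M.apply x c a) σ' := by
    intro hout σ' hσ'
    obtain ⟨c₀, n, l, h1, h2, h3, h4, h5, h6⟩ := hsav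
    -- If the oracle tape is nonempty after the move, then it was so before or the move writes on
    -- it; in both cases the convention on queries leaves only one instruction.
    have hsub : (M.enabled x c).Subsingleton := by
      obtain ⟨l, hl⟩ := hc
      refine hdet x l c hl hq ?_
      by_contra hno
      rw [not_or, not_not] at hno
      apply hout
      have : a.emit = none := by
        by_contra he
        exact hno.2 ⟨a, ha, he⟩
      simp [Machine.apply, hno.1, this]
    have hfol : M.follow x c = M.apply x c a := by
      have ha' := Machine.mem_acts.2 ha
      rcases hl : M.acts (M.view x c) with _ | ⟨a', l'⟩
      · rw [hl] at ha'; simp at ha'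
      · have : a' = a := hsub (Machine.mem_acts.1 (hl ▸ List.mem_cons_self)) ha
        simp [OracleMachine.follow, hq, hl, this]
    refine ⟨c₀, n + 1, l ++ [some a], h1, h2, ?_, h4.append (.cons hstep (.nil _)), ?_, ?_⟩
    · rw [Function.iterate_succ_apply', h3, hfol]
    · simpa using h5
    · rw [hσ']; exact h6
  by_cases he : a.emit = none
  · have hout : (M.apply x c a).out = c.out := by simp [Machine.apply, he]
    refine ⟨σ₁, hd₁.seq (by rw [if_pos he]; exact Det.skip), ⟨hsc₁, ht₁, hE₁, ?_, fun h =>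
      hsaved h _ hs₁⟩⟩
    rw [hout, hwr₁, h.wr]
  · have hout : (M.apply x c a).out ≠ [] := by
      obtain ⟨b, hb⟩ := Option.ne_none_iff_exists'.1 he
      simp [Machine.apply, hb]
    refine ⟨upd σ₁ .wr 1, hd₁.seq (by rw [if_neg he]; exact Det.setc (le_trans (by omega) hK.input)),
      ⟨by simpa using hsc₁, by simpa using ht₁, by simpa using hE₁, by simpa using hout, fun h =>
      hsaved h _ (by simpa using hs₁)⟩⟩

/-- A query. -/
theorem wp_askStep (hK : Big M.toMachine x S K) (hS : ∀ c, M.Reach f x c → ∀ t, c.workHead t ≤ S)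
    (hT : ∀ l c, Branch (M.Step f x) M.init l c → l.length ≤ K) {V : Type} [AddCommMonoid V]
    {em : Empty → V → V} (q : R → Prog B Empty κ) (w : R → ℕ)
    (hw : ∀ r (ρ : V), wp c.out K em (q r) (fun _ => ρ) (fun _ => 0) = w r • ρ)
    (h : Simulates M f x S c σ)
    (hsav : Saved M f x S c σ) {g : R → M.State} (hq : M.query c.state = some g)
    (F : (OReg M.Tape κ → ℕ) → V) (r : R) :
    ∃ σ', wp x K em (Prog.askStep q g r) F σ = w r • F σ' ∧
      Simulates M f x S { c with state := g r, out := [] } σ' := by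
  obtain ⟨c₀, n, l, h1, h2, h3, h4, h5, h6⟩ := hsav
  -- A query state is a fixed point of `follow`, so `K` steps from the saved configuration end
  -- exactly where the machine is now, with the complete query written.
  have hfix : (M.follow x)^[K] c₀ = c := by
    have hc : M.follow x c = c := by simp [OracleMachine.follow, hq]
    have hn : n ≤ K := h5.trans (hT l c h4)
    rw [show K = (K - n) + n by omega, Function.iterate_add_apply, h3]
    exact Function.iterate_fixed hc _
  have hst : num M.start (g r) ≤ K := (num_lt _ _).le.trans hK.state
  obtain ⟨σ₁, hd₁, hc₁, hf₁⟩ := det_clearAll (B := Empty) (x := x) (K := K) (σ := σ)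
    (OReg.work (T := M.Tape) (κ := κ))
  refine ⟨upd (upd σ₁ (.cur .st) (num M.start (g r))) .wr 0, ?_, ?_⟩
  · rw [Prog.askStep, wp, ← hw, ← hfix]
    refine wp_virt hK h.scratch h6 h2 (fun n t => hS _ (h1.follow_iterate n) t) (q r) ?_
      ⟨h.test, fun _ => Nat.zero_le _, fun _ _ => rfl⟩
    intro σ' τ ho
    obtain ⟨σ₂, hd₂, hc₂, hf₂⟩ := det_clearAll (B := Empty) (x := x) (K := K) (σ := σ')
      (OReg.work (T := M.Tape) (κ := κ))
    -- Clearing the working registers brings all branches of the confirming program to the same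
    -- store. The continuation is therefore constant on them and is merely multiplied by their
    -- number.
    have : σ₂ = σ₁ := by
      funext i
      by_cases hi : i ∈ Set.range (OReg.work (T := M.Tape) (κ := κ))
      · obtain ⟨j, rfl⟩ := hi
        rw [hc₂, hc₁]
      · rw [hf₂ i hi, hf₁ i hi]
        exact ho.base i fun j e => hi ⟨j, e.symm⟩
    rw [hd₂.wp_seq, (Det.setc hst).wp_seq, (Det.clear _).wp_eq, this]
  · have hcur : ∀ q, σ₁ (.cur q) = σ (.cur q) := fun q => hf₁ _ (by simp)
    refine ⟨?_, ?_, ⟨?_, ?_, h.cur.hd_le, fun t => ?_, h.cur.head_le⟩, by simp, fun h => absurd rfl h⟩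
    · simp [hf₁, h.scratch]
    · simp [hc₁]
    · simp
    · simpa [hcur] using h.cur.hd
    · simpa [hcur] using h.cur.tape t

theorem OracleMachine.halted (hno : ∀ m c', ¬ M.Step f x c m c') :
    M.query c.state = none ∧ M.acts (M.view x c) = [] := by
  have hq : M.query c.state = none := by
    by_contra hq
    obtain ⟨g, hg⟩ := Option.ne_none_iff_exists'.1 hq
    exact hno _ _ (.ask hg)
  exact ⟨hq, List.eq_nil_iff_forall_not_mem.2 fun a ha =>
    hno _ _ (.work hq (Machine.mem_acts.1 ha))⟩

/-- Moves without a query correspond one to one. At a query the simulation guesses every answer `r`,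
with weight `w r c.out`, which modulo `p` is `1` for the true answer and `0` for all others. So the
counts agree modulo `p`, though in general not as natural numbers. -/
theorem iterate_oracleStep {p : ℕ} (hK : Big M.toMachine x S K)
    (hS : ∀ c, M.Reach f x c → ∀ t, c.workHead t ≤ S)
    (hT : ∀ l c, Branch (M.Step f x) M.init l c → l.length ≤ K) (hdet : M.DetQueries f)
    {em : Empty → ZMod p → ZMod p} (q : R → Prog B Empty κ) (w : R → List B → ℕ)
    (hw : ∀ r c, M.Reach f x c → ∀ ρ : ZMod p,
      wp c.out K em (q r) (fun _ => ρ) (fun _ => 0) = w r c.out • ρ)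
    (hw1 : ∀ u, (w (f u) u : ZMod p) = 1) (hw0 : ∀ r u, f u ≠ r → (w r u : ZMod p) = 0)
    (n t N : ℕ) {ok : M.Cfg → Prop}
    (hR : Run (M.Step f x) ok (fun c => c.state ∈ M.accept) t c N) (ht : t ≤ n)
    (hc : M.Reach f x c) (h : Simulates M f x S c σ) :
    (wp x K em (Prog.oracleStep q))^[n] (wp x K em Prog.oracleEnd fun _ => 1) σ = N := by
  classical
  induction n generalizing t N c σ with
  | zero =>
    rw [Function.iterate_zero, id, Prog.oracleEnd, wp_caseView hK h.cur]
    cases hR with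
    | accept _ hno ha =>
      obtain ⟨h1, h2⟩ := OracleMachine.halted hno
      rw [if_pos ⟨h1, h2, ha⟩, wp, Nat.cast_one]
    | reject _ hno ha =>
      rw [if_neg (fun h => ha h.2.2), wp, Nat.cast_zero]
    | move => omega
  | succ n ih =>
    obtain ⟨σ₁, hd₁, h₁, hs₁⟩ := det_save hK hc h
    rw [Function.iterate_succ_apply']
    set F := (wp x K em (Prog.oracleStep q))^[n] (wp x K em Prog.oracleEnd fun _ => 1) with hF
    rw [Prog.oracleStep, hd₁.wp_seq, wp_caseView hK h₁.cur]
    -- A halted configuration only waits for the clock to run out.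
    have hidle : (∀ m c', ¬ M.Step f x c m c') →
        Run (M.Step f x) ok (fun c => c.state ∈ M.accept) 0 c N →
        wp x K em (match M.query (M.view x c).1 with
          | some g => Prog.anyOf (Prog.askStep q g) (elems R)
          | none => match M.acts (M.view x c) with
            | [] => Prog.skip
            | a :: l => Prog.anyOf Prog.workStep (a :: l)) F σ₁ = N := by
      intro hno hr
      obtain ⟨h1, h2⟩ := OracleMachine.halted hno
      rw [show M.query (M.view x c).1 = none from h1, h2]
      exact ih 0 N hr (Nat.zero_le _) hc h₁
    cases hR with
    | accept ho hno ha => exact hidle hno (.accept ho hno ha)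
    | reject ho hno ha => exact hidle hno (.reject ho hno ha)
    | @move t _ s fm ν ho hs hne hr =>
      have hih : ∀ m ∈ s, ∀ σ', Simulates M f x S (fm m) σ' →
          F σ' = (ν m : ZMod p) := by
        intro m hm σ' h'
        refine ih t (ν m) (hr m hm) (by omega) (hc.step ((hs _ _).2 ⟨hm, rfl⟩)) h'
      rcases hq : M.query c.state with _ | g
      · have hmem : ∀ a, a ∈ M.acts (M.view x c) ↔ some a ∈ s := by
          intro a
          rw [Machine.mem_acts]
          refine ⟨fun ha => ((hs _ _).1 (.work hq ha)).1, fun ha => ?_⟩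
          have h := (hs _ _).2 ⟨ha, rfl⟩
          generalize fm (some a) = d at h
          cases h
          assumption
        have hsome : ∀ m ∈ s, ∃ a, m = some a := by
          intro m hm
          have h := (hs _ _).2 ⟨hm, rfl⟩
          generalize fm m = d at h
          cases h with
          | work => exact ⟨_, rfl⟩
          | ask hg => rw [hq] at hg; cases hg
        have hs' : s = (M.acts (M.view x c)).toFinset.image some := by
          ext m
          rw [Finset.mem_image]
          constructor
          · intro hm
            obtain ⟨a, rfl⟩ := hsome m hm
            exact ⟨a, List.mem_toFinset.2 ((hmem a).2 hm), rfl⟩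
          · rintro ⟨a, ha, rfl⟩
            exact (hmem a).1 (List.mem_toFinset.1 ha)
        have hsum : (((M.acts (M.view x c)).map fun a => wp x K em (Prog.workStep a) F σ₁).sum) =
            ((∑ m ∈ s, ν m : ℕ) : ZMod p) := by
          rw [Nat.cast_sum, ← List.sum_toFinset _ (Machine.nodup_acts _)]
          conv_rhs => rw [hs']
          rw [Finset.sum_image (fun _ _ _ _ h => Option.some.inj h)]
          refine Finset.sum_congr rfl fun a ha => ?_
          have ha' := List.mem_toFinset.1 ha
          have hen := Machine.mem_acts.1 ha'
          obtain ⟨σ', hd, h'⟩ := det_workStep hK hS hdet hc h₁ hs₁ hq hen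
          rw [hd.wp_eq]
          exact hih _ ((hmem a).1 ha') σ' (((hs _ _).1 (.work hq hen)).2 ▸ h')
        rw [← hsum, show M.query (M.view x c).1 = none from hq]
        rcases ha : M.acts (M.view x c) with _ | ⟨a, l⟩
        · obtain ⟨m, hm⟩ := hne
          obtain ⟨a, rfl⟩ := hsome m hm
          have := (hmem a).2 hm
          rw [ha] at this
          simp at this
        · exact wp_anyOf _ _
      · have hstep : M.Step f x c none { c with state := g (f c.out), out := [] } := .ask hq
        obtain ⟨hm, hfm⟩ := (hs _ _).1 hstep
        -- A query state has a single successor in the oracle machine, whereas its simulation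
        -- branches over all answers.
        have hs' : s = {none} := by
          refine Finset.eq_singleton_iff_unique_mem.2 ⟨hm, fun m hm' => ?_⟩
          have h := (hs _ _).2 ⟨hm', rfl⟩
          generalize fm m = d at h
          cases h with
          | work hq' _ => rw [hq] at hq'; cases hq'
          | ask _ => rfl
        rw [show M.query (M.view x c).1 = some g from hq]
        simp only []
        -- All answers but the true one vanish modulo `p`, including everything that would follow
        -- them.
        rw [wp_anyOf, ← List.sum_toFinset _ (nodup_elems R), Finset.sum_eq_single (f c.out)]
        · obtain ⟨σ', hw', h'⟩ := wp_askStep hK hS hT q (fun r => w r c.out) (fun r => hw r c hc) h₁ hs₁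
            hq F (f c.out)
          rw [hw', nsmul_eq_mul, hw1, one_mul, hih none hm σ' (hfm ▸ h'), hs', Finset.sum_singleton]
        · intro r _ hr
          obtain ⟨σ', hw', -⟩ := wp_askStep hK hS hT q (fun r => w r c.out) (fun r => hw r c hc) h₁ hs₁
            hq F r
          rw [hw', nsmul_eq_mul, hw0 r _ hr.symm, zero_mul]
        · exact fun hno => absurd (List.mem_toFinset.2 (mem_elems _)) hno

end Simulation

/-! ### Elimination of the oracle -/

theorem numAccOut_nil {A : Type} (M : Machine A Empty) (x : List A) :
    M.numAccOut x [] = M.numAcc x := by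
  unfold Machine.numAccOut Machine.numAcc
  congr 1
  funext c
  exact propext (and_iff_left (Subsingleton.elim _ _))

theorem exists_sharpL_cast_eq {p e : ℕ} (hp : p.Prime) {A B : Type} [Finite A] [Finite B]
    {f : List B → ZMod (p ^ e)} (hf : f ∈ SharpModL (p ^ e) B) {φ : List A → ℕ}
    (hφ : φ ∈ SharpLOracle f A) : ∃ ψ ∈ SharpL A, ∀ x, (ψ x : ZMod p) = φ x := by
  classical
  obtain ⟨M, ⟨C, hC⟩, hdet, hφ⟩ := hφ
  have : NeZero (p ^ e) := ⟨(Nat.pow_pos hp.pos).ne'⟩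
  obtain ⟨κ, hκ, q, D, w, hw1, hw0, hq⟩ := exists_residue_prog hp hf Empty
  obtain ⟨E, hE⟩ := exists_big M.toMachine C 0
  -- The term `E` is for the configurations and the time of the oracle machine. Queries are shorter
  -- than `(|x| + 2) ^ (E + 1)`, and the confirming program needs the `D`-th power of that, whence
  -- `E * D + D`.
  obtain ⟨N, hN, hcount⟩ := exists_machine (Prog.oracleSim (M := M) q) (E + E * D + D)
  refine ⟨N.numAcc, ⟨N, hN, fun _ => rfl⟩, fun x => ?_⟩
  set K := capFor (E + E * D + D) x.length with hKdef
  have hpow : ∀ m ≤ E + E * D + D, (x.length + 2) ^ m ≤ K := fun m hm =>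
    (Nat.pow_le_pow_right (by omega) hm).trans (pow_le_capFor _ _)
  obtain ⟨hK, hT⟩ := hE x K (hpow E (by omega))
  -- The time bound is taken again with `K` replaced by the exact power, because the length of the
  -- queries needs an explicit polynomial bound.
  have hT' := (hE x _ le_rfl).2
  have hR : ∀ c, M.Reach f x c → (c.out.length + 2) ^ D ≤ K := by
    rintro c ⟨l, hl⟩
    have h1 := OracleMachine.length_out_le hl
    have h2 := (hC x l c hl).1
    have h3 : c.out.length + 2 ≤ (x.length + 2) ^ (E + 1) := by
      rw [pow_succ]
      simp only [Machine.init, List.length_nil] at h1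
      nlinarith
    refine (Nat.pow_le_pow_left h3 D).trans ?_
    rw [← pow_mul]
    exact hpow _ (by rw [add_mul]; omega)
  obtain ⟨n, hn⟩ := exists_run (step := M.Step f x) (acc := fun c => c.state ∈ M.accept)
    (ok := fun c => ∀ t, c.workHead t ≤ C * (Nat.log 2 x.length + 1))
    (fun c => match M.query c.state with
      | some _ => {none}
      | none => (M.enabled x c).toFinite.toFinset.image some)
    (fun c m => match m with
      | some a => M.apply x c a
      | none => match M.query c.state with
        | some g => { c with state := g (f c.out), out := [] }
        | none => c)
    (fun c m c' => by
      constructor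
      · intro h
        cases h with
        | work hq ha => simp [hq, ha]
        | ask hq => simp [hq]
      · rintro ⟨hm, rfl⟩
        rcases hq : M.query c.state with _ | g
        · rw [hq] at hm
          simp only [Finset.mem_image, Set.Finite.mem_toFinset] at hm
          obtain ⟨a, ha, rfl⟩ := hm
          exact .work hq ha
        · rw [hq] at hm
          rw [Finset.mem_singleton] at hm
          subst hm
          exact .ask hq) (C * (x.length + 1) ^ C) M.init (hC x)
  rw [hφ, OracleMachine.numAcc, hn.numBranches_eq, ← numAccOut_nil, hcount]
  -- Evaluation at the empty output, followed by reduction modulo `p`. Nothing is lost, as the empty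
  -- word is the only output over an empty alphabet.
  let ev : (List Empty → ℕ) →+ ZMod p :=
    (Nat.castAddMonoidHom (ZMod p)).comp (Pi.evalAddMonoidHom _ [])
  refine (map_wp ev (em := emitOut) (em' := fun b : Empty => b.elim) (fun b : Empty => b.elim)
    (Prog.oracleSim (M := M) q) (fun _ o => if o = [] then 1 else 0) (fun _ => 0)).trans ?_
  have hone : (fun σ : OReg M.Tape κ → ℕ => ev ((fun _ o => if o = [] then 1 else 0) σ)) =
      fun _ => 1 := by
    funext σ
    simp [ev]
  rw [hone, Prog.oracleSim, (Det.setmax _).wp_seq, wp, wp, upd_same]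
  refine iterate_oracleStep (f := f) (c := M.init) hK (fun c ⟨l, hl⟩ => (hC x l c hl).2)
    (fun l c hl => (hC x l c hl).1.trans (by omega)) hdet q w
    (fun r c hc ρ => hq r c.out K (hR c hc) _ ρ) hw1 hw0 K _ n hn (by omega) ⟨[], .nil _⟩ ?_
  exact ⟨by simp, by simp, by simpa using Enc.init M.toMachine x _, by simp [Machine.init],
    fun h => absurd rfl h⟩

/-! ## Oracle machines that make no queries -/

/-- Even a machine that never asks has to be given some oracle from the class. -/
theorem sharpL_nonempty (A : Type) : (SharpL A).Nonempty := by
  let M : Machine A Empty :=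
    { State := Unit, Sym := Unit, Tape := Empty, finite_state := inferInstance,
      finite_sym := inferInstance, finite_tape := inferInstance, blank := (), start := (),
      accept := ∅, instr := fun _ _ _ => ∅ }
  refine ⟨M.numAcc, M, ⟨0, fun x l c hl => ?_⟩, fun _ => rfl⟩
  refine ⟨?_, fun i => i.elim⟩
  cases hl with
  | nil => simp
  | cons hs _ => exact hs.1.elim

/-- The machine `M` as an oracle machine that makes no queries. -/
def Machine.toOracle {A : Type} (M : Machine A Empty) (B R : Type) : OracleMachine A B R where
  State := M.State
  Sym := M.Sym
  Tape := M.Tape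
  finite_state := M.finite_state
  finite_sym := M.finite_sym
  finite_tape := M.finite_tape
  blank := M.blank
  start := M.start
  accept := M.accept
  instr q s w := (fun a => ⟨a.next, a.write, a.moveWork, a.moveInput, none⟩) '' M.instr q s w
  query _ := none

section ToOracle

variable {A B R : Type} {M : Machine A Empty} {f : List B → R} {x : List A}

/-- The corresponding configuration of the oracle machine. -/
def toOracleCfg (B R : Type) (c : M.Cfg) : (M.toOracle B R).Cfg :=
  ⟨c.state, c.inputHead, c.work, c.workHead, []⟩

def toOracleAct (B R : Type) (a : M.Act) : (M.toOracle B R).Act :=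
  ⟨a.next, a.write, a.moveWork, a.moveInput, none⟩

theorem toOracleAct_injective : Function.Injective (toOracleAct (M := M) B R) := by
  rintro ⟨_, _, _, _, e⟩ ⟨_, _, _, _, e'⟩ h
  simp only [toOracleAct] at h
  obtain ⟨rfl, rfl, rfl, rfl, -⟩ := h
  rw [Subsingleton.elim e e']

theorem step_toOracle {c : M.Cfg} {m d} : (M.toOracle B R).Step f x (toOracleCfg B R c) m d ↔
    ∃ a c', m = some (toOracleAct B R a) ∧ d = toOracleCfg B R c' ∧ M.Step x c a c' := by
  constructor
  · intro h
    cases h with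
    | work _ ha =>
      obtain ⟨a, ha, rfl⟩ := ha
      exact ⟨a, _, rfl, rfl, ha, rfl⟩
    | ask h => cases h
  · rintro ⟨a, c', rfl, rfl, ha, rfl⟩
    exact .work rfl ⟨a, ha, rfl⟩

theorem branch_toOracle {c : M.Cfg} {l d} :
    Branch ((M.toOracle B R).Step f x) (toOracleCfg B R c) l d ↔
      ∃ l' c', l = l'.map (fun a => some (toOracleAct B R a)) ∧ d = toOracleCfg B R c' ∧
        Branch (M.Step x) c l' c' := by
  constructor
  · intro h
    generalize hc : toOracleCfg B R c = c₁ at h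
    induction h generalizing c with
    | nil => exact ⟨[], c, rfl, hc.symm, .nil _⟩
    | cons hs _ ih =>
      subst hc
      obtain ⟨a, c', rfl, rfl, ha⟩ := step_toOracle.1 hs
      obtain ⟨l', c'', rfl, rfl, hl⟩ := ih rfl
      exact ⟨a :: l', c'', rfl, rfl, .cons ha hl⟩
  · rintro ⟨l', c', rfl, rfl, h⟩
    induction h with
    | nil => exact .nil _
    | cons hs _ ih => exact .cons (step_toOracle.2 ⟨_, _, rfl, rfl, hs⟩) ih

/-- Relabelling the moves is injective and carries the accepting branches of one machine exactly
onto those of the other. -/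
theorem numAcc_toOracle : (M.toOracle B R).numAcc f x = M.numAcc x := by
  have hinj : Function.Injective (List.map fun a : M.Act => some (toOracleAct B R a)) :=
    List.map_injective_iff.2 fun a b h => toOracleAct_injective (Option.some.inj h)
  unfold OracleMachine.numAcc Machine.numAcc numBranches
  rw [← Set.ncard_image_of_injective _ hinj]
  congr 1
  ext l
  constructor
  · rintro ⟨d, hd, hno, hacc⟩
    obtain ⟨l', c', rfl, rfl, h⟩ := (branch_toOracle (c := M.init)).1 hd
    exact ⟨l', ⟨c', h, fun m d hs => hno _ _ (step_toOracle.2 ⟨_, _, rfl, rfl, hs⟩), hacc⟩, rfl⟩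
  · rintro ⟨l', ⟨c', h, hno, hacc⟩, rfl⟩
    refine ⟨toOracleCfg B R c', (branch_toOracle (c := M.init)).2 ⟨_, _, rfl, rfl, h⟩, ?_, hacc⟩
    intro m d hs
    obtain ⟨a, c'', -, -, ha⟩ := step_toOracle.1 hs
    exact hno _ _ ha

theorem sharpL_subset_oracle (f : List B → R) : SharpL A ⊆ SharpLOracle f A := by
  rintro φ ⟨M, ⟨C, hC⟩, hφ⟩
  refine ⟨M.toOracle B R, ⟨C, fun x l d hd => ?_⟩, fun x l d hd _ h => ?_, fun x => ?_⟩
  · obtain ⟨l', c', rfl, rfl, h⟩ := (branch_toOracle (c := M.init)).1 hd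
    have := hC x l' c' h
    rw [List.length_map]
    exact this
  -- The oracle tape stays empty and nothing is ever written on it, so the convention on queries
  -- holds vacuously.
  · obtain ⟨l', c', rfl, rfl, -⟩ := (branch_toOracle (c := M.init)).1 hd
    rcases h with h | ⟨a, ⟨a', -, rfl⟩, h⟩
    · exact absurd rfl h
    · exact absurd rfl h
  · rw [numAcc_toOracle, hφ]

end ToOracle

end ModLog

theorem mainTheorem8 (p e : ℕ) (hp : p.Prime) (he : 1 ≤ e) :
    (∀ (A B : Type) [Finite A] [Finite B] (enc : ZMod (p ^ e) → List B),
      Function.Injective enc →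
      ∀ f ∈ ModLog.SharpModL (p ^ e) A,
        (PFun.lift (fun x => enc (f x)) : List A →. List B) ∈ ModLog.FUL p A B) ∧
    (∀ (A B : Type) [Finite A] [Finite B],
      ModLog.CoModLOracle p (ModLog.SharpModL (p ^ e) B) A = ModLog.CoModL p A) := by
  refine ⟨fun A B _ _ enc _ f hf => ModLog.lift_mem_FUL hp enc hf, fun A B _ _ => ?_⟩
  ext L
  constructor
  · rintro ⟨f, hf, φ, hφ, hL⟩
    obtain ⟨ψ, hψ, h⟩ := ModLog.exists_sharpL_cast_eq hp hf hφ
    refine ⟨ψ, hψ, fun x => ?_⟩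
    rw [hL, ← ZMod.natCast_eq_natCast_iff, ← ZMod.natCast_eq_natCast_iff, h]
  · rintro ⟨φ, hφ, hL⟩
    obtain ⟨φ₀, h₀⟩ := ModLog.sharpL_nonempty B
    exact ⟨fun x => (φ₀ x : ZMod (p ^ e)), ⟨φ₀, h₀, fun _ => rfl⟩, φ,
      ModLog.sharpL_subset_oracle _ hφ, hL⟩
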